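/- For $A\subseteq\mathbb N_0$ and $m\ge 1$ let $W^A_m=\{T\subseteq\{1,\dots,m\} : |T|\in A\}$, a Boolean relation of arity $m$ (a $0/1$-tuple is identified with the set of its $1$-positions), and let $W^A$ be the constraint language $\{W^A_i\}_{i\ge 1}$, where $i$ is the index of $W^A_i$. For a constraint language $\Gamma=\{R_i\}_{i\ge1}$, a constraint over a set $V$ of variables is a relation $R_i$ of $\Gamma$, given by its index, applied to a tuple $(v_1,\dots,v_r)\in V^r$, where $r\geq 1$ is the arity of $R_i$ (variables may repeat). It is satisfied by $D\subseteq V$ if $\{j : v_j\in D\}\in R_i$. An instance of $\mathrm{CSP}(\Gamma)_{k}$ is a pair $I=(V,C)$ of a finite nonempty set $V=\{v_1,\dots,v_m\}$ of variables and a finite sequence $C$ of constraints over $V$, the first of which is $W^{\{k_0\}}_{m}\langle v_1,\dots,v_m\rangle$ for some $k_0\in\mathbb N_0$ and all others of which are constraints for $\Gamma$; numbers are encoded in binary. The question is whether some $D\subseteq V$ satisfies all constraints. Let $k(I)=k_0$, let $u(I)$ be the number of constraints in $C$, and let $e(I)$ be the maximum, over all constraints in $C$ and all variables $v\in V$, of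 the number of occurrences of $v$ in the constraint. A list of parameters as a subscript means that the problem is parameterized by their sum: $\mathrm{CSP}(\Gamma)_{k,u,e}$ by $k+u+e$ and $\mathrm{CSP}(\Gamma)_{k,u}$ by $k+u$. A parameterized problem is a set $Q$ of words over a finite alphabet together with a polynomial time computable function $\kappa$ from words to natural numbers; it is fixed-parameter tractable if some Turing machine decides $x\in Q$ for every word $x$ in at most $f(\kappa(x))\cdot p(|x|)$ steps, for some computable function $f$ and some polynomial $p$. A constraint language $\Gamma=\{R_i\}_{i\ge1}$ is fpt membership checkable if there are a Turing machine, a computable function $f:\mathbb N_0\to\mathbb N_0$ and an integer $c\ge0$ such that, for every $i\ge 1$ and every $T\subseteq\{1,\dots,r\}$, $r$ being the arity of $R_i$, the machine decides on input $(i,T)$ (the number $i$ and the list of the elements of $T$, in binary) whether $T\in R_i$ in at most $f(|T|)\,\ell(i)^c$ steps, where $\ell(i)$ is the length of the binary representation of $i$. **Theorem.** Let $E\subseteq\mathbb N_0$. 1. If $W^E$ is fpt membership checkable, then $\mathrm{CSP}(W^E)_{k,u,e}$ is fixed-parameter tractable. 2. If $E$ or $\mathbb N_0\setminus E$ is finite,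 then $\mathrm{CSP}(W^E)_{k,u}$ is fixed-parameter tractable. -/

import Mathlib

namespace ParamCSP

open Turing Computability

/-! ### Fixed-parameter tractability -/

/-- The Turing machine `M` (Mathlib's finite multi-stack machines `Turing.FinTM2`), started on the
word `x`, halts with output `1` if `P` holds and with output `0` otherwise, after at most `n`
steps. -/
def AnswersWithin {α : Type} (M : TM2ComputableAux α Bool) (x : List α) (P : Prop) (n : ℕ) :
    Prop :=
  ∃ b : Bool, (b = true ↔ P) ∧
    Nonempty (TM2OutputsInTime M.tm (x.map M.inputAlphabet.invFun)
      (some ((encodeBool b).map M.outputAlphabet.invFun)) n)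

/-- The parameterized problem `(Q, κ)` over the alphabet `α` is fixed-parameter tractable:
`κ` is a polynomial time computable function on words (its values are written in binary), and
some Turing machine decides `Q` in time `f (κ x) * p |x|`, with `f` computable and `p` a
polynomial. -/
structure FixedParameterTractable {α : Type} (Q : Set (List α)) (κ : List α → ℕ) : Prop where
  parameterization : Nonempty (TM2ComputableInPolyTime (id : List α → List α) encodeNat κ)
  decided : ∃ (M : TM2ComputableAux α Bool) (f : ℕ → ℕ) (p : Polynomial ℕ), Computable f ∧
    ∀ x : List α, AnswersWithin M x (x ∈ Q) (f (κ x) * p.eval x.length)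

/-! ### Words -/

/-- The alphabet in which instances are written. -/
inductive Letter : Type
  | bit (b : Bool)
  | comma
  | semicolon

/-- A number in binary followed by a list of binary words: `n,w₁,…,wₗ`. -/
def encodeBlock (n : ℕ) (ws : List (List Bool)) : List Letter :=
  (encodeNat n).map Letter.bit ++ ws.flatMap fun w => Letter.comma :: w.map Letter.bit

/-! ### Constraint languages -/

/-- A Boolean constraint language `Γ = {R_i}` indexed by the positive integers. A tuple of a
relation of arity `r` is identified with the set of its `1`-positions, a subset of `Fin r`. -/
structure ConstraintLanguage where
  arity : ℕ+ → ℕ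
  arity_pos : ∀ i, 1 ≤ arity i
  rel : ∀ i, Set (Finset (Fin (arity i)))

/-- The relation `W^A_m = {T ⊆ [m] | |T| ∈ A}`. -/
def weightRel (A : Set ℕ) (m : ℕ) : Set (Finset (Fin m)) :=
  {T | T.card ∈ A}

/-- The constraint language `W^A = {W^A_i}`, where `i` runs over the positive integers. -/
def weightLanguage (A : Set ℕ) : ConstraintLanguage where
  arity i := i
  arity_pos i := i.pos
  rel i := weightRel A i

/-- `Γ` is fpt membership checkable: some Turing machine decides on input `(i, T)`, where
`T ⊆ [arity R_i]`, whether `T ∈ R_i`, in time `f |T| * (log i)^c`, with `f` computable. Here `i` is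
written in binary and `T` is given by the increasing list of its elements in binary, and `log i`
is the length `Nat.size i` of the binary representation of `i`. -/
def FptMembershipCheckable (Γ : ConstraintLanguage) : Prop :=
  ∃ (B : TM2ComputableAux Letter Bool) (f : ℕ → ℕ) (c : ℕ), Computable f ∧
    ∀ (i : ℕ+) (T : Finset (Fin (Γ.arity i))),
      AnswersWithin B (encodeBlock i (T.sort.map fun j => encodeNat (j.val + 1)))
        (T ∈ Γ.rel i) (f T.card * (i : ℕ).size ^ c)

/-! ### Constraints and instances -/

/-- Variable symbols are binary words. -/
abbrev Variable : Type := List Bool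

/-- A Boolean relation `R` of arity `arity` applied to a tuple `scope` of variables: `R⟨ω⟩`. -/
structure AppliedRelation where
  arity : ℕ
  rel : Set (Finset (Fin arity))
  scope : Fin arity → Variable

/-- The assignment `D` satisfies `R⟨ω⟩`: the set of positions `j` with `ω j ∈ D` belongs to `R`. -/
def AppliedRelation.SatisfiedBy (ψ : AppliedRelation) (D : Finset Variable) : Prop :=
  (Finset.univ.filter fun j => ψ.scope j ∈ D) ∈ ψ.rel

/-- The number of occurrences of the variable `v` in `R⟨ω⟩`, that is, `|ω⁻¹(v)|`. -/
def AppliedRelation.occurrences (ψ : AppliedRelation) (v : Variable) : ℕ :=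
  (Finset.univ.filter fun j => ψ.scope j = v).card

/-- A constraint for `Γ`: the index of a relation of `Γ` and a tuple of variables. -/
structure Constraint (Γ : ConstraintLanguage) where
  index : ℕ+
  scope : Fin (Γ.arity index) → Variable

def Constraint.toApplied {Γ : ConstraintLanguage} (c : Constraint Γ) : AppliedRelation :=
  ⟨Γ.arity c.index, Γ.rel c.index, c.scope⟩

/-- An instance `(V, C)` of the weighted CSP over `Γ`. Its variables are `V = {v₁, …, vₘ}`, listed
without repetition in `vars`, and `m ≥ 1`. Its first constraint is `W^{k₀}_m⟨v₁, …, vₘ⟩` with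
`k₀ = weight`; the remaining ones, listed in `constraints`, are constraints for `Γ` over `V`. -/
structure Instance (Γ : ConstraintLanguage) where
  vars : List Variable
  vars_nodup : vars.Nodup
  vars_ne_nil : vars ≠ []
  weight : ℕ
  constraints : List (Constraint Γ)
  scope_mem : ∀ c ∈ constraints, ∀ j, c.scope j ∈ vars

namespace Instance

variable {Γ : ConstraintLanguage}

/-- The set `V` of variables. -/
def V (I : Instance Γ) : Finset Variable := I.vars.toFinset

/-- The sequence `C` of all constraints, the first one being the weight constraint. -/
def C (I : Instance Γ) : List AppliedRelation :=
  ⟨I.vars.length, weightRel {I.weight} I.vars.length, I.vars.get⟩ ::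
    I.constraints.map Constraint.toApplied

/-- Some assignment `D ⊆ V` satisfies every constraint. -/
def Satisfiable (I : Instance Γ) : Prop :=
  ∃ D ⊆ I.V, ∀ ψ ∈ I.C, ψ.SatisfiedBy D

/-- The parameter `k`, the weight of a satisfying assignment. -/
def k (I : Instance Γ) : ℕ := I.weight

/-- The parameter `u`, the number of constraints. -/
def u (I : Instance Γ) : ℕ := I.C.length

/-- The parameter `e`, the maximum number of occurrences of a variable in a constraint. -/
def e (I : Instance Γ) : ℕ :=
  I.V.sup fun v => (I.C.map fun ψ => ψ.occurrences v).foldr max 0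

/-- An instance as a word: `k₀,v₁,…,vₘ` followed by one block `;i,w₁,…,wᵣ` for each constraint
`R_i⟨w₁, …, wᵣ⟩`. -/
def encode (I : Instance Γ) : List Letter :=
  encodeBlock I.weight I.vars ++
    I.constraints.flatMap fun c => Letter.semicolon :: encodeBlock c.index (List.ofFn c.scope)

end Instance

/-! ### Instances are determined by their words -/

theorem append_sep_inj {α : Type} {s : α} {a a' l l' : List α} (ha : s ∉ a) (ha' : s ∉ a')
    (hl : l = [] ∨ ∃ t, l = s :: t) (hl' : l' = [] ∨ ∃ t, l' = s :: t)
    (h : a ++ l = a' ++ l') : a = a' ∧ l = l' := by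
  induction a generalizing a' with
  | nil =>
    cases a' with
    | nil => exact ⟨rfl, h⟩
    | cons y a' =>
      rcases hl with rfl | ⟨t, rfl⟩ <;> simp_all
  | cons x a ih =>
    cases a' with
    | nil => rcases hl' with rfl | ⟨t, rfl⟩ <;> simp_all
    | cons y a' =>
      simp only [List.cons_append, List.cons.injEq] at h
      simp only [List.mem_cons, not_or] at ha ha'
      obtain ⟨h1, h2⟩ := ih ha.2 ha'.2 h.2
      exact ⟨by rw [h.1, h1], h2⟩

theorem flatMap_sep_shape {α β : Type} (s : α) (f : β → List α) (l : List β) :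
    (l.flatMap fun b => s :: f b) = [] ∨ ∃ t, (l.flatMap fun b => s :: f b) = s :: t := by
  cases l with
  | nil => exact Or.inl rfl
  | cons b l => exact Or.inr ⟨f b ++ l.flatMap fun b => s :: f b, by simp⟩

theorem flatMap_sep_inj {α β : Type} {s : α} {f : β → List α} (hs : ∀ b, s ∉ f b)
    (hf : Function.Injective f) :
    Function.Injective fun l : List β => l.flatMap fun b => s :: f b := by
  intro l
  induction l with
  | nil => intro l' h; cases l' <;> simp_all
  | cons b l ih =>
    intro l' h
    cases l' with
    | nil => simp at h
    | cons b' l' =>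
      simp only [List.flatMap_cons, List.cons_append, List.cons.injEq, true_and] at h
      obtain ⟨h1, h2⟩ := append_sep_inj (hs b) (hs b') (flatMap_sep_shape s f l)
        (flatMap_sep_shape s f l') h
      rw [hf h1, ih h2]

theorem semicolon_notMem_encodeBlock (n : ℕ) (ws : List (List Bool)) :
    Letter.semicolon ∉ encodeBlock n ws := by
  simp [encodeBlock]

theorem bit_injective : Function.Injective Letter.bit := fun _ _ h => by injection h

theorem encodeBlock_inj {n n' : ℕ} {ws ws' : List (List Bool)}
    (h : encodeBlock n ws = encodeBlock n' ws') : n = n' ∧ ws = ws' := by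
  obtain ⟨h1, h2⟩ := append_sep_inj (s := Letter.comma) (by simp) (by simp)
    (flatMap_sep_shape _ _ _) (flatMap_sep_shape _ _ _) h
  refine ⟨?_, flatMap_sep_inj (s := Letter.comma) (by simp)
    (List.map_injective_iff.2 bit_injective) h2⟩
  have h3 := List.map_injective_iff.2 bit_injective h1
  rw [← decode_encodeNat n, h3, decode_encodeNat]

theorem Instance.encode_injective (Γ : ConstraintLanguage) :
    Function.Injective (Instance.encode (Γ := Γ)) := by
  intro I J h
  obtain ⟨h1, h2⟩ := append_sep_inj (s := Letter.semicolon)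
    (semicolon_notMem_encodeBlock _ _) (semicolon_notMem_encodeBlock _ _)
    (flatMap_sep_shape _ _ _) (flatMap_sep_shape _ _ _) h
  have h3 := flatMap_sep_inj (s := Letter.semicolon)
    (f := fun c : Constraint Γ => encodeBlock c.index (List.ofFn c.scope))
    (fun c => semicolon_notMem_encodeBlock _ _) (by
      rintro ⟨i, s⟩ ⟨j, t⟩ hc
      obtain ⟨hi, hst⟩ := encodeBlock_inj hc
      obtain rfl : i = j := PNat.coe_injective hi
      have hst' : s = t := List.ofFn_injective hst
      rw [hst']) h2
  obtain ⟨h4, h5⟩ := encodeBlock_inj h1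
  cases I
  cases J
  simp_all

/-! ### The parameterized problem -/

/-- The problem `CSP(Γ)` with weight constraint: the set of words of the satisfiable instances. -/
def weightedCSP (Γ : ConstraintLanguage) : Set (List Letter) :=
  {x | ∃ I : Instance Γ, I.encode = x ∧ I.Satisfiable}

/-- The function on words that takes the value `param I` at the word of the instance `I`, and the
value `1` at words that are not the word of any instance. -/
noncomputable def parameterOnWords {Γ : ConstraintLanguage} (param : Instance Γ → ℕ) :
    List Letter → ℕ :=
  Function.extend Instance.encode param fun _ => 1

end ParamCSP

/-! Judge an assignment `D` by its size and by its numbers of hits in the scopes, all truncated at a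
bound `M`. A new variable `v` raises each hit number by the number of occurrences of `v`, whatever
`D` is. So assignments with equal truncated `signature` remain indistinguishable under all further
extensions, and dynamic programming over the variables may keep one assignment per signature, at
most `(M + 1) ^ u` in total (`signature_cons`, `representatives_complete`,
`length_representatives`). If `k < M`, the truncated size still tells whether the weight is `k`, and
the last test looks up the truncated hit numbers in a table of `E` on `0, …, M`. This is correct as
soon as truncation does not affect membership in `E` for assignments of weight `k`
(`solve_memTable`).

For part 1, no hit number exceeds `k * e` (`hits_le`), so `M = k * e + k + 1` truncates none of
them. The table is filled by asking the membership checker about a full set of `j` positions, which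
takes time bounded in terms of `j` alone (`membershipQuery_outputs`). For part 2, membership in `E`
is constant from some `b` on, so `M = k + b + 1` works without reference to `e`, and the table is
read off a fixed finite list.

The remaining work shows that Turing machines do this within the time bounds. Structured programs
over stacks, with the checker as a subroutine, are compiled to machines; the data are binary trees.
`PolyIn B μ f` expresses time polynomial in a measure `μ` that dominates the size, and it is closed
under composition, folds and arithmetic. With `μ = size + S`, where `S` collects the costs that
depend on the parameter and is at most a computable function of it, polynomial time becomes
fixed-parameter time, because `p (m * n) ≤ p m * p n` separates the two factors (`poly_mul_le`,
`fixedParameterTractable_of_solve`). The parameter itself needs honest polynomial time although the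
weight is written in binary; the other summands are small and are added by incrementing the binary
word (`encode_parameterOnWords`). -/

namespace ParamCSP

open Turing Computability StateTransition

section

/-! ### Structured programs over several stacks -/

/-- The working stacks of a program. -/
inductive Reg : Type
  | inp | main | save | wkA | wkB | cnt
  deriving DecidableEq

instance : Fintype Reg :=
  ⟨⟨{.inp, .main, .save, .wkA, .wkB, .cnt}, by decide⟩, by rintro (_ | _) <;> decide⟩

/-- All stacks: the working stacks, the output stack and the stacks of the subroutine. -/
inductive Stk (κ : Type) : Type
  | base (r : Reg)
  | out
  | orc (k : κ)
  deriving DecidableEq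

instance {κ : Type} [Fintype κ] : Fintype (Stk κ) :=
  Fintype.ofEquiv (Reg ⊕ Unit ⊕ κ)
    { toFun := Sum.elim .base (Sum.elim (fun _ => .out) .orc)
      invFun := fun
        | .base r => .inl r
        | .out => .inr (.inl ())
        | .orc k => .inr (.inr k)
      left_inv := by rintro (_ | _ | _) <;> rfl
      right_inv := by rintro (_ | _ | _) <;> rfl }

noncomputable instance : Fintype Letter :=
  haveI : Finite Letter := Finite.of_surjective
    (Sum.elim Letter.bit fun b : Bool => bif b then .comma else .semicolon) (by
      rintro (b | _ | _)
      exacts [⟨.inl b, rfl⟩, ⟨.inr true, rfl⟩, ⟨.inr false, rfl⟩])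
  Fintype.ofFinite _

variable (B : TM2ComputableAux Letter Bool)

/-- The alphabets of the stacks. -/
abbrev Sym : Stk B.tm.K → Type
  | .base _ => Letter
  | .out => Bool
  | .orc k => B.tm.Γ k

/-- Structured programs. -/
inductive Cmd : Type
  /-- pop a symbol and push symbols that depend on it -/
  | act (k : Stk B.tm.K) (f : Option (Sym B k) → Option Letter)
      (ps : List (Σ k : Stk B.tm.K, Option Letter → Sym B k))
  /-- push a symbol -/
  | push (k : Stk B.tm.K) (x : Sym B k)
  /-- branch on the top of a stack -/
  | ite (k : Stk B.tm.K) (p : Option (Sym B k) → Bool) (c d : Cmd)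
  /-- iterate while the top of a stack satisfies a condition -/
  | loop (k : Stk B.tm.K) (p : Option (Sym B k) → Bool) (c : Cmd)
  | seq (c d : Cmd)
  /-- run the subroutine -/
  | call

variable {B}

/-- The labels of the machine of a program. -/
def Cmd.Lab : Cmd B → Type
  | act _ _ _ => Unit
  | push _ _ => Unit
  | ite _ _ c d => Unit ⊕ (c.Lab ⊕ d.Lab)
  | loop _ _ c => Unit ⊕ c.Lab
  | seq c d => c.Lab ⊕ d.Lab
  | call => B.tm.Λ

def Cmd.entry : (c : Cmd B) → c.Lab
  | act _ _ _ => ()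
  | push _ _ => ()
  | ite _ _ _ _ => Sum.inl ()
  | loop _ _ _ => Sum.inl ()
  | seq c _ => Sum.inl c.entry
  | call => B.tm.main

noncomputable instance Cmd.fintypeLab (c : Cmd B) : Fintype c.Lab :=
  haveI : Finite c.Lab := by
    induction c with
    | act => exact inferInstanceAs (Finite Unit)
    | push => exact inferInstanceAs (Finite Unit)
    | ite _ _ c d => exact inferInstanceAs (Finite (Unit ⊕ (c.Lab ⊕ d.Lab)))
    | loop _ _ c => exact inferInstanceAs (Finite (Unit ⊕ c.Lab))
    | seq c d => exact inferInstanceAs (Finite (c.Lab ⊕ d.Lab))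
    | call => exact @Finite.of_fintype _ B.tm.ΛFin
  Fintype.ofFinite _

variable (B) in
/-- The internal states of the machine of a program. -/
abbrev St : Type := Option Letter × B.tm.σ

variable (B) in
/-- The contents of all stacks. -/
abbrev Stks : Type := ∀ k, List (Sym B k)

/-- Push symbols that depend on the register, then clear the register and continue. -/
def pushes {L : Type} (exit : L) :
    List (Σ k : Stk B.tm.K, Option Letter → Sym B k) → TM2.Stmt (Sym B) L (St B)
  | [] => .load (fun s => (none, s.2)) (.goto fun _ => exit)
  | p :: ps => .push p.1 (fun s => p.2 s.1) (pushes exit ps)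

/-- A statement of the subroutine as a statement of the whole machine. -/
def liftStmt {L : Type} (emb : B.tm.Λ → L) (exit : L) :
    TM2.Stmt B.tm.Γ B.tm.Λ B.tm.σ → TM2.Stmt (Sym B) L (St B)
  | .push k f q => .push (.orc k) (fun s => f s.2) (liftStmt emb exit q)
  | .peek k f q => .peek (.orc k) (fun s x => (s.1, f s.2 x)) (liftStmt emb exit q)
  | .pop k f q => .pop (.orc k) (fun s x => (s.1, f s.2 x)) (liftStmt emb exit q)
  | .load a q => .load (fun s => (s.1, a s.2)) (liftStmt emb exit q)
  | .branch p q q' => .branch (fun s => p s.2) (liftStmt emb exit q) (liftStmt emb exit q')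
  | .goto f => .goto fun s => emb (f s.2)
  | .halt => .goto fun _ => exit

/-- Test the top of a stack and jump. -/
def testStmt {L : Type} (k : Stk B.tm.K) (p : Option (Sym B k) → Bool) (yes no : L) :
    TM2.Stmt (Sym B) L (St B) :=
  .peek k (fun s x => (bif p x then some .comma else none, s.2))
    (.branch (fun s => s.1.isSome)
      (.load (fun s => (none, s.2)) (.goto fun _ => yes))
      (.load (fun s => (none, s.2)) (.goto fun _ => no)))

/-- The statements of the machine of a program that continues at the label `exit`. -/
def Cmd.code : (c : Cmd B) → {L : Type} → (c.Lab → L) → L → c.Lab → TM2.Stmt (Sym B) L (St B)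
  | act k f ps, _, _, exit, _ => .pop k (fun s x => (f x, s.2)) (pushes exit ps)
  | push k x, _, _, exit, _ => .push k (fun _ => x) (.goto fun _ => exit)
  | ite k p c d, _, emb, exit, l => match l with
    | .inl _ => testStmt k p (emb (.inr (.inl c.entry))) (emb (.inr (.inr d.entry)))
    | .inr (.inl l) => c.code (fun l => emb (.inr (.inl l))) exit l
    | .inr (.inr l) => d.code (fun l => emb (.inr (.inr l))) exit l
  | loop k p c, _, emb, exit, l => match l with
    | .inl _ => testStmt k p (emb (.inr c.entry)) exit
    | .inr l => c.code (fun l => emb (.inr l)) (emb (.inl ())) l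
  | seq c d, _, emb, exit, l => match l with
    | .inl l => c.code (fun l => emb (.inl l)) (emb (.inr d.entry)) l
    | .inr l => d.code (fun l => emb (.inr l)) exit l
  | call, _, emb, exit, l => liftStmt emb exit (B.tm.m l)

/-- The machine `M` leads from `c` to `c'` in at most `n` steps. -/
def Leads {L : Type} (M : L → TM2.Stmt (Sym B) L (St B)) (c c' : TM2.Cfg (Sym B) L (St B))
    (n : ℕ) : Prop :=
  Nonempty (EvalsToInTime (TM2.step M) c (some c') n)

/-- The program `c` leads from the stacks `S` to the stacks `S'` in at most `n` steps. -/
def Runs (c : Cmd B) (S S' : Stks B) (n : ℕ) : Prop :=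
  ∀ (L : Type) (M : L → TM2.Stmt (Sym B) L (St B)) (emb : c.Lab → L) (exit : L),
    (∀ l, M (emb l) = c.code emb exit l) →
      Leads M ⟨some (emb c.entry), (none, B.tm.initialState), S⟩
        ⟨some exit, (none, B.tm.initialState), S'⟩ n

/-! ### Composition rules for runs and their times -/

section Leads

variable {L : Type} {M : L → TM2.Stmt (Sym B) L (St B)} {c₁ c₂ c₃ : TM2.Cfg (Sym B) L (St B)}
  {m n : ℕ}

theorem Leads.trans (h₁ : Leads M c₁ c₂ m) (h₂ : Leads M c₂ c₃ n) : Leads M c₁ c₃ (m + n) := by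
  obtain ⟨h₁⟩ := h₁
  obtain ⟨h₂⟩ := h₂
  rw [add_comm]
  exact ⟨EvalsToInTime.trans _ _ _ _ _ _ h₁ h₂⟩

theorem Leads.mono (h : Leads M c₁ c₂ m) (hmn : m ≤ n) : Leads M c₁ c₂ n := by
  obtain ⟨h⟩ := h
  exact ⟨⟨h.toEvalsTo, h.steps_le_m.trans hmn⟩⟩

theorem Leads.single (h : TM2.step M c₁ = some c₂) : Leads M c₁ c₂ 1 :=
  ⟨⟨⟨1, h⟩, le_rfl⟩⟩

end Leads

theorem Runs.mono {c : Cmd B} {S S' : Stks B} {m n : ℕ} (h : Runs c S S' m) (hmn : m ≤ n) :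
    Runs c S S' n :=
  fun L M emb exit hM => (h L M emb exit hM).mono hmn

/-- `Runs` quantifies over every host machine, embedding of labels and exit label. Both halves are
therefore instantiated in one host, with the entry of `d` as exit of `c`, and no machines have to be
merged. -/
theorem Runs.seq {c d : Cmd B} {S T U : Stks B} {m n : ℕ} (h₁ : Runs c S T m)
    (h₂ : Runs d T U n) : Runs (c.seq d) S U (m + n) := fun L M _ _ hM =>
  (h₁ L M _ _ fun l => hM (.inl l)).trans (h₂ L M _ _ fun l => hM (.inr l))

/-- A statement is executed up to its jump in a single step. The register is reset before the jump,
so that programs always start and end in the same internal state. -/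
theorem step_testStmt {L : Type} {M : L → TM2.Stmt (Sym B) L (St B)} {k : Stk B.tm.K}
    {p : Option (Sym B k) → Bool} {l yes no : L} (h : M l = testStmt k p yes no) (s : B.tm.σ)
    (S : Stks B) :
    TM2.step M ⟨some l, (none, s), S⟩ =
      some ⟨some (bif p (S k).head? then yes else no), (none, s), S⟩ := by
  rw [TM2.step, h, testStmt]
  cases hp : p (S k).head? <;> simp [hp]

theorem Runs.ite_true {k : Stk B.tm.K} {p : Option (Sym B k) → Bool} {c d : Cmd B}
    {S S' : Stks B} {n : ℕ} (hp : p (S k).head? = true) (h : Runs c S S' n) :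
    Runs (.ite k p c d) S S' (n + 1) := by
  intro L M emb exit hM
  have h0 := step_testStmt (hM (.inl ())) B.tm.initialState S
  rw [hp] at h0
  rw [add_comm]
  exact (Leads.single h0).trans (h L M _ _ fun l => hM (.inr (.inl l)))

theorem Runs.ite_false {k : Stk B.tm.K} {p : Option (Sym B k) → Bool} {c d : Cmd B}
    {S S' : Stks B} {n : ℕ} (hp : p (S k).head? = false) (h : Runs d S S' n) :
    Runs (.ite k p c d) S S' (n + 1) := by
  intro L M emb exit hM
  have h0 := step_testStmt (hM (.inl ())) B.tm.initialState S
  rw [hp] at h0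
  rw [add_comm]
  exact (Leads.single h0).trans (h L M _ _ fun l => hM (.inr (.inr l)))

theorem Runs.loop_false {k : Stk B.tm.K} {p : Option (Sym B k) → Bool} {c : Cmd B}
    {S : Stks B} (hp : p (S k).head? = false) : Runs (.loop k p c) S S 1 := by
  intro _ _ _ _ hM
  have h0 := step_testStmt (hM (.inl ())) B.tm.initialState S
  rw [hp] at h0
  exact Leads.single h0

theorem Runs.loop_true {k : Stk B.tm.K} {p : Option (Sym B k) → Bool} {c : Cmd B}
    {S T U : Stks B} {m n : ℕ} (hp : p (S k).head? = true) (h : Runs c S T m)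
    (h' : Runs (.loop k p c) T U n) : Runs (.loop k p c) S U (m + 1 + n) := by
  intro L M emb exit hM
  have h0 := step_testStmt (hM (.inl ())) B.tm.initialState S
  rw [hp] at h0
  rw [add_comm m]
  exact ((Leads.single h0).trans (h L M _ _ fun l => hM (.inr l))).trans (h' L M emb exit hM)

theorem Runs.push (k : Stk B.tm.K) (x : Sym B k) (S : Stks B) :
    Runs (.push k x) S (Function.update S k (x :: S k)) 1 := by
  intro _ _ _ _ hM
  refine Leads.single ?_
  rw [TM2.step, hM]
  rfl

/-- The effect on the stacks of a list of pushes. -/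
def pushAll (r : Option Letter) :
    List (Σ k : Stk B.tm.K, Option Letter → Sym B k) → Stks B → Stks B
  | [], S => S
  | p :: ps, S => pushAll r ps (Function.update S p.1 (p.2 r :: S p.1))

theorem stepAux_pushes {L : Type} (exit : L)
    (ps : List (Σ k : Stk B.tm.K, Option Letter → Sym B k)) (r : Option Letter) (s : B.tm.σ)
    (S : Stks B) :
    TM2.stepAux (pushes exit ps) (r, s) S = ⟨some exit, (none, s), pushAll r ps S⟩ := by
  induction ps generalizing S with
  | nil => simp [pushes, pushAll]
  | cons p ps ih => simp [pushes, pushAll, ih]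

theorem Runs.act (k : Stk B.tm.K) (f : Option (Sym B k) → Option Letter)
    (ps : List (Σ k : Stk B.tm.K, Option Letter → Sym B k)) (S : Stks B) :
    Runs (.act k f ps) S (pushAll (f (S k).head?) ps (Function.update S k (S k).tail)) 1 := by
  intro _ _ _ _ hM
  refine Leads.single ?_
  rw [TM2.step, hM]
  simp [Cmd.code, stepAux_pushes]

/-- The contents of all stacks, assembled. -/
def stks (ρ : Reg → List Letter) (o : List Bool) (T : ∀ k, List (B.tm.Γ k)) : Stks B
  | .base r => ρ r
  | .out => o
  | .orc k => T k

section stks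

variable (ρ : Reg → List Letter) (o : List Bool) (T : ∀ k, List (B.tm.Γ k))

@[simp] theorem stks_base (r : Reg) : stks (B := B) ρ o T (.base r) = ρ r := rfl
@[simp] theorem stks_out : stks (B := B) ρ o T .out = o := rfl
@[simp] theorem stks_orc (k : B.tm.K) : stks (B := B) ρ o T (.orc k) = T k := rfl

@[simp] theorem update_stks_base (r : Reg) (l : List Letter) :
    Function.update (stks (B := B) ρ o T) (.base r) l = stks (Function.update ρ r l) o T := by
  funext k
  rcases k with r' | _ | k
  · by_cases h : r' = r
    · subst h; simp
    · rw [Function.update_of_ne (by simpa using h)]; simp [h]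
  · rw [Function.update_of_ne (by simp)]; rfl
  · rw [Function.update_of_ne (by simp)]; rfl

@[simp] theorem update_stks_out (l : List Bool) :
    Function.update (stks (B := B) ρ o T) .out l = stks ρ l T := by
  funext k
  rcases k with r' | _ | k
  · rw [Function.update_of_ne (by simp)]; rfl
  · simp
  · rw [Function.update_of_ne (by simp)]; rfl

@[simp] theorem update_stks_orc (k : B.tm.K) (l : List (B.tm.Γ k)) :
    Function.update (stks (B := B) ρ o T) (.orc k) l = stks ρ o (Function.update T k l) := by
  funext k'
  rcases k' with r' | _ | k'
  · rw [Function.update_of_ne (by simp)]; rfl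
  · rw [Function.update_of_ne (by simp)]; rfl
  · by_cases h : k' = k
    · subst h; simp
    · rw [Function.update_of_ne (by simpa using h)]; simp [h]

end stks

/-- The configuration of the whole machine that corresponds to one of the subroutine. -/
def liftCfg {L : Type} (emb : B.tm.Λ → L) (exit : L) (ρ : Reg → List Letter) (o : List Bool)
    (c : B.tm.Cfg) : TM2.Cfg (Sym B) L (St B) :=
  ⟨some (c.l.elim exit emb), (none, c.var), stks ρ o c.stk⟩

/-- Lifting turns `halt` into a jump to `exit`, and `liftCfg` reads the missing label of a halted
configuration as `exit`; hence the simulation is exact, with no case distinction at the end. -/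
theorem stepAux_liftStmt {L : Type} (emb : B.tm.Λ → L) (exit : L) (ρ : Reg → List Letter)
    (o : List Bool) (q : TM2.Stmt B.tm.Γ B.tm.Λ B.tm.σ) (v : B.tm.σ)
    (T : ∀ k, List (B.tm.Γ k)) :
    TM2.stepAux (liftStmt emb exit q) (none, v) (stks ρ o T) =
      liftCfg emb exit ρ o (TM2.stepAux q v T) := by
  induction q generalizing v T with
  | push k f q ih => simp only [liftStmt, TM2.stepAux, stks_orc, update_stks_orc, ← ih]
  | peek k f q ih => simp only [liftStmt, TM2.stepAux, stks_orc, ← ih]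
  | pop k f q ih => simp only [liftStmt, TM2.stepAux, stks_orc, update_stks_orc, ← ih]
  | load a q ih => simp only [liftStmt, TM2.stepAux, ← ih]
  | branch p q q' ih ih' =>
    simp only [liftStmt, TM2.stepAux]
    cases p v <;> simp [ih, ih']
  | goto f => rfl
  | halt => rfl

theorem iterate_bind_none {α : Type} (f : α → Option α) (n : ℕ) :
    (flip bind f)^[n] none = none := by
  induction n with
  | zero => rfl
  | succ n ih => rw [Function.iterate_succ_apply]; exact ih

theorem iterate_liftCfg {L : Type} {M : L → TM2.Stmt (Sym B) L (St B)} {emb : B.tm.Λ → L}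
    {exit : L} (hM : ∀ l, M (emb l) = liftStmt emb exit (B.tm.m l)) (ρ : Reg → List Letter)
    (o : List Bool) (n : ℕ) (c c' : B.tm.Cfg) (h : (flip bind B.tm.step)^[n] (some c) = some c') :
    (flip bind (TM2.step M))^[n] (some (liftCfg emb exit ρ o c)) =
      some (liftCfg emb exit ρ o c') := by
  induction n generalizing c with
  | zero => cases h; rfl
  | succ n ih =>
    rw [Function.iterate_succ_apply] at h ⊢
    obtain ⟨l, v, T⟩ := c
    cases l with
    | none =>
      -- A halted configuration has no successor, so no steps can remain and this case is void.
      have : flip bind B.tm.step (some (⟨none, v, T⟩ : B.tm.Cfg)) = none := rfl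
      rw [this, iterate_bind_none] at h
      cases h
    | some l =>
      have h1 : flip bind B.tm.step (some (⟨some l, v, T⟩ : B.tm.Cfg)) =
          some (TM2.stepAux (B.tm.m l) v T) := rfl
      rw [h1] at h
      rw [← ih _ h]
      congr 1
      change TM2.step M (liftCfg emb exit ρ o ⟨some l, v, T⟩) = _
      simp [liftCfg, TM2.step, hM, stepAux_liftStmt]

/-- The subroutine can be called repeatedly because `haltList` prescribes the initial internal state
and empty stacks apart from the output. -/
theorem Runs.call {w : List (B.tm.Γ B.tm.k₀)} {w' : List (B.tm.Γ B.tm.k₁)} {n : ℕ}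
    (h : Nonempty (TM2OutputsInTime B.tm w (some w') n)) (ρ : Reg → List Letter)
    (o : List Bool) :
    Runs .call (stks ρ o (initList B.tm w).stk) (stks (B := B) ρ o (haltList B.tm w').stk) n := by
  obtain ⟨h⟩ := h
  intro L M emb exit hM
  exact ⟨⟨⟨h.steps, iterate_liftCfg hM ρ o h.steps _ _ h.evals_in_steps⟩, h.steps_le_m⟩⟩

end

section

/-! ### Moving words and trees between stacks -/

/-- Binary trees, the data of the programs. -/
inductive Tr : Type
  | nil
  | node (l r : Tr)

namespace Tr

/-- The word of a tree, in prefix notation. -/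
def enc : Tr → List Letter
  | nil => [.bit false]
  | node l r => .bit true :: (enc l ++ enc r)

/-- The number of nodes of a tree. -/
def size : Tr → ℕ
  | nil => 1
  | node l r => size l + size r + 1

def left : Tr → Tr
  | nil => nil
  | node l _ => l

def right : Tr → Tr
  | nil => nil
  | node _ r => r

def isNode : Tr → Bool
  | nil => false
  | node _ _ => true

@[simp] theorem size_nil : size nil = 1 := rfl
@[simp] theorem size_node (l r : Tr) : size (node l r) = size l + size r + 1 := rfl
@[simp] theorem left_node (l r : Tr) : left (node l r) = l := rfl
@[simp] theorem right_node (l r : Tr) : right (node l r) = r := rfl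
@[simp] theorem left_nil : left nil = nil := rfl
@[simp] theorem right_nil : right nil = nil := rfl
@[simp] theorem isNode_nil : isNode nil = false := rfl
@[simp] theorem isNode_node (l r : Tr) : isNode (node l r) = true := rfl

@[simp] theorem length_enc (t : Tr) : t.enc.length = t.size := by
  induction t with
  | nil => rfl
  | node l r ihl ihr => simp [enc, ihl, ihr]

theorem size_pos (t : Tr) : 1 ≤ t.size := by cases t <;> simp

theorem size_left (t : Tr) : t.left.size ≤ t.size := by cases t <;> simp; omega
theorem size_right (t : Tr) : t.right.size ≤ t.size := by cases t <;> simp; omega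

end Tr

/-- The working stacks, assembled. -/
def cfg (i m s a b c : List Letter) : Reg → List Letter
  | .inp => i
  | .main => m
  | .save => s
  | .wkA => a
  | .wkB => b
  | .cnt => c

section cfg

variable (i m s a b c l : List Letter)

@[simp] theorem cfg_inp : cfg i m s a b c .inp = i := rfl
@[simp] theorem cfg_main : cfg i m s a b c .main = m := rfl
@[simp] theorem cfg_save : cfg i m s a b c .save = s := rfl
@[simp] theorem cfg_wkA : cfg i m s a b c .wkA = a := rfl
@[simp] theorem cfg_wkB : cfg i m s a b c .wkB = b := rfl
@[simp] theorem cfg_cnt : cfg i m s a b c .cnt = c := rfl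
@[simp] theorem update_cfg_inp :
    Function.update (cfg i m s a b c) .inp l = cfg l m s a b c := by
  funext k; cases k <;> simp [Function.update, cfg]
@[simp] theorem update_cfg_main :
    Function.update (cfg i m s a b c) .main l = cfg i l s a b c := by
  funext k; cases k <;> simp [Function.update, cfg]
@[simp] theorem update_cfg_save :
    Function.update (cfg i m s a b c) .save l = cfg i m l a b c := by
  funext k; cases k <;> simp [Function.update, cfg]
@[simp] theorem update_cfg_wkA :
    Function.update (cfg i m s a b c) .wkA l = cfg i m s l b c := by
  funext k; cases k <;> simp [Function.update, cfg]
@[simp] theorem update_cfg_wkB :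
    Function.update (cfg i m s a b c) .wkB l = cfg i m s a l c := by
  funext k; cases k <;> simp [Function.update, cfg]

end cfg

variable {B : TM2ComputableAux Letter Bool}

namespace Cmd

/-- Do nothing. -/
abbrev skip : Cmd B := .loop .out (fun _ => false) (.push .out false)

/-- Remove the top of a stack. -/
abbrev drop (k : Stk B.tm.K) : Cmd B := .act k (fun _ => none) []

/-- Push a word. -/
def pushWord (k : Reg) : List Letter → Cmd B
  | [] => skip
  | x :: l => .seq (pushWord k l) (.push (.base k) x)

/-- Empty a stack. -/
abbrev clear (k : Reg) : Cmd B := .loop (.base k) Option.isSome (drop (.base k))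

/-- Move the top of a stack to another stack. -/
abbrev mvSym (k k' : Reg) : Cmd B := .act (.base k) id [⟨.base k', fun r => r.getD .comma⟩]

/-- Move the content of a stack to another stack. -/
abbrev mv (k k' : Reg) : Cmd B := .loop (.base k) Option.isSome (mvSym k k')

/-- Move the content of a stack to two other stacks. -/
abbrev mvTwo (k k₁ k₂ : Reg) : Cmd B :=
  .loop (.base k) Option.isSome
    (.act (.base k) id [⟨.base k₁, fun r => r.getD .comma⟩, ⟨.base k₂, fun r => r.getD .comma⟩])

def isOne (x : Option Letter) : Bool :=
  match x with
  | some (.bit true) => true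
  | _ => false

/-- Move as many trees as the counter says from a stack to another stack. -/
abbrev mvTrees (k k' : Reg) : Cmd B :=
  .loop (.base .cnt) Option.isSome
    (.seq (drop (.base .cnt))
      (.ite (.base k) isOne
        (.seq (mvSym k k') (.seq (.push (.base .cnt) .comma) (.push (.base .cnt) .comma)))
        (mvSym k k')))

/-- Move a tree from a stack to another stack. -/
abbrev mvTree (k k' : Reg) : Cmd B := .seq (.push (.base .cnt) .comma) (mvTrees k k')

end Cmd

theorem Runs.of_eq {c : Cmd B} {S S' T T' : Stks B} {m n : ℕ} (h : Runs c S T m) (hS : S' = S)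
    (hT : T' = T) (hn : m ≤ n) : Runs c S' T' n := by
  subst hS hT
  exact h.mono hn

/-! ### Effects and times of the moves -/

section Moves

variable {ρ : Reg → List Letter} {o : List Bool} {T : ∀ k, List (B.tm.Γ k)}

theorem Runs.skip {S : Stks B} : Runs Cmd.skip S S 1 := Runs.loop_false rfl

theorem Runs.dropBase (k : Reg) : Runs (Cmd.drop (.base k)) (stks (B := B) ρ o T)
    (stks (Function.update ρ k (ρ k).tail) o T) 1 := by
  simpa [pushAll] using Runs.act (B := B) (.base k) (fun _ => none) [] (stks ρ o T)

theorem Runs.pushBase (k : Reg) (x : Letter) : Runs (.push (.base k) x) (stks (B := B) ρ o T)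
    (stks (Function.update ρ k (x :: ρ k)) o T) 1 := by
  simpa using Runs.push (B := B) (.base k) x (stks ρ o T)

theorem Runs.pushWord (k : Reg) (l : List Letter) :
    Runs (Cmd.pushWord k l) (stks (B := B) ρ o T)
      (stks (Function.update ρ k (l ++ ρ k)) o T) (l.length + 1) := by
  induction l with
  | nil => simpa [Cmd.pushWord] using Runs.skip
  | cons x l ih => simpa [Cmd.pushWord] using ih.seq (Runs.pushBase k x)

theorem Runs.clear (k : Reg) : Runs (Cmd.clear k) (stks (B := B) ρ o T)
    (stks (Function.update ρ k []) o T) (2 * (ρ k).length + 1) := by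
  generalize hl : ρ k = l
  induction l generalizing ρ with
  | nil =>
    rw [← hl, Function.update_eq_self]
    exact (Runs.loop_false (by simp [hl])).mono (by simp)
  | cons x l ih =>
    have h := ih (ρ := Function.update ρ k l) (by simp)
    rw [Function.update_idem] at h
    exact (Runs.loop_true (by simp [hl]) (Runs.dropBase k) (by simpa [hl] using h)).mono
      (by simp; omega)

theorem Runs.mvSym {k k' : Reg} (hk : k ≠ k') {x : Letter} {l : List Letter}
    (hx : ρ k = x :: l) : Runs (Cmd.mvSym k k') (stks (B := B) ρ o T)
      (stks (Function.update (Function.update ρ k l) k' (x :: ρ k')) o T) 1 := by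
  simpa [pushAll, hx, Function.update_of_ne hk.symm] using
    Runs.act (B := B) (.base k) id [⟨.base k', fun r => r.getD .comma⟩] (stks ρ o T)

theorem Runs.mv {k k' : Reg} (hk : k ≠ k') : Runs (Cmd.mv k k') (stks (B := B) ρ o T)
    (stks (Function.update (Function.update ρ k []) k' ((ρ k).reverse ++ ρ k')) o T)
    (2 * (ρ k).length + 1) := by
  generalize hl : ρ k = l
  induction l generalizing ρ with
  | nil =>
    rw [← hl, Function.update_eq_self]
    exact (Runs.loop_false (by simp [hl])).of_eq rfl (by simp [hl]) (by simp)
  | cons x l ih =>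
    have h := ih (ρ := Function.update (Function.update ρ k l) k' (x :: ρ k'))
      (by simp [Function.update_of_ne hk])
    refine (Runs.loop_true (by simp [hl]) (Runs.mvSym hk hl) h).of_eq rfl ?_ (by simp; omega)
    · congr 1
      rw [Function.update_comm hk.symm, Function.update_idem, Function.update_self,
        Function.update_idem]
      simp

theorem Runs.mvTwo {k k₁ k₂ : Reg} (h₁ : k ≠ k₁) (h₂ : k ≠ k₂) (h₁₂ : k₁ ≠ k₂) :
    Runs (Cmd.mvTwo k k₁ k₂) (stks (B := B) ρ o T)
      (stks (Function.update (Function.update (Function.update ρ k []) k₁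
        ((ρ k).reverse ++ ρ k₁)) k₂ ((ρ k).reverse ++ ρ k₂)) o T) (2 * (ρ k).length + 1) := by
  generalize hl : ρ k = l
  induction l generalizing ρ with
  | nil =>
    rw [← hl, Function.update_eq_self]
    exact (Runs.loop_false (by simp [hl])).of_eq rfl (by simp [hl]) (by simp)
  | cons x l ih =>
    have h := ih (ρ := Function.update (Function.update (Function.update ρ k l) k₁ (x :: ρ k₁))
      k₂ (x :: ρ k₂)) (by simp [Function.update_of_ne h₁, Function.update_of_ne h₂])
    have h0 := Runs.act (B := B) (.base k) id
      [⟨.base k₁, fun r => r.getD .comma⟩, ⟨.base k₂, fun r => r.getD .comma⟩] (stks ρ o T)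
    simp only [stks_base, hl, List.head?_cons, id, List.tail_cons, update_stks_base, pushAll,
      Option.getD_some, Function.update_of_ne h₁.symm, Function.update_of_ne h₂.symm,
      Function.update_of_ne h₁₂.symm] at h0
    refine (Runs.loop_true (by simp [hl]) h0 h).of_eq rfl ?_ (by simp; omega)
    · congr 1
      funext j
      by_cases j2 : j = k₂
      · subst j2; simp
      by_cases j1 : j = k₁
      · subst j1; simp [j2]
      by_cases j0 : j = k
      · subst j0; simp [j1, j2]
      simp [j0, j1, j2]

/-- In prefix notation a counter of the trees still to be read suffices: a leaf uses up one, a node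
replaces one by two. The lemma prolongs a given run of the same loop backwards by one tree, so that
the hypotheses for the two subtrees chain; each letter costs at most 6 steps. -/
theorem Runs.mvTrees {k k' : Reg} (hk : k ≠ k') (hc : k ≠ .cnt) (hc' : k' ≠ .cnt) (t : Tr)
    {R cs : List Letter} {x : Letter} {U : Stks B} {n : ℕ} (hR : ρ k = t.enc ++ R)
    (hcs : ρ .cnt = x :: cs)
    (h : Runs (Cmd.mvTrees k k') (stks (B := B) (Function.update (Function.update
      (Function.update ρ k R) k' (t.enc.reverse ++ ρ k')) .cnt cs) o T) U n) :
    Runs (Cmd.mvTrees k k') (stks (B := B) ρ o T) U (n + 6 * t.size) := by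
  induction t generalizing ρ R cs x n with
  | nil =>
    have h1 : Runs (.seq (.drop (.base .cnt)) (.ite (.base k) Cmd.isOne
        (.seq (.mvSym k k') (.seq (.push (.base .cnt) .comma) (.push (.base .cnt) .comma)))
        (.mvSym k k'))) (stks (B := B) ρ o T) (stks (B := B) (Function.update (Function.update
      (Function.update ρ .cnt cs) k R) k' (.bit false :: ρ k')) o T) 3 := by
      refine (Runs.dropBase .cnt).seq (n := 2) ?_
      refine Runs.ite_false ?_ ?_
      · simp [Function.update_of_ne hc, hR, Tr.enc, Cmd.isOne]
      · have := Runs.mvSym (B := B) (ρ := Function.update ρ .cnt cs) (o := o) (T := T) hk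
          (x := .bit false) (l := R) (by simp [hc, hR, Tr.enc])
        simpa [hcs, hc'] using this
    refine (Runs.loop_true (by simp [hcs]) h1 (h.of_eq ?_ rfl le_rfl)).mono (by simp; omega)
    congr 1
    rw [Function.update_comm hc.symm, Function.update_comm hc'.symm]
    simp [Tr.enc]
  | node l r ihl ihr =>
    have h1 : Runs (.seq (.drop (.base .cnt)) (.ite (.base k) Cmd.isOne
        (.seq (.mvSym k k') (.seq (.push (.base .cnt) .comma) (.push (.base .cnt) .comma)))
        (.mvSym k k'))) (stks (B := B) ρ o T) (stks (B := B) (Function.update (Function.update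
      (Function.update ρ .cnt (.comma :: .comma :: cs)) k (l.enc ++ (r.enc ++ R))) k'
        (.bit true :: ρ k')) o T) 5 := by
      refine (Runs.dropBase .cnt).seq (n := 4) ?_
      refine Runs.ite_true ?_ ?_
      · simp [Function.update_of_ne hc, hR, Tr.enc, Cmd.isOne]
      · have h2 := Runs.mvSym (B := B) (ρ := Function.update ρ .cnt cs) (o := o) (T := T) hk
          (x := .bit true) (l := l.enc ++ (r.enc ++ R)) (by simp [hc, hR, Tr.enc])
        have h3 := h2.seq ((Runs.pushBase .cnt .comma).seq (Runs.pushBase .cnt .comma))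
        convert h3 using 2
        · simp [hcs]
        · funext j
          by_cases j2 : j = k'
          · subst j2; simp [hc']
          by_cases j1 : j = k
          · subst j1; simp [j2, hc]
          by_cases j0 : j = .cnt
          · subst j0; simp [j1, j2]
          simp [j0, j1, j2]
    -- The left subtree uses up one of the two new commas; the other one waits for the right
    -- subtree.
    have key := ihl (ρ := Function.update (Function.update
      (Function.update ρ .cnt (.comma :: .comma :: cs)) k (l.enc ++ (r.enc ++ R))) k'
        (.bit true :: ρ k')) (R := r.enc ++ R) (cs := .comma :: cs) (x := .comma)
        (n := n + 6 * r.size) (by simp [hk]) (by simp [hc.symm, hc'.symm]) ?_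
    · refine (Runs.loop_true (by simp [hcs]) h1 key).mono (by simp; omega)
    · refine ihr (R := R) (cs := cs) (x := .comma) (by simp [hk, hc]) (by simp) ?_
      convert h using 2
      funext j
      by_cases j0 : j = .cnt
      · subst j0; simp
      by_cases j2 : j = k'
      · subst j2; simp [hc', Tr.enc]
      by_cases j1 : j = k
      · subst j1; simp [j2, hc]
      simp [j0, j1, j2]

theorem Runs.mvTree {k k' : Reg} (hk : k ≠ k') (hc : k ≠ .cnt) (hc' : k' ≠ .cnt) {t : Tr}
    {R : List Letter} (hR : ρ k = t.enc ++ R) (hcs : ρ .cnt = []) :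
    Runs (Cmd.mvTree k k') (stks (B := B) ρ o T) (stks (B := B) (Function.update
      (Function.update ρ k R) k' (t.enc.reverse ++ ρ k')) o T) (6 * t.size + 2) := by
  refine ((Runs.pushBase .cnt .comma).seq (Runs.mvTrees hk hc hc' t (R := R) (cs := [])
    (x := .comma) (n := 1) (by simp [hc, hR]) (by simp [hcs]) ?_)).mono (by omega)
  refine (Runs.loop_false ?_).of_eq ?_ rfl le_rfl
  · simp [hcs, hc.symm, hc'.symm]
  · congr 1
    funext j
    by_cases j0 : j = .cnt
    · subst j0; simp [hcs, hc.symm, hc'.symm]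
    by_cases j2 : j = k'
    · subst j2; simp [hc']
    by_cases j1 : j = k
    · subst j1; simp [j2, hc]
    simp [j0, j1, j2]

end Moves

end

section

variable {B : TM2ComputableAux Letter Bool}

/-! ### Operations on trees -/

variable (B) in
/-- The stacks between two operations: a tree on the main stack, and saved data. -/
def home (t : Tr) (R : List Letter) : Stks B := stks (cfg [] t.enc R [] [] []) [] fun _ => []

namespace Cmd

/-- Replace the content of the main stack by the tree on top of the save stack. -/
abbrev restore : Cmd B := .seq (clear .main) (.seq (mvTree .save .wkA) (mv .wkA .main))

/-- Copy the tree on the main stack to the save stack. -/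
abbrev saveMain : Cmd B := .seq (mv .main .wkA) (mvTwo .wkA .main .save)

abbrev const (t : Tr) : Cmd B := .seq (clear .main) (pushWord .main t.enc)

abbrev left : Cmd B :=
  .ite (.base .main) isOne
    (.seq (drop (.base .main)) (.seq (mvTree .main .wkA) (.seq (clear .main) (mv .wkA .main)))) skip

abbrev right : Cmd B :=
  .ite (.base .main) isOne
    (.seq (drop (.base .main)) (.seq (mvTree .main .wkA) (clear .wkA))) skip

/-- Exchange the tree on the main stack with the tree on top of the save stack. -/
abbrev swap : Cmd B :=
  .seq (mv .main .wkA) (.seq (mvTree .save .wkB) (.seq (mv .wkB .main) (mv .wkA .save)))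

/-- Both programs need the same input. It is saved before `c`, and `swap` then brings it back while
putting the result of `c` in its place. -/
abbrev node (c d : Cmd B) : Cmd B :=
  .seq saveMain (.seq c (.seq swap (.seq d (.seq (mvTree .save .wkA) (.seq (mv .wkA .main)
    (.push (.base .main) (.bit true)))))))

/-- Branch on whether a computed tree is a leaf. -/
abbrev cond (c d e : Cmd B) : Cmd B :=
  .seq saveMain (.seq c (.ite (.base .main) isOne (.seq restore d) (.seq restore e)))

/-- Iterate while the left subtree is not a leaf, and return the right subtree. -/
abbrev whileLeft (c : Cmd B) : Cmd B :=
  .seq (drop (.base .main)) (.seq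
    (.loop (.base .main) isOne
      (.seq (.push (.base .main) (.bit true)) (.seq c (drop (.base .main)))))
    (drop (.base .main)))

end Cmd

theorem isOne_enc (t : Tr) (R : List Letter) : Cmd.isOne (t.enc ++ R).head? = t.isNode := by
  cases t <;> rfl

theorem Runs.restore (l : List Letter) (t : Tr) (R : List Letter) :
    Runs Cmd.restore (stks (cfg [] l (t.enc ++ R) [] [] []) [] fun _ => []) (home B t R)
      (2 * l.length + 8 * t.size + 4) := by
  have h1 := Runs.clear (B := B) (ρ := cfg [] l (t.enc ++ R) [] [] []) (o := [])
    (T := fun _ => []) .main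
  have h2 := Runs.mvTree (B := B) (ρ := cfg [] [] (t.enc ++ R) [] [] []) (o := [])
    (T := fun _ => []) (k := .save) (k' := .wkA) (by decide) (by decide) (by decide) rfl rfl
  have h3 := Runs.mv (B := B) (ρ := cfg [] [] R t.enc.reverse [] []) (o := [])
    (T := fun _ => []) (k := .wkA) (k' := .main) (by decide)
  simp at h1 h2 h3
  exact (h1.seq (h2.seq h3)).mono (by omega)

theorem Runs.saveMain (t : Tr) (R : List Letter) :
    Runs Cmd.saveMain (home B t R) (home B t (t.enc ++ R)) (4 * t.size + 2) := by
  have h1 := Runs.mv (B := B) (ρ := cfg [] t.enc R [] [] []) (o := [])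
    (T := fun _ => []) (k := .main) (k' := .wkA) (by decide)
  have h2 := Runs.mvTwo (B := B) (ρ := cfg [] [] R t.enc.reverse [] []) (o := [])
    (T := fun _ => []) (k := .wkA) (k₁ := .main) (k₂ := .save) (by decide) (by decide) (by decide)
  simp at h1 h2
  exact (h1.seq h2).mono (by omega)

theorem Runs.const (t t' : Tr) (R : List Letter) :
    Runs (Cmd.const t') (home B t R) (home B t' R) (2 * t.size + t'.size + 2) := by
  have h1 := Runs.clear (B := B) (ρ := cfg [] t.enc R [] [] []) (o := [])
    (T := fun _ => []) .main
  have h2 := Runs.pushWord (B := B) (ρ := cfg [] [] R [] [] []) (o := [])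
    (T := fun _ => []) .main t'.enc
  simp at h1 h2
  exact (h1.seq h2).mono (by omega)

theorem Runs.left (t : Tr) (R : List Letter) :
    Runs Cmd.left (home B t R) (home B t.left R) (10 * t.size + 5) := by
  cases t with
  | nil => exact (Runs.ite_false rfl Runs.skip).mono (by simp)
  | node l r =>
    refine Runs.mono (Runs.ite_true rfl ?_) (m := 10 * (Tr.node l r).size + 4) (by omega)
    have h0 := Runs.dropBase (B := B) (ρ := cfg [] (Tr.node l r).enc R [] [] []) (o := [])
      (T := fun _ => []) .main
    have h1 := Runs.mvTree (B := B) (ρ := cfg [] (l.enc ++ r.enc) R [] [] []) (o := [])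
      (T := fun _ => []) (k := .main) (k' := .wkA) (by decide) (by decide) (by decide) rfl rfl
    have h2 := Runs.clear (B := B) (ρ := cfg [] r.enc R l.enc.reverse [] []) (o := [])
      (T := fun _ => []) .main
    have h3 := Runs.mv (B := B) (ρ := cfg [] [] R l.enc.reverse [] []) (o := [])
      (T := fun _ => []) (k := .wkA) (k' := .main) (by decide)
    simp [Tr.enc] at h0 h1 h2 h3
    exact (h0.seq (h1.seq (h2.seq h3))).mono (by simp; omega)

theorem Runs.right (t : Tr) (R : List Letter) :
    Runs Cmd.right (home B t R) (home B t.right R) (10 * t.size + 5) := by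
  cases t with
  | nil => exact (Runs.ite_false rfl Runs.skip).mono (by simp)
  | node l r =>
    refine Runs.mono (Runs.ite_true rfl ?_) (m := 10 * (Tr.node l r).size + 4) (by omega)
    have h0 := Runs.dropBase (B := B) (ρ := cfg [] (Tr.node l r).enc R [] [] []) (o := [])
      (T := fun _ => []) .main
    have h1 := Runs.mvTree (B := B) (ρ := cfg [] (l.enc ++ r.enc) R [] [] []) (o := [])
      (T := fun _ => []) (k := .main) (k' := .wkA) (by decide) (by decide) (by decide) rfl rfl
    have h2 := Runs.clear (B := B) (ρ := cfg [] r.enc R l.enc.reverse [] []) (o := [])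
      (T := fun _ => []) .wkA
    simp [Tr.enc] at h0 h1 h2
    exact (h0.seq (h1.seq h2)).mono (by simp; omega)

theorem Runs.swap (t t' : Tr) (R : List Letter) :
    Runs Cmd.swap (home B t (t'.enc ++ R)) (home B t' (t.enc ++ R))
      (4 * t.size + 8 * t'.size + 5) := by
  have h0 := Runs.mv (B := B) (ρ := cfg [] t.enc (t'.enc ++ R) [] [] []) (o := [])
    (T := fun _ => []) (k := .main) (k' := .wkA) (by decide)
  have h1 := Runs.mvTree (B := B) (ρ := cfg [] [] (t'.enc ++ R) t.enc.reverse [] []) (o := [])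
    (T := fun _ => []) (k := .save) (k' := .wkB) (by decide) (by decide) (by decide) rfl rfl
  have h2 := Runs.mv (B := B) (ρ := cfg [] [] R t.enc.reverse t'.enc.reverse []) (o := [])
    (T := fun _ => []) (k := .wkB) (k' := .main) (by decide)
  have h3 := Runs.mv (B := B) (ρ := cfg [] t'.enc R t.enc.reverse [] []) (o := [])
    (T := fun _ => []) (k := .wkA) (k' := .save) (by decide)
  simp at h0 h1 h2 h3
  exact (h0.seq (h1.seq (h2.seq h3))).mono (by omega)

/-- The programs are required to work above any saved content `R`; this is what permits nested use
of the save stack. -/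
theorem Runs.node {c d : Cmd B} {t u v : Tr} {m n : ℕ}
    (hc : ∀ R, Runs c (home B t R) (home B u R) m) (hd : ∀ R, Runs d (home B t R) (home B v R) n)
    (R : List Letter) :
    Runs (Cmd.node c d) (home B t R) (home B (.node u v) R)
      (m + n + 12 * t.size + 12 * u.size + 11) := by
  have h0 := Runs.mvTree (B := B) (ρ := cfg [] v.enc (u.enc ++ R) [] [] []) (o := [])
    (T := fun _ => []) (k := .save) (k' := .wkA) (by decide) (by decide) (by decide) rfl rfl
  have h1 := Runs.mv (B := B) (ρ := cfg [] v.enc R u.enc.reverse [] []) (o := [])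
    (T := fun _ => []) (k := .wkA) (k' := .main) (by decide)
  have h2 := Runs.pushBase (B := B) (ρ := cfg [] (u.enc ++ v.enc) R [] [] []) (o := [])
    (T := fun _ => []) .main (.bit true)
  simp at h0 h1 h2
  exact ((Runs.saveMain t R).seq ((hc _).seq ((Runs.swap u t R).seq ((hd _).seq
    (h0.seq (h1.seq h2)))))).mono (by omega)

theorem Runs.cond_true {c d e : Cmd B} {t u v : Tr} {m n : ℕ} (hu : u.isNode = true)
    (hc : ∀ R, Runs c (home B t R) (home B u R) m) (hd : ∀ R, Runs d (home B t R) (home B v R) n)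
    (R : List Letter) :
    Runs (Cmd.cond c d e) (home B t R) (home B v R) (m + n + 12 * t.size + 2 * u.size + 7) := by
  refine ((Runs.saveMain t R).seq ((hc _).seq (Runs.ite_true ?_
    ((Runs.restore u.enc t R).seq (hd _))))).mono (by simp; omega)
  simpa [home, hu] using isOne_enc u []

theorem Runs.cond_false {c d e : Cmd B} {t u v : Tr} {m n : ℕ} (hu : u.isNode = false)
    (hc : ∀ R, Runs c (home B t R) (home B u R) m) (he : ∀ R, Runs e (home B t R) (home B v R) n)
    (R : List Letter) :
    Runs (Cmd.cond c d e) (home B t R) (home B v R) (m + n + 12 * t.size + 2 * u.size + 7) := by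
  refine ((Runs.saveMain t R).seq ((hc _).seq (Runs.ite_false ?_
    ((Runs.restore u.enc t R).seq (he _))))).mono (by simp; omega)
  simpa [home, hu] using isOne_enc u []

/-- If the successive values of a loop are the nodes of `s i` and `t i`, where `s i` is a leaf for
`i = n` only, then the loop ends with `t n`. -/
theorem Runs.whileLeft {c : Cmd B} {s t : ℕ → Tr} {n m : ℕ}
    (hs : ∀ i < n, (s i).isNode = true) (hn : s n = .nil)
    (hc : ∀ i < n, ∀ R, Runs c (home B (.node (s i) (t i)) R)
      (home B (.node (s (i + 1)) (t (i + 1))) R) m) (R : List Letter) :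
    Runs (Cmd.whileLeft c) (home B (.node (s 0) (t 0)) R) (home B (t n) R)
      (n * (m + 3) + 3) := by
  have hd (x : Letter) (l : List Letter) := Runs.dropBase (B := B)
    (ρ := cfg [] (x :: l) R [] [] []) (o := []) (T := fun _ => []) .main
  simp only [cfg_main, List.tail_cons, update_cfg_main] at hd
  -- Inside the loop the root letter of the pair is stripped, so the top of the stack is the root
  -- letter of `s i` and serves as loop condition. The induction is on the number `j` of rounds
  -- left.
  have key : ∀ j ≤ n, Runs (.loop (.base .main) Cmd.isOne
      (.seq (.push (.base .main) (.bit true)) (.seq c (Cmd.drop (.base .main)))))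
      (stks (B := B) (cfg [] ((s (n - j)).enc ++ (t (n - j)).enc) R [] [] []) [] fun _ => [])
      (stks (cfg [] ((s n).enc ++ (t n).enc) R [] [] []) [] fun _ => []) (j * (m + 3) + 1) := by
    intro j hj
    induction j with
    | zero =>
      exact (Runs.loop_false ((isOne_enc _ _).trans (by simp [hn]))).mono (by simp)
    | succ j ih =>
      have h1 : n - (j + 1) + 1 = n - j := by omega
      have h2 := hc (n - (j + 1)) (by omega) R
      rw [h1] at h2
      have h3 := Runs.pushBase (B := B) (ρ := cfg []
        ((s (n - (j + 1))).enc ++ (t (n - (j + 1))).enc) R [] [] []) (o := [])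
        (T := fun _ => []) .main (.bit true)
      simp only [cfg_main, update_cfg_main] at h3
      refine (Runs.loop_true ((isOne_enc _ _).trans (hs _ (by omega)))
        (h3.seq (h2.seq (hd _ _))) (ih (by omega))).mono ?_
      rw [Nat.add_mul]
      omega
  have h := key n le_rfl
  rw [Nat.sub_self, hn] at h
  exact ((hd _ _).seq (h.seq (hd _ _))).mono (by omega)

end

section

/-! ### Data as trees -/

/-- Types whose elements are represented by trees. -/
class TreeRep (α : Type) where
  rep : α → Tr

open TreeRep (rep)

instance : TreeRep Unit := ⟨fun _ => .nil⟩

instance : TreeRep Bool := ⟨fun b => bif b then .node .nil .nil else .nil⟩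

instance {α β : Type} [TreeRep α] [TreeRep β] : TreeRep (α × β) := ⟨fun p => .node (rep p.1) (rep p.2)⟩

def repList {α : Type} [TreeRep α] : List α → Tr
  | [] => .nil
  | a :: l => .node (rep a) (repList l)

instance {α : Type} [TreeRep α] : TreeRep (List α) := ⟨repList⟩

/-- Numbers are represented in unary. -/
instance : TreeRep ℕ := ⟨fun n => rep (List.replicate n ())⟩

/-- The number of a letter. -/
def Letter.toNat : Letter → ℕ
  | .bit false => 0
  | .bit true => 1
  | .comma => 2
  | .semicolon => 3

instance : TreeRep Letter := ⟨fun x => rep x.toNat⟩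

/-- The size of the representation. -/
def size {α : Type} [TreeRep α] (a : α) : ℕ := (rep a).size

section Rep

variable {α β : Type} [TreeRep α] [TreeRep β]

@[simp] theorem rep_pair (a : α) (b : β) : rep (a, b) = .node (rep a) (rep b) := rfl
@[simp] theorem rep_nil : rep ([] : List α) = .nil := rfl
@[simp] theorem rep_cons (a : α) (l : List α) : rep (a :: l) = .node (rep a) (rep l) := rfl
@[simp] theorem rep_zero : rep 0 = .nil := rfl
@[simp] theorem rep_succ (n : ℕ) : rep (n + 1) = .node .nil (rep n) := rfl
theorem rep_replicate (n : ℕ) : rep (List.replicate n ()) = rep n := rfl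
-- The two bits have the numbers 0 and 1, so a binary word and the same word written in letters are
-- one and the same tree, and conversion is free.
theorem rep_bit (b : Bool) : rep (Letter.bit b) = rep b := by cases b <;> rfl

theorem size_eq (a : α) : size a = (rep a).size := rfl

theorem size_pos (a : α) : 1 ≤ size a := Tr.size_pos _

@[simp] theorem size_pair (a : α) (b : β) : size (a, b) = size a + size b + 1 := rfl
@[simp] theorem size_nil : size ([] : List α) = 1 := rfl
@[simp] theorem size_cons (a : α) (l : List α) : size (a :: l) = size a + size l + 1 := rfl
@[simp] theorem size_nat (n : ℕ) : size n = 2 * n + 1 := by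
  induction n with
  | zero => rfl
  | succ n ih =>
    have : size (n + 1) = 1 + size n + 1 := rfl
    omega

theorem size_bool (b : Bool) : size b ≤ 3 := by cases b <;> decide
theorem size_letter (x : Letter) : size x ≤ 7 := by rcases x with (_ | _) | _ | _ <;> decide

theorem size_append (l l' : List α) : size (l ++ l') + 1 = size l + size l' := by
  induction l with
  | nil => simp; omega
  | cons a l ih => simp; omega

@[simp] theorem size_reverse (l : List α) : size l.reverse = size l := by
  induction l with
  | nil => rfl
  | cons a l ih =>
    have := size_append l.reverse [a]
    simp only [List.reverse_cons, size_cons, size_nil, ih] at this ⊢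
    omega

theorem length_lt_size (l : List α) : l.length < size l := by
  induction l with
  | nil => simp
  | cons a l ih => simp; omega

theorem size_mem {l : List α} {a : α} (h : a ∈ l) : size a < size l := by
  induction l with
  | nil => simp at h
  | cons b l ih =>
    rcases List.mem_cons.1 h with rfl | h
    · simp
    · have := ih h; simp; omega

theorem size_sublist {l l' : List α} (h : l.Sublist l') : size l ≤ size l' := by
  induction h with
  | slnil => rfl
  | cons a _ ih => simp; omega
  | cons_cons a _ ih => simp; omega

theorem size_le_of_forall {l : List α} {n : ℕ} (h : ∀ a ∈ l, size a ≤ n) :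
    size l ≤ l.length * (n + 1) + 1 := by
  induction l with
  | nil => simp
  | cons a l ih =>
    have h1 := ih fun b hb => h b (List.mem_cons_of_mem _ hb)
    have h2 := h a List.mem_cons_self
    simp [Nat.add_mul]
    omega

theorem size_words (l : List Letter) : size l ≤ 8 * l.length + 1 := by
  have := size_le_of_forall (l := l) fun a _ => size_letter a
  omega

end Rep

/-! ### Reading and writing words -/

variable {B : TM2ComputableAux Letter Bool}

namespace Cmd

/-- Pop a letter and push its tree and a node. -/
abbrev loadLetter (x : Letter) : Cmd B :=
  .seq (drop (.base .wkA)) (pushWord .main (.bit true :: (rep x).enc))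

abbrev isLetter (x : Letter) (y : Option Letter) : Bool :=
  match x, y with
  | .bit b, some (.bit c) => b == c
  | .comma, some .comma => true
  | .semicolon, some .semicolon => true
  | _, _ => false

/-- Turn the word on the input stack into a tree on the main stack. -/
abbrev load : Cmd B :=
  .seq (mv .inp .wkA) (.seq (.push (.base .main) (.bit false))
    (.loop (.base .wkA) Option.isSome
      (.ite (.base .wkA) (isLetter (.bit false)) (loadLetter (.bit false))
      (.ite (.base .wkA) (isLetter (.bit true)) (loadLetter (.bit true))
      (.ite (.base .wkA) (isLetter .comma) (loadLetter .comma) (loadLetter .semicolon))))))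

/-- Pop the tree of a number and push the letter with this number in the list. -/
abbrev popNumeral : List Letter → Letter → Cmd B
  | [], x => .seq (drop (.base .main)) (.push (.base .wkA) x)
  | y :: l, x => .ite (.base .main) isOne
      (.seq (drop (.base .main)) (.seq (drop (.base .main)) (popNumeral l y)))
      (.seq (drop (.base .main)) (.push (.base .wkA) x))

/-- Turn the tree of a word on the main stack into a reversed word on a working stack. -/
abbrev unload : Cmd B :=
  .seq (.loop (.base .main) isOne (.seq (drop (.base .main))
    (popNumeral [.bit true, .comma, .semicolon] (.bit false)))) (drop (.base .main))

/-- Move the word on the working stack to the input of the subroutine. -/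
abbrev toCall : Cmd B :=
  .loop (.base .wkA) Option.isSome
    (.act (.base .wkA) id
      [⟨.orc B.tm.k₀, fun r => B.inputAlphabet.invFun (r.getD .comma)⟩])

/-- Read the answer of the subroutine. -/
abbrev fromCall : Cmd B :=
  .ite (.orc B.tm.k₁) (fun x => x.elim false B.outputAlphabet)
    (.seq (drop (.orc B.tm.k₁)) (pushWord .main (rep true).enc))
    (.seq (drop (.orc B.tm.k₁)) (pushWord .main (rep false).enc))

/-- Ask the subroutine for the word on the main stack. -/
abbrev ask : Cmd B := .seq unload (.seq toCall (.seq call fromCall))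

/-- Write the bits on the working stack to the output stack. -/
abbrev write : Cmd B :=
  .loop (.base .wkA) Option.isSome (.act (.base .wkA) id [⟨.out, fun r => isOne r⟩])

end Cmd

section Words

variable {i m s a b c : List Letter} {o : List Bool} {T : ∀ k, List (B.tm.Γ k)}

theorem Runs.dropMain (x : Letter) : Runs (.drop (.base .main))
    (stks (B := B) (cfg i (x :: m) s a b c) o T) (stks (cfg i m s a b c) o T) 1 := by
  simpa using Runs.dropBase (B := B) (ρ := cfg i (x :: m) s a b c) (o := o) (T := T) .main

theorem Runs.loadLetter (x : Letter) : Runs (Cmd.loadLetter x)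
    (stks (B := B) (cfg i m s (x :: a) b c) o T)
    (stks (cfg i (.bit true :: ((rep x).enc ++ m)) s a b c) o T) 10 := by
  have h1 := Runs.dropBase (B := B) (ρ := cfg i m s (x :: a) b c) (o := o) (T := T) .wkA
  have h2 := Runs.pushWord (B := B) (ρ := cfg i m s a b c) (o := o) (T := T) .main
    (.bit true :: (rep x).enc)
  simp at h1 h2
  have := size_letter x
  rw [size_eq] at this
  exact (h1.seq h2).mono (by omega)

/-- The input is reversed first, since the tree of a list is built from its last element. -/
theorem Runs.load (x : List Letter) :
    Runs Cmd.load (stks (B := B) (cfg x [] [] [] [] []) [] fun _ => [])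
      (home B (rep x) []) (16 * x.length + 3) := by
  have key : ∀ (x : List Letter) (m : List Letter),
      Runs (.loop (.base .wkA) Option.isSome
        (.ite (.base .wkA) (Cmd.isLetter (.bit false)) (Cmd.loadLetter (.bit false))
        (.ite (.base .wkA) (Cmd.isLetter (.bit true)) (Cmd.loadLetter (.bit true))
        (.ite (.base .wkA) (Cmd.isLetter .comma) (Cmd.loadLetter .comma)
          (Cmd.loadLetter .semicolon)))))
        (stks (B := B) (cfg [] (rep m).enc [] x [] []) [] fun _ => [])
        (stks (B := B) (cfg [] (rep (x.reverse ++ m)).enc [] [] [] []) [] fun _ => [])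
        (14 * x.length + 1) := by
    intro x
    induction x with
    | nil => intro m; exact (Runs.loop_false rfl).mono (by simp)
    | cons x l ih =>
      intro m
      have h1 := ih (x :: m)
      have h2 := Runs.loadLetter (B := B) (i := []) (m := (rep m).enc) (s := []) (a := l)
        (b := []) (c := []) (o := []) (T := fun _ => []) x
      rw [show l.reverse ++ x :: m = (x :: l).reverse ++ m by simp] at h1
      -- At most three tests and the ten steps of `loadLetter`.
      refine (Runs.loop_true (m := 13) rfl ?_ h1).mono (by simp; omega)
      rcases x with (_ | _) | _ | _
      · exact (Runs.ite_true rfl h2).mono (by omega)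
      · exact (Runs.ite_false rfl (Runs.ite_true rfl h2)).mono (by omega)
      · exact (Runs.ite_false rfl (Runs.ite_false rfl (Runs.ite_true rfl h2))).mono (by omega)
      · exact Runs.ite_false rfl (Runs.ite_false rfl (Runs.ite_false rfl h2))
  have h1 := Runs.mv (B := B) (ρ := cfg x [] [] [] [] []) (o := [])
    (T := fun _ => []) (k := .inp) (k' := .wkA) (by decide)
  have h2 := Runs.pushBase (B := B) (ρ := cfg [] [] [] x.reverse [] []) (o := [])
    (T := fun _ => []) .main (.bit false)
  have h3 := key x.reverse []
  simp at h1 h2 h3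
  exact (h1.seq (h2.seq h3)).mono (by omega)

theorem Runs.popNumeral (x : Letter) :
    Runs (.popNumeral [.bit true, .comma, .semicolon] (.bit false))
      (stks (B := B) (cfg i ((rep x).enc ++ m) s a b c) o T)
      (stks (cfg i m s (x :: a) b c) o T) 11 := by
  have h0 (x : Letter) := Runs.pushBase (B := B) (ρ := cfg i m s a b c) (o := o) (T := T) .wkA x
  simp only [update_cfg_wkA, cfg_wkA] at h0
  rcases x with (_ | _) | _ | _
  · exact (Runs.ite_false rfl ((Runs.dropMain _).seq (h0 _))).mono (by omega)
  · exact (Runs.ite_true rfl ((Runs.dropMain _).seq ((Runs.dropMain _).seq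
      (Runs.ite_false rfl ((Runs.dropMain _).seq (h0 _)))))).mono (by omega)
  · exact (Runs.ite_true rfl ((Runs.dropMain _).seq ((Runs.dropMain _).seq
      (Runs.ite_true rfl ((Runs.dropMain _).seq ((Runs.dropMain _).seq
      (Runs.ite_false rfl ((Runs.dropMain _).seq (h0 _))))))))).mono (by omega)
  · exact (Runs.ite_true rfl ((Runs.dropMain _).seq ((Runs.dropMain _).seq
      (Runs.ite_true rfl ((Runs.dropMain _).seq ((Runs.dropMain _).seq
      (Runs.ite_true rfl ((Runs.dropMain _).seq ((Runs.dropMain _).seq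
      ((Runs.dropMain _).seq (h0 _))))))))))).mono (by omega)

theorem Runs.unload (x : List Letter) :
    Runs Cmd.unload (stks (B := B) (cfg i (rep x).enc s a b c) o T)
      (stks (cfg i [] s (x.reverse ++ a) b c) o T) (13 * x.length + 2) := by
  refine Runs.mono (Runs.seq (T := stks (cfg i [.bit false] s (x.reverse ++ a) b c) o T)
    (m := 13 * x.length + 1) ?_ (Runs.dropMain _)) le_rfl
  induction x generalizing a with
  | nil => exact (Runs.loop_false rfl).mono (by simp)
  | cons x l ih =>
    have h := ih (a := x :: a)
    rw [show l.reverse ++ x :: a = (x :: l).reverse ++ a by simp] at h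
    exact (Runs.loop_true rfl ((Runs.dropMain _).seq (Runs.popNumeral x)) h).mono
      (by simp; omega)

/-- Pushing letter by letter reverses the word, which undoes the reversal made by `unload`. -/
theorem Runs.toCall (x : List Letter) (l : List (B.tm.Γ B.tm.k₀)) :
    Runs Cmd.toCall (stks (B := B) (cfg i m s x b c) o (initList B.tm l).stk)
      (stks (cfg i m s [] b c) o
        (initList B.tm ((x.map B.inputAlphabet.invFun).reverse ++ l)).stk)
      (2 * x.length + 1) := by
  induction x generalizing l with
  | nil => exact Runs.loop_false rfl
  | cons x w ih =>
    have h := ih (B.inputAlphabet.invFun x :: l)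
    refine (Runs.loop_true rfl ?_ (h.of_eq rfl (by simp) le_rfl) (m := 1)).mono (by simp; omega)
    have h0 := Runs.act (B := B) (.base .wkA) id
      [⟨.orc B.tm.k₀, fun r => B.inputAlphabet.invFun (r.getD .comma)⟩]
      (stks (B := B) (cfg i m s (x :: w) b c) o (initList B.tm l).stk)
    refine h0.of_eq rfl ?_ le_rfl
    simp only [pushAll, stks_base, update_stks_base, cfg_wkA, update_cfg_wkA, stks_orc,
      update_stks_orc, List.tail_cons]
    congr 1
    funext k
    by_cases hk : k = B.tm.k₀
    · subst hk; simp [initList]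
    · simp [initList, hk]

/-- Once the single answer symbol is popped, all stacks of the subroutine are empty again, as `home`
demands. -/
theorem Runs.fromCall (b₀ : Bool) (R : List Letter) :
    Runs Cmd.fromCall (stks (B := B) (cfg [] [] R [] [] []) []
      (haltList B.tm ((encodeBool b₀).map B.outputAlphabet.invFun)).stk)
      (home B (rep b₀) R) 6 := by
  have hs : (haltList B.tm ((encodeBool b₀).map B.outputAlphabet.invFun)).stk B.tm.k₁ =
      [B.outputAlphabet.invFun b₀] := by
    simp [haltList, encodeBool]
  have h0 := Runs.act (B := B) (.orc B.tm.k₁) (fun _ => none) []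
    (stks (cfg [] [] R [] [] []) []
      (haltList B.tm ((encodeBool b₀).map B.outputAlphabet.invFun)).stk)
  have h1 := Runs.pushWord (B := B) (ρ := cfg [] [] R [] [] []) (o := [])
    (T := fun _ => []) .main (rep b₀).enc
  have h2 : Function.update (haltList B.tm
      ((encodeBool b₀).map B.outputAlphabet.invFun)).stk B.tm.k₁ [] = fun _ => [] := by
    funext k
    by_cases hk : k = B.tm.k₁
    · subst hk; simp
    · simp [haltList, hk]
  simp only [pushAll, stks_orc, update_stks_orc, hs, List.tail_cons, h2] at h0
  simp only [cfg_main, update_cfg_main, List.append_nil, Tr.length_enc] at h1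
  have h3 := size_bool b₀
  rw [size_eq] at h3
  cases b₀
  · refine (Runs.ite_false ?_ (h0.seq h1)).mono (by omega)
    rw [stks_orc, hs]
    simp
  · refine (Runs.ite_true ?_ (h0.seq h1)).mono (by omega)
    rw [stks_orc, hs]
    simp

theorem Runs.ask {x : List Letter} {b₀ : Bool} {n : ℕ}
    (h : Nonempty (TM2OutputsInTime B.tm (x.map B.inputAlphabet.invFun)
      (some ((encodeBool b₀).map B.outputAlphabet.invFun)) n)) (R : List Letter) :
    Runs Cmd.ask (home B (rep x) R) (home B (rep b₀) R) (15 * x.length + n + 9) := by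
  -- Empty stacks are the start of the subroutine on the empty word, from which `toCall` builds up
  -- the query.
  have h0 : (fun k => [] : ∀ k, List (B.tm.Γ k)) = (initList B.tm []).stk := by
    funext k
    by_cases hk : k = B.tm.k₀
    · subst hk; simp [initList]
    · simp [initList, hk]
  have h1 := Runs.unload (B := B) (i := []) (s := R) (a := []) (b := []) (c := []) (o := [])
    (T := fun _ => []) x
  have h2 := Runs.toCall (B := B) (i := []) (m := []) (s := R) (b := []) (c := []) (o := [])
    x.reverse []
  rw [← h0] at h2
  simp only [List.append_nil, List.map_reverse, List.reverse_reverse, List.length_reverse] at h1 h2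
  exact (h1.seq (h2.seq ((Runs.call h _ _).seq (Runs.fromCall b₀ R)))).mono (by omega)

theorem Runs.write (x o : List Bool) :
    Runs Cmd.write (stks (B := B) (cfg i m s (x.map .bit) b c) o T)
      (stks (cfg i m s [] b c) (x.reverse ++ o) T) (2 * x.length + 1) := by
  induction x generalizing o with
  | nil => exact Runs.loop_false rfl
  | cons x l ih =>
    refine (Runs.loop_true rfl ?_ ((ih (x :: o)).of_eq rfl (by simp) le_rfl) (m := 1)).mono
      (by simp; omega)
    have h0 := Runs.act (B := B) (.base .wkA) id [⟨.out, fun r => Cmd.isOne r⟩]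
      (stks (B := B) (cfg i m s (.bit x :: l.map .bit) b c) o T)
    refine h0.of_eq rfl ?_ le_rfl
    simp only [pushAll, stks_base, update_stks_base, cfg_wkA, update_cfg_wkA, stks_out,
      update_stks_out, List.tail_cons, List.head?_cons, id]
    cases x <;> rfl

end Words

theorem rep_map_bit (y : List Bool) : rep (y.map Letter.bit) = rep y := by
  induction y with
  | nil => rfl
  | cons b l ih => simp [ih, rep_bit]

/-- The complete program: read the input, run `c` and write the output. -/
abbrev Cmd.full (c : Cmd B) : Cmd B := .seq .load (.seq c (.seq .unload .write))

theorem Runs.full {c : Cmd B} {x : List Letter} {y : List Bool} {n : ℕ}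
    (h : Runs c (home B (rep x) []) (home B (rep y) []) n) :
    Runs c.full (stks (B := B) (cfg x [] [] [] [] []) [] fun _ => [])
      (stks (cfg [] [] [] [] [] []) y fun _ => []) (16 * x.length + n + 15 * y.length + 6) := by
  have h1 := Runs.unload (B := B) (i := []) (s := []) (a := []) (b := []) (c := []) (o := [])
    (T := fun _ => []) (y.map .bit)
  have h2 := Runs.write (B := B) (i := []) (m := []) (s := []) (b := []) (c := [])
    (T := fun _ => []) y.reverse []
  rw [rep_map_bit] at h1
  simp only [List.append_nil, List.map_reverse, List.reverse_reverse, List.length_reverse,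
    List.length_map] at h1 h2
  exact ((Runs.load x).seq (h.seq (h1.seq h2))).mono (by omega)

/-- The machine of a program. -/
noncomputable def Cmd.machine (c : Cmd B) : TM2ComputableAux Letter Bool where
  tm :=
    { K := Stk B.tm.K
      kFin := haveI := B.tm.kFin; inferInstance
      k₀ := .base .inp
      k₁ := .out
      Γ := Sym B
      Λ := Option c.Lab
      main := some c.entry
      σ := St B
      initialState := (none, B.tm.initialState)
      σFin := haveI := B.tm.σFin; inferInstance
      Γk₀Fin := inferInstanceAs (Fintype Letter)
      m := fun l => l.elim .halt (c.code some none) }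
  inputAlphabet := Equiv.refl _
  outputAlphabet := Equiv.refl _

/-- The additional step executes `halt` at the exit label `none`. -/
theorem Runs.machine {c : Cmd B} {x : List Letter} {y : List Bool} {n : ℕ}
    (h : Runs c (stks (B := B) (cfg x [] [] [] [] []) [] fun _ => [])
      (stks (cfg [] [] [] [] [] []) y fun _ => []) n) :
    Nonempty (TM2OutputsInTime c.machine.tm (x.map c.machine.inputAlphabet.invFun)
      (some (y.map c.machine.outputAlphabet.invFun)) (n + 1)) := by
  have h1 := h (Option c.Lab) c.machine.tm.m some none fun l => rfl
  have h2 : Leads c.machine.tm.m ⟨some none, (none, B.tm.initialState),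
      stks (B := B) (cfg [] [] [] [] [] []) y fun _ => []⟩
      ⟨none, (none, B.tm.initialState), stks (B := B) (cfg [] [] [] [] [] []) y fun _ => []⟩ 1 :=
    Leads.single rfl
  have h3 := h1.trans h2
  have e1 : initList c.machine.tm (x.map c.machine.inputAlphabet.invFun) =
      ⟨some (some c.entry), (none, B.tm.initialState),
        stks (B := B) (cfg x [] [] [] [] []) [] fun _ => []⟩ := by
    have : x.map c.machine.inputAlphabet.invFun = x := List.map_id x
    rw [this]
    unfold initList
    congr 1
    funext k
    rcases k with (_ | _) | _ | _ <;> rfl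
  have e2 : haltList c.machine.tm (y.map c.machine.outputAlphabet.invFun) =
      ⟨none, (none, B.tm.initialState),
        stks (B := B) (cfg [] [] [] [] [] []) y fun _ => []⟩ := by
    have : y.map c.machine.outputAlphabet.invFun = y := List.map_id y
    rw [this]
    unfold haltList
    congr 1
    funext k
    rcases k with (_ | _) | _ | _ <;> rfl
  unfold TM2OutputsInTime
  rw [e1, Option.map_some, e2]
  exact h3

end

open TreeRep (rep)

section

/-! ### Polynomial bounds -/

theorem poly_mono (p : Polynomial ℕ) {m n : ℕ} (h : m ≤ n) : p.eval m ≤ p.eval n := by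
  simp only [Polynomial.eval_eq_sum, Polynomial.sum]
  gcongr

/-- A function is bounded by a polynomial in another function. -/
def PolyBd {α : Type} (μ g : α → ℕ) : Prop := ∃ p : Polynomial ℕ, ∀ a, g a ≤ p.eval (μ a)

namespace PolyBd

variable {α β : Type} {μ f g : α → ℕ}

theorem const (n : ℕ) : PolyBd μ fun _ => n := ⟨Polynomial.C n, by simp⟩

theorem self : PolyBd μ μ := ⟨Polynomial.X, by simp⟩

theorem mono (h : PolyBd μ g) (hfg : ∀ a, f a ≤ g a) : PolyBd μ f :=
  h.imp fun _ hp a => (hfg a).trans (hp a)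

theorem add (hf : PolyBd μ f) (hg : PolyBd μ g) : PolyBd μ fun a => f a + g a := by
  obtain ⟨p, hp⟩ := hf
  obtain ⟨q, hq⟩ := hg
  exact ⟨p + q, fun a => by rw [Polynomial.eval_add]; exact add_le_add (hp a) (hq a)⟩

theorem mul (hf : PolyBd μ f) (hg : PolyBd μ g) : PolyBd μ fun a => f a * g a := by
  obtain ⟨p, hp⟩ := hf
  obtain ⟨q, hq⟩ := hg
  exact ⟨p * q, fun a => by rw [Polynomial.eval_mul]; exact Nat.mul_le_mul (hp a) (hq a)⟩

theorem trans {ν : α → ℕ} (hg : PolyBd ν g) (hν : PolyBd μ ν) : PolyBd μ g := by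
  obtain ⟨p, hp⟩ := hg
  obtain ⟨q, hq⟩ := hν
  exact ⟨p.comp q, fun a => by
    rw [Polynomial.eval_comp]; exact (hp a).trans (poly_mono p (hq a))⟩

theorem comp {ν g : β → ℕ} (hg : PolyBd ν g) (h : α → β) :
    PolyBd (fun a => ν (h a)) fun a => g (h a) :=
  hg.imp fun _ hp a => hp (h a)

end PolyBd

/-! ### Functions computable in polynomial time -/

/-- A measure of data that bounds the size from above. -/
structure Meas (α : Type) [TreeRep α] where
  val : α → ℕ
  size_le : ∀ a, size a ≤ val a

/-- The size as a measure. -/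
def Meas.size (α : Type) [TreeRep α] : Meas α := ⟨ParamCSP.size, fun _ => le_rfl⟩

/-- The measure of data with additional data. -/
def Meas.ctx {α : Type} [TreeRep α] (μ : Meas α) (β : Type) [TreeRep β] : Meas (α × β) :=
  ⟨fun p => μ.val p.1 + ParamCSP.size p.2 + 1, fun p => by
    have := μ.size_le p.1
    rw [size_pair]
    omega⟩

variable (B : TM2ComputableAux Letter Bool) {α β γ σ : Type} [TreeRep α] [TreeRep β] [TreeRep γ]
  [TreeRep σ]

/-- The tree `F a` can be computed from `a` in time polynomial in the measure `μ` of `a`, with `B`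
as a subroutine. -/
def PolyTr (μ : Meas α) (F : α → Tr) : Prop :=
  ∃ (c : Cmd B) (t : α → ℕ), PolyBd μ.val t ∧ (PolyBd μ.val fun a => (F a).size) ∧
    ∀ a R, Runs c (home B (rep a) R) (home B (F a) R) (t a)

/-- The function `f` can be computed in time polynomial in the measure `μ` of its argument, with
`B` as a subroutine. -/
structure PolyIn (μ : Meas α) (f : α → β) : Prop where
  tr : PolyTr B μ fun a => rep (f a)

variable {B} {μ : Meas α}

theorem Meas.polyBd_size (μ : Meas α) : PolyBd μ.val fun a => ParamCSP.size a :=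
  PolyBd.self.mono μ.size_le

namespace PolyTr

variable {F G : α → Tr}

theorem const (t : Tr) : PolyTr B μ fun _ => t :=
  ⟨.const t, fun a => 2 * size a + t.size + 2,
    (((PolyBd.const 2).mul μ.polyBd_size).add (PolyBd.const _)).add (PolyBd.const _),
    PolyBd.const _, fun _ R => Runs.const _ t R⟩

theorem id : PolyTr B μ fun a => rep a :=
  ⟨.skip, fun _ => 1, PolyBd.const 1, μ.polyBd_size, fun _ _ => Runs.skip⟩

theorem left (hF : PolyTr B μ F) : PolyTr B μ fun a => (F a).left := by
  obtain ⟨c, t, ht, hs, hc⟩ := hF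
  exact ⟨.seq c .left, fun a => t a + (10 * (F a).size + 5),
    ht.add (((PolyBd.const 10).mul hs).add (PolyBd.const 5)), hs.mono fun a => (F a).size_left,
    fun a R => (hc a R).seq (Runs.left _ R)⟩

theorem right (hF : PolyTr B μ F) : PolyTr B μ fun a => (F a).right := by
  obtain ⟨c, t, ht, hs, hc⟩ := hF
  exact ⟨.seq c .right, fun a => t a + (10 * (F a).size + 5),
    ht.add (((PolyBd.const 10).mul hs).add (PolyBd.const 5)), hs.mono fun a => (F a).size_right,
    fun a R => (hc a R).seq (Runs.right _ R)⟩

theorem node (hF : PolyTr B μ F) (hG : PolyTr B μ G) : PolyTr B μ fun a => .node (F a) (G a) := by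
  obtain ⟨c, t, ht, hs, hc⟩ := hF
  obtain ⟨d, u, hu, hs', hd⟩ := hG
  exact ⟨.node c d, fun a => t a + u a + 12 * size a + 12 * (F a).size + 11,
    (((ht.add hu).add ((PolyBd.const 12).mul μ.polyBd_size)).add
      ((PolyBd.const 12).mul hs)).add (PolyBd.const 11),
    (hs.add hs').add (PolyBd.const 1), fun a R => Runs.node (hc a) (hd a) R⟩

theorem cond {C : α → Tr} (hC : PolyTr B μ C) (hF : PolyTr B μ F) (hG : PolyTr B μ G) :
    PolyTr B μ fun a => bif (C a).isNode then F a else G a := by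
  obtain ⟨b, v, hv, hs₀, hb⟩ := hC
  obtain ⟨c, t, ht, hs, hc⟩ := hF
  obtain ⟨d, u, hu, hs', hd⟩ := hG
  refine ⟨.cond b c d, fun a => v a + (t a + u a) + 12 * size a + 2 * (C a).size + 7,
    (((hv.add (ht.add hu)).add ((PolyBd.const 12).mul μ.polyBd_size)).add
      ((PolyBd.const 2).mul hs₀)).add (PolyBd.const 7),
    (hs.add hs').mono fun a => ?_, fun a R => ?_⟩
  · cases h : (C a).isNode <;> simp [h]
  · have e := size_eq a
    cases h : (C a).isNode
    · refine (Runs.cond_false h (hb a) (hd a) R).of_eq rfl (by simp [h]) ?_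
      dsimp only
      omega
    · refine (Runs.cond_true h (hb a) (hc a) R).of_eq rfl (by simp [h]) ?_
      dsimp only
      omega

/-- The measures of argument and value are unrelated in general, so the growth of `ν` along `f` has
to be assumed; for `ν` the size it follows from `hf`. -/
theorem comp {ν : Meas β} {H : β → Tr} {f : α → β} (hH : PolyTr B ν H) (hf : PolyIn B μ f)
    (h : PolyBd μ.val fun a => ν.val (f a)) : PolyTr B μ fun a => H (f a) := by
  obtain ⟨c, t, ht, hs, hc⟩ := hH
  obtain ⟨d, u, hu, _, hd⟩ := hf.tr
  exact ⟨.seq d c, fun a => u a + t (f a), hu.add ((ht.comp f).trans h), (hs.comp f).trans h,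
    fun a R => (hd a R).seq (hc _ R)⟩

end PolyTr

theorem PolyTr.toPolyIn {F : α → Tr} {f : α → β} (h : PolyTr B μ F) (e : ∀ a, rep (f a) = F a) :
    PolyIn B μ f :=
  ⟨by simpa only [e] using h⟩

namespace PolyIn

theorem polyBd {f : α → β} (hf : PolyIn B μ f) : PolyBd μ.val fun a => size (f a) :=
  hf.tr.choose_spec.choose_spec.2.1

/-- Programs see only trees, so functions of different types with equal trees need the same program.
This lets a number serve as a list of units and a letter as a number. -/
theorem of_rep {f : α → β} {g : α → γ} (hf : PolyIn B μ f) (h : ∀ a, rep (g a) = rep (f a)) :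
    PolyIn B μ g :=
  hf.tr.toPolyIn h

theorem congr {f g : α → β} (hf : PolyIn B μ f) (h : ∀ a, g a = f a) : PolyIn B μ g :=
  hf.of_rep fun a => congrArg rep (h a)

theorem const (b : β) : PolyIn B μ fun _ => b := ⟨PolyTr.const _⟩

protected theorem id : PolyIn B μ fun a => a := ⟨PolyTr.id⟩

theorem comp' {ν : Meas β} {g : β → γ} {f : α → β} (hg : PolyIn B ν g) (hf : PolyIn B μ f)
    (h : PolyBd μ.val fun a => ν.val (f a)) : PolyIn B μ fun a => g (f a) :=
  ⟨PolyTr.comp (f := f) hg.tr hf h⟩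

theorem comp {g : β → γ} {f : α → β} (hg : PolyIn B (.size β) g) (hf : PolyIn B μ f) :
    PolyIn B μ fun a => g (f a) :=
  hg.comp' hf hf.polyBd

theorem fst {f : α → β × γ} (hf : PolyIn B μ f) : PolyIn B μ fun a => (f a).1 :=
  hf.tr.left.toPolyIn fun _ => rfl

theorem snd {f : α → β × γ} (hf : PolyIn B μ f) : PolyIn B μ fun a => (f a).2 :=
  hf.tr.right.toPolyIn fun _ => rfl

theorem pair {f : α → β} {g : α → γ} (hf : PolyIn B μ f) (hg : PolyIn B μ g) :
    PolyIn B μ fun a => (f a, g a) :=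
  (hf.tr.node hg.tr).toPolyIn fun _ => rfl

theorem lift {f : α → γ} (hf : PolyIn B μ f) : PolyIn B (μ.ctx β) fun p => f p.1 :=
  hf.comp' (PolyIn.id.fst) (PolyBd.self.mono fun p => by
    change μ.val p.1 ≤ μ.val p.1 + size p.2 + 1
    omega)

theorem cons {f : α → β} {g : α → List β} (hf : PolyIn B μ f) (hg : PolyIn B μ g) :
    PolyIn B μ fun a => f a :: g a :=
  (hf.tr.node hg.tr).toPolyIn fun _ => rfl

theorem tail {f : α → List β} (hf : PolyIn B μ f) : PolyIn B μ fun a => (f a).tail :=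
  hf.tr.right.toPolyIn fun a => by cases f a <;> rfl

theorem cond {c : α → Bool} {f g : α → β} (hc : PolyIn B μ c) (hf : PolyIn B μ f)
    (hg : PolyIn B μ g) : PolyIn B μ fun a => bif c a then f a else g a :=
  (hc.tr.cond hf.tr hg.tr).toPolyIn fun a => by cases c a <;> rfl

theorem isEmpty {f : α → List β} (hf : PolyIn B μ f) : PolyIn B μ fun a => (f a).isEmpty :=
  (hf.tr.cond (PolyTr.const (rep false)) (PolyTr.const (rep true))).toPolyIn fun a => by
    cases f a <;> rfl

theorem headD {f : α → List β} (hf : PolyIn B μ f) (b : β) :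
    PolyIn B μ fun a => (f a).headD b :=
  (hf.tr.cond hf.tr.left (PolyTr.const (rep b))).toPolyIn fun a => by cases f a <;> rfl

theorem not {c : α → Bool} (hc : PolyIn B μ c) : PolyIn B μ fun a => !c a :=
  (hc.cond (const false) (const true)).congr fun a => by cases c a <;> rfl

theorem and {c d : α → Bool} (hc : PolyIn B μ c) (hd : PolyIn B μ d) :
    PolyIn B μ fun a => c a && d a :=
  (hc.cond hd (const false)).congr fun a => by cases c a <;> rfl

theorem or {c d : α → Bool} (hc : PolyIn B μ c) (hd : PolyIn B μ d) :
    PolyIn B μ fun a => c a || d a :=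
  (hc.cond (const true) hd).congr fun a => by cases c a <;> rfl

/-- The subroutine need not be polynomial in the size: it is enough that the measure `μ` accounts
for its running time. -/
theorem ask {f : α → List Letter} {b : α → Bool} {n : α → ℕ} (hf : PolyIn B μ f)
    (hn : PolyBd μ.val n)
    (h : ∀ a, Nonempty (TM2OutputsInTime B.tm ((f a).map B.inputAlphabet.invFun)
      (some ((encodeBool (b a)).map B.outputAlphabet.invFun)) (n a))) : PolyIn B μ b := by
  obtain ⟨c, t, ht, hs, hc⟩ := hf.tr
  refine .mk ⟨.seq c .ask, fun a => t a + (15 * size (f a) + n a + 9),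
    ht.add ((((PolyBd.const 15).mul hs).add hn).add (PolyBd.const 9)),
    (PolyBd.const 3).mono fun a => size_bool _,
    fun a R => (hc a R).seq ((Runs.ask (h a) R).mono ?_)⟩
  have := length_lt_size (f a)
  omega

/-! ### Iteration over lists -/

/-- Iterating a polynomial step may blow up the data, so bounds on the intermediate values are
needed, but only for values that the fold on `l a` actually reaches. The loop carries the remaining
list in front, as `Runs.whileLeft` requires, and the argument `a` at the end. -/
theorem foldl' {ν : Meas (α × σ × β)} {l : α → List β} {s : α → σ} {g : α → σ → β → σ}
    {b : α → ℕ} (hl : PolyIn B μ l) (hs : PolyIn B μ s)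
    (hg : PolyIn B ν fun p => g p.1 p.2.1 p.2.2) (hb : PolyBd μ.val b)
    (hν : ∀ a l₁ x l₂, l a = l₁ ++ x :: l₂ → ν.val (a, l₁.foldl (g a) (s a), x) ≤ b a)
    (hsize : ∀ a l₁ l₂, l a = l₁ ++ l₂ → size (l₁.foldl (g a) (s a)) ≤ b a) :
    PolyIn B μ fun a => (l a).foldl (g a) (s a) := by
  let ν' : Meas ((β × List β) × σ × α) :=
    ⟨fun d => size d + ν.val (d.2.2, d.2.1, d.1.1), fun d => by omega⟩
  have hbody : PolyIn B ν' fun d => (d.1.2, g d.2.2 d.2.1 d.1.1, d.2.2) := by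
    refine PolyIn.id.fst.snd.pair (pair ?_ PolyIn.id.snd.snd)
    exact hg.comp' (f := fun d : (β × List β) × σ × α => (d.2.2, d.2.1, d.1.1))
      (PolyIn.id.snd.snd.pair (PolyIn.id.snd.fst.pair PolyIn.id.fst.fst))
      (PolyBd.self.mono fun d => Nat.le_add_left _ _)
  have hstart : PolyIn B μ fun a => (l a, s a, a) := hl.pair (hs.pair PolyIn.id)
  obtain ⟨c, t, ⟨p, hp⟩, _, hc⟩ := hbody.tr
  obtain ⟨c₀, t₀, ht₀, hs₀, hc₀⟩ := hstart.tr
  have hloop : PolyTr B μ fun a => rep ((l a).foldl (g a) (s a), a) := by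
    -- A bound for `ν'` at every round: remaining list, current value, argument and two nodes make
    -- up the size, and the second `b a` bounds `ν`.
    let w : α → ℕ := fun a => size (l a) + b a + size a + 2 + b a
    have hw : PolyBd μ.val w :=
      (((hl.polyBd.add hb).add μ.polyBd_size).add (PolyBd.const 2)).add hb
    refine ⟨.seq c₀ (.whileLeft c), fun a => t₀ a + ((l a).length * (p.eval (w a) + 3) + 3),
      ht₀.add (((hl.polyBd.mono fun a => (length_lt_size _).le).mul
        ((PolyBd.trans ⟨p, fun a => le_rfl⟩ hw).add (PolyBd.const 3))).add (PolyBd.const 3)),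
      ((hb.add μ.polyBd_size).add (PolyBd.const 1)).mono fun a =>
        Nat.add_le_add_right (Nat.add_le_add_right (hsize a (l a) [] (by simp)) _) _,
      fun a R => (hc₀ a R).seq ?_⟩
    have key := Runs.whileLeft (B := B) (c := c) (s := fun i => rep ((l a).drop i))
      (t := fun i => rep (((l a).take i).foldl (g a) (s a), a)) (n := (l a).length)
      (m := p.eval (w a)) (fun i hi => ?_) (by simp) (fun i hi R => ?_) R
    · simpa using key
    · rw [List.drop_eq_getElem_cons hi]; rfl
    · have e : l a = (l a).take i ++ (l a)[i] :: (l a).drop (i + 1) := by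
        rw [← List.drop_eq_getElem_cons hi, List.take_append_drop]
      have h1 := hc (((l a)[i], (l a).drop (i + 1)), ((l a).take i).foldl (g a) (s a), a) R
      have h2 : ((l a).take (i + 1)).foldl (g a) (s a) =
          g a (((l a).take i).foldl (g a) (s a)) (l a)[i] := by
        rw [List.take_succ_eq_append_getElem hi, List.foldl_append]
        rfl
      rw [List.drop_eq_getElem_cons hi, h2]
      refine h1.mono ((hp _).trans (poly_mono p ?_))
      have h3 := hν a _ _ _ e
      have h4 := hsize a _ _ e
      have h5 : size (l a) + 1 = size ((l a).take i) + size ((l a)[i] :: (l a).drop (i + 1)) := by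
        conv_lhs => rw [e]
        exact size_append _ _
      have h6 := size_pos ((l a).take i)
      simp only [size_pair, size_cons, ν', w] at *
      omega
  exact hloop.left.toPolyIn fun _ => rfl

/-- Iteration where the size of the value grows by a bounded amount in each step. -/
theorem foldl {l : α → List β} {s : α → σ} {g : α → σ → β → σ} {b : α → ℕ}
    (hl : PolyIn B μ l) (hs : PolyIn B μ s)
    (hg : PolyIn B (μ.ctx (σ × β)) fun p => g p.1 p.2.1 p.2.2) (hb : PolyBd μ.val b)
    (h : ∀ a, ∀ x ∈ l a, ∀ v, size (g a v x) ≤ size v + b a) :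
    PolyIn B μ fun a => (l a).foldl (g a) (s a) := by
  have hsize : ∀ a l₁ l₂, l a = l₁ ++ l₂ →
      size (l₁.foldl (g a) (s a)) ≤ size (s a) + l₁.length * b a := by
    intro a l₁
    -- The processed part grows at its right end.
    induction l₁ using List.reverseRecOn with
    | nil => simp
    | append_singleton l₁ x ih =>
      intro l₂ e
      have h1 := ih (x :: l₂) (by simp [e])
      have h2 := h a x (by simp [e]) (l₁.foldl (g a) (s a))
      simp only [List.foldl_append, List.foldl_cons, List.foldl_nil, List.length_append,
        List.length_singleton, Nat.add_mul]
      omega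
  have hsize' : ∀ a l₁ l₂, l a = l₁ ++ l₂ →
      size (l₁.foldl (g a) (s a)) ≤ size (s a) + size (l a) * b a := fun a l₁ l₂ e => by
    refine (hsize a l₁ l₂ e).trans (Nat.add_le_add_left (Nat.mul_le_mul_right _ ?_) _)
    have := length_lt_size (l a)
    rw [e, List.length_append] at this
    rw [e]
    omega
  refine foldl' (b := fun a => μ.val a + (size (s a) + size (l a) * b a + size (l a) + 1) + 1)
    hl hs hg ((PolyBd.self.add (((hs.polyBd.add (hl.polyBd.mul hb)).add hl.polyBd).add
      (PolyBd.const 1))).add (PolyBd.const 1)) (fun a l₁ x l₂ e => ?_)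
    fun a l₁ l₂ e => (hsize' a l₁ l₂ e).trans (by omega)
  have h1 := hsize' a l₁ (x :: l₂) e
  have h2 : size x < size (l a) := size_mem (by simp [e])
  change μ.val a + size (l₁.foldl (g a) (s a), x) + 1 ≤ _
  rw [size_pair]
  omega

end PolyIn

end

section

variable {B : TM2ComputableAux Letter Bool} {α β γ σ : Type} [TreeRep α] [TreeRep β] [TreeRep γ]
  [TreeRep σ] {μ : Meas α}

theorem foldl_cons_eq {β γ : Type} (f : β → γ) (l : List β) (s : List γ) :
    l.foldl (fun s x => f x :: s) s = (l.map f).reverse ++ s := by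
  induction l generalizing s with
  | nil => rfl
  | cons x l ih => simp [ih]

theorem foldl_replicate {σ : Type} (f : σ → σ) (n : ℕ) (s : σ) :
    (List.replicate n ()).foldl (fun s _ => f s) s = f^[n] s := by
  induction n generalizing s with
  | zero => rfl
  | succ n ih => simp [List.replicate_succ, ih]

namespace PolyIn

theorem comp₂ {f : α → β} {g : α → γ} {h : β → γ → σ}
    (hh : PolyIn B (.size (β × γ)) fun p => h p.1 p.2) (hf : PolyIn B μ f) (hg : PolyIn B μ g) :
    PolyIn B μ fun a => h (f a) (g a) :=
  hh.comp (hf.pair hg)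

/-- The values of a function at the elements of a list are bounded. -/
theorem bd_of_mem {l : α → List β} {g : α → β → γ} (hl : PolyIn B μ l)
    (hg : PolyIn B (μ.ctx β) fun p => g p.1 p.2) :
    ∃ b, PolyBd μ.val b ∧ ∀ a, ∀ x ∈ l a, size (g a x) ≤ b a := by
  obtain ⟨p, hp⟩ := hg.polyBd
  refine ⟨fun a => p.eval (μ.val a + size (l a) + 1), PolyBd.trans ⟨p, fun _ => le_rfl⟩
    ((PolyBd.self.add hl.polyBd).add (PolyBd.const 1)), fun a x hx => ?_⟩
  refine (hp (a, x)).trans (poly_mono p ?_)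
  have := size_mem hx
  change μ.val a + size x + 1 ≤ _
  omega

/-- Iteration over a list where all values are bounded. -/
theorem foldl_of_le {l : α → List β} {s : α → σ} {g : α → σ → β → σ} {b : α → ℕ}
    (hl : PolyIn B μ l) (hs : PolyIn B μ s)
    (hg : PolyIn B (μ.ctx (σ × β)) fun p => g p.1 p.2.1 p.2.2) (hb : PolyBd μ.val b)
    (h : ∀ a l₁ l₂, l a = l₁ ++ l₂ → size (l₁.foldl (g a) (s a)) ≤ b a) :
    PolyIn B μ fun a => (l a).foldl (g a) (s a) := by
  refine foldl' (b := fun a => μ.val a + (b a + size (l a) + 1) + 1)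
    hl hs hg ((PolyBd.self.add ((hb.add hl.polyBd).add
      (PolyBd.const 1))).add (PolyBd.const 1)) (fun a l₁ x l₂ e => ?_)
    fun a l₁ l₂ e => (h a l₁ l₂ e).trans (by omega)
  have h1 := h a l₁ (x :: l₂) e
  have h2 : size x < size (l a) := size_mem (by simp [e])
  change μ.val a + size (l₁.foldl (g a) (s a), x) + 1 ≤ _
  rw [size_pair]
  omega

theorem reverse {f : α → List β} (hf : PolyIn B μ f) : PolyIn B μ fun a => (f a).reverse := by
  have h : PolyIn B (.size (List β)) fun l => l.foldl (fun s x => x :: s) ([] : List β) :=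
    foldl (b := fun l => size l) PolyIn.id (const [])
      (PolyIn.cons PolyIn.id.snd.snd PolyIn.id.snd.fst) PolyBd.self
      fun l x hx v => by have := size_mem hx; simp only [size_cons]; omega
  exact (h.comp hf).congr fun a => by
    rw [foldl_cons_eq fun x : β => x, List.map_id', List.append_nil]

theorem append {f g : α → List β} (hf : PolyIn B μ f) (hg : PolyIn B μ g) :
    PolyIn B μ fun a => f a ++ g a := by
  have h : PolyIn B μ fun a => (f a).reverse.foldl (fun s x => x :: s) (g a) :=
    foldl (b := fun a => size (f a)) hf.reverse hg
      (PolyIn.cons PolyIn.id.snd.snd PolyIn.id.snd.fst) hf.polyBd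
      fun a x hx v => by have := size_mem (List.mem_reverse.1 hx); simp only [size_cons]; omega
  exact h.congr fun a => by simp

/-- The separate measure `ν`, bounded on members of the list only, admits functions with expensive
values elsewhere, such as queries to the subroutine. -/
theorem map' {ν : Meas (α × β)} {l : α → List β} {g : α → β → γ} {b : α → ℕ}
    (hl : PolyIn B μ l) (hg : PolyIn B ν fun p => g p.1 p.2) (hb : PolyBd μ.val b)
    (hν : ∀ a, ∀ x ∈ l a, ν.val (a, x) ≤ b a) : PolyIn B μ fun a => (l a).map (g a) := by
  obtain ⟨p, hp⟩ := hg.polyBd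
  let ν' : Meas (α × List γ × β) := ⟨fun q => size q + ν.val (q.1, q.2.2), fun q => by omega⟩
  have hstep : PolyIn B ν' fun q => g q.1 q.2.2 :: q.2.1 := by
    refine PolyIn.cons ?_ PolyIn.id.snd.fst
    exact hg.comp' (f := fun q : α × List γ × β => (q.1, q.2.2))
      (PolyIn.id.fst.pair PolyIn.id.snd.snd) (PolyBd.self.mono fun q => Nat.le_add_left _ _)
  have hpb : PolyBd μ.val fun a => p.eval (b a) := PolyBd.trans ⟨p, fun _ => le_rfl⟩ hb
  have hsize : ∀ a l₁ l₂, l a = l₁ ++ l₂ →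
      size (l₁.foldl (fun s x => g a x :: s) []) ≤ size (l a) * (p.eval (b a) + 1) + 1 := by
    intro a l₁ l₂ e
    have h1 : l₁.foldl (fun s x => g a x :: s) [] = (l₁.map (g a)).reverse := by
      rw [foldl_cons_eq, List.append_nil]
    rw [h1, size_reverse]
    refine (size_le_of_forall (n := p.eval (b a)) fun y hy => ?_).trans ?_
    · obtain ⟨x, hx, rfl⟩ := List.mem_map.1 hy
      exact (hp (a, x)).trans (poly_mono p (hν a x (by simp [e, hx])))
    · have := length_lt_size (l a)
      rw [e, List.length_append] at this
      rw [List.length_map, e]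
      refine Nat.add_le_add_right (Nat.mul_le_mul_right _ (by omega)) _
  have h : PolyIn B μ fun a => (l a).foldl (fun s x => g a x :: s) ([] : List γ) := by
    refine foldl' (ν := ν') (b := fun a => (size a + (size (l a) * (p.eval (b a) + 1) + 1 +
      size (l a) + 1) + 1) + b a) hl (const []) hstep
      (((μ.polyBd_size.add ((((hl.polyBd.mul (hpb.add (PolyBd.const 1))).add
        (PolyBd.const 1)).add hl.polyBd).add (PolyBd.const 1))).add (PolyBd.const 1)).add hb)
      (fun a l₁ x l₂ e => ?_) fun a l₁ l₂ e => (hsize a l₁ l₂ e).trans (by omega)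
    have h1 := hsize a l₁ _ e
    have h2 : size x < size (l a) := size_mem (by simp [e])
    have h3 := hν a x (by simp [e])
    simp only [ν', size_pair]
    omega
  exact h.reverse.congr fun a => by
    rw [foldl_cons_eq, List.append_nil, List.reverse_reverse]

theorem map {l : α → List β} {g : α → β → γ} (hl : PolyIn B μ l)
    (hg : PolyIn B (μ.ctx β) fun p => g p.1 p.2) : PolyIn B μ fun a => (l a).map (g a) :=
  map' (b := fun a => μ.val a + size (l a) + 1) hl hg
    ((PolyBd.self.add hl.polyBd).add (PolyBd.const 1)) fun a x hx => by
      have := size_mem hx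
      change μ.val a + size x + 1 ≤ _
      omega

/-- A step function that does not use the value of the iteration, in the context of a fold. -/
theorem step {g : α → β → γ} (hg : PolyIn B (μ.ctx β) fun p => g p.1 p.2) :
    PolyIn B (μ.ctx (σ × β)) fun p => g p.1 p.2.2 :=
  hg.comp' (f := fun p : α × σ × β => (p.1, p.2.2)) (PolyIn.id.fst.pair PolyIn.id.snd.snd)
    (PolyBd.self.mono fun p => by
      change μ.val p.1 + size p.2.2 + 1 ≤ μ.val p.1 + size (p.2.1, p.2.2) + 1
      rw [size_pair]
      omega)

theorem any {l : α → List β} {c : α → β → Bool} (hl : PolyIn B μ l)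
    (hc : PolyIn B (μ.ctx β) fun p => c p.1 p.2) : PolyIn B μ fun a => (l a).any (c a) := by
  have h : PolyIn B μ fun a => (l a).foldl (fun s x => s || c a x) false :=
    foldl (b := fun _ => 3) hl (const false) (PolyIn.id.snd.fst.or hc.step) (PolyBd.const 3)
      fun a x _ v => (size_bool _).trans (by omega)
  refine h.congr fun a => ?_
  suffices ∀ (l : List β) (b : Bool), l.foldl (fun s x => s || c a x) b = (b || l.any (c a)) by
    simp [this]
  intro l
  induction l with
  | nil => simp
  | cons x l ih => intro b; simp [ih, Bool.or_assoc]

theorem all {l : α → List β} {c : α → β → Bool} (hl : PolyIn B μ l)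
    (hc : PolyIn B (μ.ctx β) fun p => c p.1 p.2) : PolyIn B μ fun a => (l a).all (c a) :=
  (hl.any (c := fun a x => !c a x) hc.not).not.congr fun a => by simp [List.all_eq_not_any_not]

/-! ### Numbers -/

theorem succ {f : α → ℕ} (hf : PolyIn B μ f) : PolyIn B μ fun a => f a + 1 :=
  ((const ()).cons (g := fun a => List.replicate (f a) ()) (hf.of_rep fun _ => rfl)).of_rep
    fun _ => rfl

theorem replicate {f : α → ℕ} (hf : PolyIn B μ f) : PolyIn B μ fun a => List.replicate (f a) () :=
  hf.of_rep fun _ => rfl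

theorem pred {f : α → ℕ} (hf : PolyIn B μ f) : PolyIn B μ fun a => f a - 1 :=
  hf.replicate.tail.of_rep fun a => by rw [List.tail_replicate]; rfl

theorem isZero {f : α → ℕ} (hf : PolyIn B μ f) : PolyIn B μ fun a => decide (f a = 0) :=
  hf.replicate.isEmpty.congr fun a => by cases f a <;> rfl

/-- A unary number is a list of units, so iteration is a fold over it. -/
theorem iterate {n : α → ℕ} {s : α → σ} {g : α → σ → σ} {b : α → ℕ}
    (hn : PolyIn B μ n) (hs : PolyIn B μ s) (hg : PolyIn B (μ.ctx σ) fun p => g p.1 p.2)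
    (hb : PolyBd μ.val b) (h : ∀ a v, size (g a v) ≤ size v + b a) :
    PolyIn B μ fun a => (g a)^[n a] (s a) := by
  have := foldl (b := b) (g := fun a s _ => g a s) hn.replicate hs
    (hg.comp' (f := fun p : α × σ × Unit => (p.1, p.2.1)) (PolyIn.id.fst.pair PolyIn.id.snd.fst)
    (PolyBd.self.mono fun p => by
      change μ.val p.1 + size p.2.1 + 1 ≤ μ.val p.1 + size (p.2.1, p.2.2) + 1
      rw [size_pair]
      omega)) hb fun a x _ v => h a v
  exact this.congr fun a => (foldl_replicate _ _ _).symm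

theorem iterate_of_le {n : α → ℕ} {s : α → σ} {g : α → σ → σ} {b : α → ℕ}
    (hn : PolyIn B μ n) (hs : PolyIn B μ s) (hg : PolyIn B (μ.ctx σ) fun p => g p.1 p.2)
    (hb : PolyBd μ.val b) (h : ∀ a, ∀ i ≤ n a, size ((g a)^[i] (s a)) ≤ b a) :
    PolyIn B μ fun a => (g a)^[n a] (s a) := by
  have := foldl_of_le (b := b) (g := fun a s _ => g a s) hn.replicate hs
    (hg.comp' (f := fun p : α × σ × Unit => (p.1, p.2.1)) (PolyIn.id.fst.pair PolyIn.id.snd.fst)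
    (PolyBd.self.mono fun p => by
      change μ.val p.1 + size p.2.1 + 1 ≤ μ.val p.1 + size (p.2.1, p.2.2) + 1
      rw [size_pair]
      omega)) hb fun a l₁ l₂ e => by
        obtain ⟨h1, h2, -⟩ := List.append_eq_replicate_iff.1 e.symm
        rw [h2, foldl_replicate]
        exact h a _ (by omega)
  exact this.congr fun a => (foldl_replicate _ _ _).symm

theorem add {f g : α → ℕ} (hf : PolyIn B μ f) (hg : PolyIn B μ g) :
    PolyIn B μ fun a => f a + g a :=
  (iterate (g := fun _ v => v + 1) (b := fun _ => 2) hg hf PolyIn.id.snd.succ (PolyBd.const 2) fun a v => by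
    simp only [size_nat]; omega).congr fun a => by
      rw [show (fun p : ℕ => p + 1) = Nat.succ from rfl, Nat.succ_iterate]

theorem mul {f g : α → ℕ} (hf : PolyIn B μ f) (hg : PolyIn B μ g) :
    PolyIn B μ fun a => f a * g a :=
  (iterate (s := fun _ => 0) (g := fun a v => v + f a) (b := fun a => size (f a)) hg (const 0)
    (PolyIn.id.snd.add hf.lift) hf.polyBd fun a v => by
      simp only [size_nat]; omega).congr fun a => by
        generalize g a = n
        induction n with
        | zero => rfl
        | succ n ih => rw [Function.iterate_succ_apply', ← ih, Nat.mul_succ]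

theorem sub {f g : α → ℕ} (hf : PolyIn B μ f) (hg : PolyIn B μ g) :
    PolyIn B μ fun a => f a - g a :=
  (iterate (g := fun _ v => v - 1) (b := fun _ => 0) hg hf PolyIn.id.snd.pred (PolyBd.const 0) fun a v => by
    simp only [size_nat]; omega).congr fun a => by
      rw [show (fun p : ℕ => p - 1) = Nat.pred from rfl, Nat.pred_iterate]

/-- Truncated subtraction yields minimum, maximum and equality without a comparison primitive. -/
theorem min {f g : α → ℕ} (hf : PolyIn B μ f) (hg : PolyIn B μ g) :
    PolyIn B μ fun a => Min.min (f a) (g a) :=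
  (hf.sub (hf.sub hg)).congr fun a => by omega

theorem max {f g : α → ℕ} (hf : PolyIn B μ f) (hg : PolyIn B μ g) :
    PolyIn B μ fun a => Max.max (f a) (g a) :=
  (hf.add (hg.sub hf)).congr fun a => by omega

theorem eqNat {f g : α → ℕ} (hf : PolyIn B μ f) (hg : PolyIn B μ g) :
    PolyIn B μ fun a => decide (f a = g a) :=
  ((hf.sub hg).isZero.and (hg.sub hf).isZero).congr fun a => by
    rw [← Bool.decide_and]
    congr 1
    exact propext (by omega)

theorem length {f : α → List β} (hf : PolyIn B μ f) : PolyIn B μ fun a => (f a).length := by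
  have h : PolyIn B μ fun a => (f a).foldl (fun s _ => s + 1) 0 :=
    foldl (b := fun _ => 2) hf (const 0) PolyIn.id.snd.fst.succ (PolyBd.const 2)
      fun a x _ v => by simp only [size_nat]; omega
  exact h.congr fun a => by simp

theorem countP {l : α → List β} {c : α → β → Bool} (hl : PolyIn B μ l)
    (hc : PolyIn B (μ.ctx β) fun p => c p.1 p.2) : PolyIn B μ fun a => (l a).countP (c a) := by
  have h : PolyIn B μ fun a => (l a).foldl (fun s x => bif c a x then s + 1 else s) 0 :=
    foldl (b := fun _ => 2) hl (const 0)
      (hc.step.cond PolyIn.id.snd.fst.succ PolyIn.id.snd.fst) (PolyBd.const 2)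
      fun a x _ v => by cases c a x <;> simp only [cond_true, cond_false, size_nat] <;> omega
  refine h.congr fun a => ?_
  suffices ∀ (l : List β) (n : ℕ),
      l.foldl (fun s x => bif c a x then s + 1 else s) n = n + l.countP (c a) by
    simp [this]
  intro l
  induction l with
  | nil => simp
  | cons x l ih =>
    intro n
    rw [List.foldl_cons, ih, List.countP_cons]
    cases c a x <;> simp; omega

theorem getD {l : α → List β} {n : α → ℕ} (hl : PolyIn B μ l) (hn : PolyIn B μ n) (d : β) :
    PolyIn B μ fun a => (l a).getD (n a) d := by
  have h : PolyIn B μ fun a => List.tail^[n a] (l a) :=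
    iterate (b := fun _ => 0) hn hl PolyIn.id.snd.tail (PolyBd.const 0) fun a v => by
      cases v <;> simp; omega
  refine (h.headD d).congr fun a => ?_
  rw [List.tail_iterate]
  generalize l a = l
  generalize n a = n
  induction n generalizing l with
  | zero => cases l <;> rfl
  | succ n ih => cases l <;> simp

theorem range {n : α → ℕ} (hn : PolyIn B μ n) : PolyIn B μ fun a => List.range (n a) := by
  -- The list built so far knows the next number, namely its length.
  have e : ∀ i, (fun l : List ℕ => l ++ [l.length])^[i] [] = List.range i := by
    intro i
    induction i with
    | zero => rfl
    | succ i ih => rw [Function.iterate_succ_apply', ih, List.range_succ, List.length_range]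
  refine (iterate_of_le (s := fun _ => ([] : List ℕ)) (g := fun _ l => l ++ [l.length])
    (b := fun a => size (n a) * (size (n a) + 1) + 1) hn (const [])
    (PolyIn.id.snd.append (PolyIn.id.snd.length.cons (const [])))
    ((hn.polyBd.mul (hn.polyBd.add (PolyBd.const 1))).add (PolyBd.const 1))
    fun a i hi => ?_).congr fun a => (e _).symm
  rw [e]
  refine (size_le_of_forall (n := size (n a)) fun j hj => ?_).trans ?_
  · have := List.mem_range.1 hj
    simp only [size_nat]
    omega
  · rw [List.length_range]
    refine Nat.add_le_add_right (Nat.mul_le_mul_right _ ?_) _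
    simp only [size_nat]
    omega

/-! ### Equality tests -/

theorem eqBool {f g : α → Bool} (hf : PolyIn B μ f) (hg : PolyIn B μ g) :
    PolyIn B μ fun a => decide (f a = g a) :=
  (hf.cond hg hg.not).congr fun a => by cases f a <;> cases g a <;> rfl

/-- The fold over one list consumes the other in parallel; equality means that all heads matched and
nothing is left. The default head does no harm because emptiness is tested as well. -/
theorem eqList [DecidableEq β] [Inhabited β]
    (heq : PolyIn B (.size (β × β)) fun p => decide (p.1 = p.2)) {f g : α → List β}
    (hf : PolyIn B μ f) (hg : PolyIn B μ g) : PolyIn B μ fun a => decide (f a = g a) := by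
  have h : PolyIn B μ fun a => (f a).foldl (fun (s : Bool × List β) x =>
      (s.1 && ((!s.2.isEmpty) && decide (s.2.headD default = x)), s.2.tail)) (true, g a) := by
    refine foldl (b := fun _ => 3) hf ((const true).pair hg) ?_ (PolyBd.const 3) ?_
    · exact (PolyIn.id.snd.fst.fst.and (PolyIn.id.snd.fst.snd.isEmpty.not.and
        (heq.comp₂ (h := fun x y => decide (x = y)) (PolyIn.id.snd.fst.snd.headD default)
          PolyIn.id.snd.snd))).pair PolyIn.id.snd.fst.snd.tail
    · rintro a x - ⟨b, l⟩
      simp only [size_pair]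
      have h1 := size_bool (b && ((!l.isEmpty) && decide (l.headD default = x)))
      have h2 : size l.tail ≤ size l := size_sublist (List.tail_sublist l)
      omega
  refine (h.fst.and h.snd.isEmpty).congr fun a => ?_
  generalize g a = l'
  suffices ∀ (l l' : List β) (b : Bool), (b && decide (l = l')) =
      ((l.foldl (fun (s : Bool × List β) x =>
      (s.1 && ((!s.2.isEmpty) && decide (s.2.headD default = x)), s.2.tail)) (b, l')).1 &&
      (l.foldl (fun (s : Bool × List β) x =>
      (s.1 && ((!s.2.isEmpty) && decide (s.2.headD default = x)), s.2.tail)) (b, l')).2.isEmpty) by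
    simpa using this (f a) l' true
  intro l
  induction l with
  | nil => intro l' b; cases l' <;> simp
  | cons x l ih =>
    intro l' b
    rw [List.foldl_cons, ← ih]
    cases l' with
    | nil => simp
    | cons y l' =>
      by_cases hxy : y = x
      · subst hxy
        simp only [List.isEmpty_cons, Bool.not_false, List.headD_cons, decide_true, Bool.and_true,
          List.tail_cons, List.cons.injEq, true_and]
        congr
      · simp [hxy, Ne.symm hxy]

theorem eqWord {f g : α → List Bool} (hf : PolyIn B μ f) (hg : PolyIn B μ g) :
    PolyIn B μ fun a => decide (f a = g a) :=
  eqList (PolyIn.id.fst.eqBool PolyIn.id.snd) hf hg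

theorem eqNats {f g : α → List ℕ} (hf : PolyIn B μ f) (hg : PolyIn B μ g) :
    PolyIn B μ fun a => decide (f a = g a) :=
  eqList (PolyIn.id.fst.eqNat PolyIn.id.snd) hf hg

theorem memWord {f : α → List Bool} {l : α → List (List Bool)} (hf : PolyIn B μ f)
    (hl : PolyIn B μ l) : PolyIn B μ fun a => decide (f a ∈ l a) :=
  (hl.any (c := fun a x => decide (f a = x)) (hf.lift.eqWord PolyIn.id.snd)).congr fun a => by
    simp [List.any_eq]

end PolyIn

end

/-! ### Binary numbers -/

/-- The number of a binary word, the least significant bit first. -/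
def binVal (w : List Bool) : ℕ := w.foldr (fun b n => bif b then 2 * n + 1 else 2 * n) 0

/-- The binary words that end in `1`, and the empty word. -/
def isCanonical (w : List Bool) : Bool := w.reverse.headD true

/-- The successor of a binary number. -/
def inc : List Bool → List Bool
  | [] => [true]
  | false :: l => true :: l
  | true :: l => false :: inc l

theorem inc_encodePosNum (p : PosNum) : inc (encodePosNum p) = encodePosNum p.succ := by
  induction p with
  | one => rfl
  | bit0 p ih => rfl
  | bit1 p ih => exact congrArg _ ih

theorem encodeNat_succ (n : ℕ) : encodeNat (n + 1) = inc (encodeNat n) := by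
  unfold encodeNat
  rw [Nat.cast_succ, Num.add_one]
  cases (n : Num) with
  | zero => rfl
  | pos p => exact (inc_encodePosNum p).symm

theorem inc_iterate (n m : ℕ) : inc^[n] (encodeNat m) = encodeNat (m + n) := by
  induction n with
  | zero => rfl
  | succ n ih => rw [Function.iterate_succ_apply', ih, ← encodeNat_succ]; rfl

theorem encodeNat_zero : encodeNat 0 = [] := rfl

theorem binVal_encodePosNum (p : PosNum) : binVal (encodePosNum p) = p := by
  induction p with
  | one => rfl
  | bit0 p ih =>
    rw [PosNum.cast_bit0, ← ih]
    simp [binVal, encodePosNum]; omega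
  | bit1 p ih =>
    rw [PosNum.cast_bit1, ← ih]
    simp [binVal, encodePosNum]; omega

theorem binVal_encodeNat (n : ℕ) : binVal (encodeNat n) = n := by
  unfold encodeNat
  conv_rhs => rw [← Num.to_of_nat n]
  cases (n : Num) with
  | zero => rfl
  | pos p => exact binVal_encodePosNum p

theorem isCanonical_encodePosNum (p : PosNum) : isCanonical (encodePosNum p) = true := by
  unfold isCanonical
  induction p with
  | one => rfl
  | bit0 p ih | bit1 p ih =>
    have h := encodePosNum_nonempty p
    rw [← List.reverse_ne_nil_iff] at h
    obtain ⟨b, l, e⟩ := List.exists_cons_of_ne_nil h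
    simp_all [encodePosNum]

theorem isCanonical_encodeNat (n : ℕ) : isCanonical (encodeNat n) = true := by
  unfold encodeNat
  cases (n : Num) with
  | zero => rfl
  | pos p => exact isCanonical_encodePosNum p

theorem exists_encodePosNum {b : Bool} {l : List Bool} (h : isCanonical (b :: l) = true) :
    ∃ p, encodePosNum p = b :: l := by
  induction l generalizing b with
  | nil =>
    obtain rfl : b = true := by simpa [isCanonical] using h
    exact ⟨.one, rfl⟩
  | cons c l ih =>
    obtain ⟨p, hp⟩ := ih (b := c) (by
      have h1 : (c :: l).reverse ≠ [] := by simp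
      obtain ⟨d, l', e⟩ := List.exists_cons_of_ne_nil h1
      unfold isCanonical at h ⊢
      rw [List.reverse_cons, e] at h
      rw [e]
      simpa using h)
    cases b
    · exact ⟨.bit0 p, by rw [encodePosNum, hp]⟩
    · exact ⟨.bit1 p, by rw [encodePosNum, hp]⟩

/-- Canonical words have no superfluous leading zeros, hence they are exactly the words that
`encodeNat` produces. This is the validity test for the weight. -/
theorem encodeNat_binVal {w : List Bool} (h : isCanonical w = true) :
    encodeNat (binVal w) = w := by
  cases w with
  | nil => rfl
  | cons b l =>
    obtain ⟨p, hp⟩ := exists_encodePosNum h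
    rw [← hp, binVal_encodePosNum]
    unfold encodeNat
    have : ((p : ℕ) : Num) = Num.pos p := Num.of_to_nat (Num.pos p)
    rw [this]
    rfl

/-- Evaluation from the most significant digit passes through the values of the suffixes; none of
them exceeds the final value. -/
theorem binVal_append_le (l l' : List Bool) : binVal l' ≤ binVal (l ++ l') := by
  induction l with
  | nil => rfl
  | cons b l ih =>
    refine ih.trans ?_
    cases b <;> simp [binVal] <;> omega

/-! ### Parsing -/

/-- Add a letter at the front of a word that has been parsed into blocks of binary words. -/
def parseLetter (x : Letter) (bs : List (List (List Bool))) : List (List (List Bool)) :=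
  match x with
  | .bit b => ((b :: (bs.headD []).headD []) :: (bs.headD []).tail) :: bs.tail
  | .comma => ([] :: bs.headD []) :: bs.tail
  | .semicolon => [[]] :: bs

/-- The blocks of a word. -/
def parse (x : List Letter) : List (List (List Bool)) := x.foldr parseLetter [[[]]]

/-- The word of a block. -/
def renderBlock (c : List (List Bool)) : List Letter :=
  (c.headD []).map .bit ++ c.tail.flatMap fun w => .comma :: w.map .bit

/-- The word of a sequence of blocks. -/
def render (bs : List (List (List Bool))) : List Letter :=
  renderBlock (bs.headD []) ++ bs.tail.flatMap fun c => .semicolon :: renderBlock c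

/-- Parsing never fails: every word splits into blocks and can be recovered from them. Whether it is
an instance is decided afterwards, on the blocks. -/
theorem render_parse (x : List Letter) :
    (parse x ≠ [] ∧ ∀ c ∈ parse x, c ≠ []) ∧ render (parse x) = x := by
  induction x with
  | nil => exact ⟨by simp [parse], rfl⟩
  | cons x l ih =>
    have e : parse (x :: l) = parseLetter x (parse l) := rfl
    rw [e]
    obtain ⟨⟨h1, h2⟩, h3⟩ := ih
    obtain ⟨c, bs, hp⟩ := List.exists_cons_of_ne_nil h1
    rw [hp] at h2 h3 ⊢
    obtain ⟨w, ws, rfl⟩ := List.exists_cons_of_ne_nil (h2 c (by simp))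
    rcases x with b | _ | _
    · refine ⟨⟨by simp [parseLetter], ?_⟩, ?_⟩
      · simpa [parseLetter] using h2
      · simpa [parseLetter, render, renderBlock] using h3
    · refine ⟨⟨by simp [parseLetter], ?_⟩, ?_⟩
      · simpa [parseLetter] using h2
      · simpa [parseLetter, render, renderBlock] using h3
    · refine ⟨⟨by simp [parseLetter], ?_⟩, ?_⟩
      · simpa [parseLetter] using h2
      · simpa [parseLetter, render, renderBlock] using h3

theorem foldr_parseLetter_bits (w w' : List Bool) (ws : List (List Bool))
    (bs : List (List (List Bool))) :
    (w.map .bit).foldr parseLetter ((w' :: ws) :: bs) = ((w ++ w') :: ws) :: bs := by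
  induction w with
  | nil => rfl
  | cons b w ih => rw [List.map_cons, List.foldr_cons, ih]; rfl

theorem foldr_parseLetter_words (ws ws' : List (List Bool)) (bs : List (List (List Bool))) :
    (ws.flatMap fun w => .comma :: w.map .bit).foldr parseLetter (([] :: ws') :: bs) =
      ([] :: (ws ++ ws')) :: bs := by
  induction ws with
  | nil => rfl
  | cons w ws ih =>
    rw [List.flatMap_cons, List.foldr_append, ih, List.foldr_cons, foldr_parseLetter_bits,
      List.append_nil]
    rfl

/-- The parser works from the right, so reading a block completes the empty block opened by the
semicolon behind it, or by the end of the word. -/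
theorem foldr_parseLetter_block {c : List (List Bool)} (hc : c ≠ [])
    (bs : List (List (List Bool))) :
    (renderBlock c).foldr parseLetter ([[]] :: bs) = c :: bs := by
  obtain ⟨w, ws, rfl⟩ := List.exists_cons_of_ne_nil hc
  rw [renderBlock, List.foldr_append, List.tail_cons, foldr_parseLetter_words,
    foldr_parseLetter_bits]
  simp

theorem parse_render {bs : List (List (List Bool))} (hbs : bs ≠ []) (h : ∀ c ∈ bs, c ≠ []) :
    parse (render bs) = bs := by
  obtain ⟨c, bs, rfl⟩ := List.exists_cons_of_ne_nil hbs
  have key : (bs.flatMap fun c => .semicolon :: renderBlock c).foldr parseLetter [[[]]] =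
      [[]] :: bs := by
    clear hbs
    induction bs with
    | nil => rfl
    | cons d bs ih =>
      rw [List.flatMap_cons, List.foldr_append, ih (by simp_all), List.foldr_cons,
        foldr_parseLetter_block (h d (by simp))]
      rfl
  rw [parse, render, List.foldr_append, List.tail_cons, key, List.headD_cons,
    foldr_parseLetter_block (h c (by simp))]

/-! ### Instances as blocks -/

/-- The blocks of an instance. -/
def Instance.blocks {Γ : ConstraintLanguage} (I : Instance Γ) : List (List (List Bool)) :=
  (encodeNat I.weight :: I.vars) ::
    I.constraints.map fun c => encodeNat c.index :: List.ofFn c.scope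

theorem Instance.encode_eq_render {Γ : ConstraintLanguage} (I : Instance Γ) :
    I.encode = render I.blocks := by
  simp [encode, render, blocks, encodeBlock, renderBlock, List.flatMap_map]

theorem Instance.parse_encode {Γ : ConstraintLanguage} (I : Instance Γ) :
    parse I.encode = I.blocks := by
  rw [I.encode_eq_render]
  exact parse_render (by simp [blocks]) (by simp [blocks])

theorem Instance.encode_eq_iff {Γ : ConstraintLanguage} (I : Instance Γ) (x : List Letter) :
    I.encode = x ↔ parse x = I.blocks :=
  ⟨fun h => h ▸ I.parse_encode, fun h => by
    rw [I.encode_eq_render, ← h, (render_parse x).2]⟩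

/-- The binary weight, the variables and the scopes of the constraints. -/
abbrev RawInstance : Type := List Bool × List (List Bool) × List (List (List Bool))

/-- The data of a sequence of blocks. -/
def rawInstance (bs : List (List (List Bool))) : RawInstance :=
  ((bs.headD []).headD [], (bs.headD []).tail, bs.tail.map List.tail)

/-- The test that a block is a constraint over the given variables. -/
def validConstraint (vars c : List (List Bool)) : Bool :=
  decide (c.headD [] = encodeNat c.tail.length) &&
    ((!c.tail.isEmpty) && c.tail.all fun v => decide (v ∈ vars))

/-- The test that a sequence of blocks comes from an instance. -/
def validBlocks (bs : List (List (List Bool))) : Bool :=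
  isCanonical (rawInstance bs).1 && ((!(rawInstance bs).2.1.isEmpty) &&
    (((rawInstance bs).2.1.all fun v =>
      decide ((rawInstance bs).2.1.countP (fun w => decide (w = v)) = 1)) &&
      bs.tail.all fun c => validConstraint (rawInstance bs).2.1 c))

/-- The data of an instance. -/
def Instance.raw {Γ : ConstraintLanguage} (I : Instance Γ) : RawInstance :=
  (encodeNat I.weight, I.vars, I.constraints.map fun c => List.ofFn c.scope)

theorem Instance.rawInstance_blocks {Γ : ConstraintLanguage} (I : Instance Γ) :
    rawInstance I.blocks = I.raw := by
  simp [rawInstance, blocks, raw]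

theorem nodup_iff_countP (l : List (List Bool)) :
    l.Nodup ↔ (l.all fun v => decide (l.countP (fun w => decide (w = v)) = 1)) = true := by
  simp only [List.all_eq_true, decide_eq_true_eq, List.nodup_iff_count_eq_one, List.count,
    beq_eq_decide]

theorem Instance.validBlocks_blocks {E : Set ℕ} (I : Instance (weightLanguage E)) :
    validBlocks I.blocks = true := by
  rw [validBlocks, I.rawInstance_blocks]
  simp only [Bool.and_eq_true]
  refine ⟨isCanonical_encodeNat _, by simpa [raw] using I.vars_ne_nil,
    (nodup_iff_countP _).1 I.vars_nodup, List.all_eq_true.2 fun c hc => ?_⟩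
  obtain ⟨c, hcI, rfl⟩ := List.mem_map.1 hc
  have h1 : (weightLanguage E).arity c.index = c.index := rfl
  have h2 := c.index.pos
  simp only [validConstraint, List.headD_cons, List.tail_cons, List.length_ofFn, h1, decide_true,
    Bool.true_and, Bool.and_eq_true, List.all_eq_true, decide_eq_true_eq]
  refine ⟨?_, ?_⟩
  · rw [Bool.not_eq_true', List.isEmpty_eq_false_iff, ne_eq, ← List.length_eq_zero_iff,
      List.length_ofFn]
    omega
  · intro v hv
    obtain ⟨j, rfl⟩ := (List.mem_ofFn' _ _).1 hv
    exact I.scope_mem c hcI j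

theorem exists_instance {E : Set ℕ} {bs : List (List (List Bool))} (h0 : bs ≠ [])
    (h1 : ∀ c ∈ bs, c ≠ []) (h : validBlocks bs = true) :
    ∃ I : Instance (weightLanguage E), I.blocks = bs := by
  obtain ⟨c, bs, rfl⟩ := List.exists_cons_of_ne_nil h0
  obtain ⟨w, ws, rfl⟩ := List.exists_cons_of_ne_nil (h1 c (by simp))
  simp only [validBlocks, rawInstance, List.headD_cons, List.tail_cons, Bool.and_eq_true] at h
  obtain ⟨h2, h3, h4, h5⟩ := h
  have key : ∀ bs : List (List (List Bool)), (∀ c ∈ bs, c ≠ []) →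
      (bs.all fun c => validConstraint ws c) = true →
      ∃ cs : List (Constraint (weightLanguage E)), (∀ c ∈ cs, ∀ j, c.scope j ∈ ws) ∧
        (cs.map fun c => encodeNat c.index :: List.ofFn c.scope) = bs := by
    intro bs
    induction bs with
    | nil => exact fun _ _ => ⟨[], by simp, rfl⟩
    | cons c bs ih =>
      intro hne hall
      rw [List.all_cons, Bool.and_eq_true] at hall
      obtain ⟨cs, hcs, rfl⟩ := ih (fun c hc => hne c (List.mem_cons_of_mem _ hc)) hall.2
      obtain ⟨i, sc, rfl⟩ := List.exists_cons_of_ne_nil (hne c (by simp))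
      simp only [validConstraint, List.headD_cons, List.tail_cons, Bool.and_eq_true] at hall
      obtain ⟨⟨hi, ha, hb⟩, -⟩ := hall
      -- In `weightLanguage` the index is the arity, so the index word must be the binary length of
      -- the scope.
      obtain rfl := of_decide_eq_true hi
      simp only [List.all_eq_true, decide_eq_true_eq] at hb
      have hpos : 0 < sc.length := by
        cases sc <;> simp at ha ⊢
      refine ⟨⟨⟨sc.length, hpos⟩, sc.get⟩ :: cs, ?_, ?_⟩
      · intro c hc
        rcases List.mem_cons.1 hc with rfl | hc
        · exact fun j => hb _ (List.get_mem sc j)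
        · exact hcs c hc
      · simp only [List.map_cons, PNat.mk_coe, List.cons.injEq, true_and, and_true]
        exact List.ofFn_get sc
  obtain ⟨cs, hcs, rfl⟩ := key bs (fun c hc => h1 c (List.mem_cons_of_mem _ hc)) h5
  refine ⟨⟨ws, (nodup_iff_countP _).2 h4, by simpa using h3, binVal w, cs, hcs⟩, ?_⟩
  simp [Instance.blocks, encodeNat_binVal h2]

/-- The instances are the words that parse into valid blocks. -/
theorem validBlocks_iff {E : Set ℕ} (x : List Letter) :
    validBlocks (parse x) = true ↔ ∃ I : Instance (weightLanguage E), I.encode = x := by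
  constructor
  · intro h
    obtain ⟨I, hI⟩ := exists_instance (E := E) (render_parse x).1.1 (render_parse x).1.2 h
    exact ⟨I, (I.encode_eq_iff x).2 hI.symm⟩
  · rintro ⟨I, rfl⟩
    rw [I.parse_encode, I.validBlocks_blocks]

/-! ### The parameter -/

/-- The maximal number of occurrences of a variable in a scope, or `1`. -/
def maxOcc (vars : List (List Bool)) (cs : List (List (List Bool))) : ℕ :=
  (vars.map fun v => (cs.map fun c => c.countP fun w => decide (w = v)).foldl max 0).foldl max 1

theorem foldl_max_le_iff (l : List ℕ) (s n : ℕ) : l.foldl max s ≤ n ↔ s ≤ n ∧ ∀ x ∈ l, x ≤ n := by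
  induction l generalizing s with
  | nil => simp
  | cons x l ih => simp [ih, and_assoc]

theorem foldr_max_le_iff (l : List ℕ) (n : ℕ) : l.foldr max 0 ≤ n ↔ ∀ x ∈ l, x ≤ n := by
  induction l with
  | nil => simp
  | cons x l ih => simp [ih]

theorem card_filter_fin {α : Type} {r : ℕ} (f : Fin r → α) (p : α → Prop) [DecidablePred p] :
    (Finset.univ.filter fun j => p (f j)).card = (List.ofFn f).countP fun x => decide (p x) := by
  induction r with
  | zero => simp
  | succ r ih =>
    rw [List.ofFn_succ, List.countP_cons, ← ih, Fin.univ_succ, Finset.filter_cons]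
    split_ifs with h <;> simp_all [Finset.filter_map, Finset.card_map]

/-- The weight constraint contains every variable exactly once and there is at least one variable;
this accounts for the start value 1 in `maxOcc`. Both maxima are compared through their upper
bounds. -/
theorem Instance.e_eq {E : Set ℕ} (I : Instance (weightLanguage E)) :
    I.e = maxOcc I.vars (I.constraints.map fun c => List.ofFn c.scope) := by
  refine eq_of_forall_ge_iff fun n => ?_
  have h1 : ∀ v ∈ I.vars, (AppliedRelation.mk I.vars.length (weightRel {I.weight} I.vars.length)
      I.vars.get).occurrences v = 1 := by
    intro v hv
    have h2 := card_filter_fin I.vars.get (· = v)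
    rw [List.ofFn_get] at h2
    refine h2.trans ?_
    have := (nodup_iff_countP _).1 I.vars_nodup
    simp only [List.all_eq_true, decide_eq_true_eq] at this
    exact this v hv
  have h2 : ∀ (c : Constraint (weightLanguage E)) (v : List Bool),
      c.toApplied.occurrences v = (List.ofFn c.scope).countP fun w => decide (w = v) :=
    fun c v => card_filter_fin c.scope (· = v)
  simp only [e, V, C, maxOcc, Finset.sup_le_iff, foldr_max_le_iff, foldl_max_le_iff,
    List.mem_toFinset, List.mem_map, List.map_cons, List.map_map, List.mem_cons,
    forall_eq_or_imp, forall_exists_index, and_imp, forall_apply_eq_imp_iff₂, Function.comp_apply,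
    h2, zero_le, true_and]
  constructor
  · intro h
    obtain ⟨v, hv⟩ := List.exists_mem_of_ne_nil _ I.vars_ne_nil
    exact ⟨(h1 v hv) ▸ (h v hv).1, fun v hv => (h v hv).2⟩
  · exact fun h v hv => ⟨(h1 v hv).trans_le h.1, h.2 v hv⟩

/-- The parameters `u` and `e` of the data of an instance. -/
def RawInstance.u (q : RawInstance) : ℕ := q.2.2.length + 1
def RawInstance.e (q : RawInstance) : ℕ := maxOcc q.2.1 q.2.2

theorem Instance.raw_u {E : Set ℕ} (I : Instance (weightLanguage E)) : RawInstance.u I.raw = I.u := by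
  simp [RawInstance.u, raw, u, C]

theorem Instance.raw_e {E : Set ℕ} (I : Instance (weightLanguage E)) : RawInstance.e I.raw = I.e :=
  I.e_eq.symm

theorem parameterOnWords_encode {Γ : ConstraintLanguage} (param : Instance Γ → ℕ)
    (I : Instance Γ) : parameterOnWords param I.encode = param I :=
  (Instance.encode_injective Γ).extend_apply _ _ _

/-- The weight may be exponential in the length of the word, so it is never converted to unary here:
`g` successor steps on its binary word give the sum. -/
theorem encode_parameterOnWords {E : Set ℕ} (g : RawInstance → ℕ) (x : List Letter) :
    encodeNat (parameterOnWords
      (fun I : Instance (weightLanguage E) => I.k + g I.raw) x) =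
    bif validBlocks (parse x) then
      inc^[g (rawInstance (parse x))] (rawInstance (parse x)).1 else [true] := by
  cases h : validBlocks (parse x)
  · have h1 : ¬ ∃ I : Instance (weightLanguage E), I.encode = x := by
      rw [← validBlocks_iff, h]
      simp
    -- The value 1 at other words has the binary word `[true]`.
    rw [parameterOnWords, Function.extend_apply' _ _ _ h1]
    rfl
  · obtain ⟨I, rfl⟩ := (validBlocks_iff (E := E) x).1 h
    rw [parameterOnWords_encode, I.parse_encode, I.rawInstance_blocks, cond_true]
    exact (inc_iterate _ _).symm

/-! ### Parsing, validity and parameters in polynomial time -/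

section

variable {B : TM2ComputableAux Letter Bool} {α β γ σ : Type} [TreeRep α] [TreeRep β] [TreeRep γ]
  [TreeRep σ] {μ : Meas α}

theorem size_inc (l : List Bool) : size (inc l) ≤ size l + 4 := by
  have h0 : size false = 1 := rfl
  have h1 : size true = 3 := rfl
  induction l with
  | nil => decide
  | cons b l ih =>
    cases b
    · simp only [inc, size_cons, h0, h1]
      omega
    · simp only [inc, size_cons, h0, h1]
      omega

namespace PolyIn

theorem isCanonical {f : α → List Bool} (hf : PolyIn B μ f) :
    PolyIn B μ fun a => isCanonical (f a) :=
  hf.reverse.headD true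

theorem inc {f : α → List Bool} (hf : PolyIn B μ f) : PolyIn B μ fun a => inc (f a) := by
  -- The state is the carry and the reversed output; a carry left at the end becomes a new top
  -- digit.
  let step : Bool × List Bool → Bool → Bool × List Bool := fun s b =>
    (s.1 && b, (bif s.1 then !b else b) :: s.2)
  have h : PolyIn B μ fun a => (f a).foldl step (true, []) := by
    refine foldl (b := fun _ => 7) hf (const _) ?_ (PolyBd.const 7) ?_
    · exact (PolyIn.id.snd.fst.fst.and PolyIn.id.snd.snd).pair
        ((PolyIn.id.snd.fst.fst.cond PolyIn.id.snd.snd.not PolyIn.id.snd.snd).cons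
          PolyIn.id.snd.fst.snd)
    · rintro a b - ⟨c, l⟩
      have h1 := size_bool (c && b)
      have h2 := size_bool (bif c then !b else b)
      simp only [step, size_pair, size_cons]
      omega
  refine (h.fst.cond ((const true).cons h.snd) h.snd).reverse.congr fun a => ?_
  -- Without carry the remaining digits are copied.
  have h0 : ∀ l s : List Bool, ((l.foldl step (false, s)).1 = false) ∧
      (l.foldl step (false, s)).2.reverse = s.reverse ++ l := by
    intro l
    induction l with
    | nil => simp
    | cons b l ih => intro s; simpa [step] using ih (b :: s)
  suffices ∀ l s : List Bool, s.reverse ++ ParamCSP.inc l =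
      (bif (l.foldl step (true, s)).1 then true :: (l.foldl step (true, s)).2
        else (l.foldl step (true, s)).2).reverse from this (f a) []
  intro l
  induction l with
  | nil => intro s; simp [ParamCSP.inc]
  | cons b l ih =>
    intro s
    cases b
    · have := h0 l (true :: s)
      simp [step, ParamCSP.inc, this]
    · have := ih (false :: s)
      simpa [step, ParamCSP.inc] using this

theorem encodeNat {f : α → ℕ} (hf : PolyIn B μ f) : PolyIn B μ fun a => encodeNat (f a) :=
  (iterate (s := fun _ => ([] : List Bool)) (g := fun _ v => ParamCSP.inc v) (b := fun _ => 4) hf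
    (const []) PolyIn.id.snd.inc (PolyBd.const 4) fun _ v => size_inc v).congr fun a => by
      rw [← encodeNat_zero, inc_iterate, Nat.zero_add]

theorem incIterate {f : α → List Bool} {n : α → ℕ} (hf : PolyIn B μ f) (hn : PolyIn B μ n) :
    PolyIn B μ fun a => ParamCSP.inc^[n a] (f a) :=
  iterate (g := fun _ v => ParamCSP.inc v) (b := fun _ => 4) hn hf PolyIn.id.snd.inc
    (PolyBd.const 4) fun _ v => size_inc v

/-- The unary value may be exponential in the word, so its bound is a hypothesis; it is met by
measures that include the weight. -/
theorem binVal {f : α → List Bool} (hf : PolyIn B μ f)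
    (h : PolyBd μ.val fun a => binVal (f a)) : PolyIn B μ fun a => binVal (f a) := by
  refine (foldl_of_le (l := fun a => (f a).reverse) (s := fun _ => 0)
    (g := fun _ n b => bif b then 2 * n + 1 else 2 * n) (b := fun a => 2 * ParamCSP.binVal (f a) + 1)
    hf.reverse (const 0) (PolyIn.id.snd.snd.cond ((const 2).mul PolyIn.id.snd.fst).succ
      ((const 2).mul PolyIn.id.snd.fst)) (((PolyBd.const 2).mul h).add (PolyBd.const 1))
      fun a l₁ l₂ e => ?_).congr fun a => ?_
  · have e2 : f a = l₂.reverse ++ l₁.reverse := by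
      rw [← List.reverse_append, ← e, List.reverse_reverse]
    have h3 := binVal_append_le l₂.reverse l₁.reverse
    rw [← e2] at h3
    rw [size_nat]
    have h4 : l₁.foldl (fun n b => bif b then 2 * n + 1 else 2 * n) 0 =
        ParamCSP.binVal l₁.reverse := by
      rw [ParamCSP.binVal, List.foldr_reverse]
    rw [h4]
    omega
  · rw [ParamCSP.binVal, List.foldl_reverse]

theorem letterNat {f : α → Letter} (hf : PolyIn B μ f) : PolyIn B μ fun a => (f a).toNat :=
  hf.of_rep fun _ => rfl

theorem parse {f : α → List Letter} (hf : PolyIn B μ f) : PolyIn B μ fun a => parse (f a) := by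
  have hstep : PolyIn B (μ.ctx (List (List (List Bool)) × Letter))
      fun p => parseLetter p.2.2 p.2.1 := by
    have hs : PolyIn B (μ.ctx (List (List (List Bool)) × Letter)) fun p => p.2.1 :=
      PolyIn.id.snd.fst
    have hx := (PolyIn.id (B := B) (μ := μ.ctx (List (List (List Bool)) × Letter))).snd.snd.letterNat
    have hbit (b : Bool) := ((((const b).cons ((hs.headD []).headD [])).cons
      (hs.headD []).tail).cons hs.tail)
    refine (hx.isZero.cond (hbit false) (hx.pred.isZero.cond (hbit true)
      (hx.pred.pred.isZero.cond (((const []).cons (hs.headD [])).cons hs.tail)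
        ((const [[]]).cons hs)))).congr fun p => ?_
    rcases p with ⟨_, _, (_ | _) | _ | _⟩ <;> rfl
  refine (foldl (l := fun a => (f a).reverse) (s := fun _ => [[[]]])
    (g := fun _ s x => parseLetter x s) (b := fun _ => 9) hf.reverse (const _) hstep
    (PolyBd.const 9) fun a x _ s => ?_).congr fun a => by
      rw [List.foldl_reverse]
      rfl
  have h1 : size (s.headD []) + size s.tail ≤ size s + 1 := by cases s <;> simp; omega
  have h2 : size ((s.headD []).headD []) + size (s.headD []).tail ≤ size (s.headD []) + 1 := by
    cases s.headD [] <;> simp; omega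
  rcases x with b | _ | _
  · have := size_bool b
    simp only [parseLetter, size_cons]
    omega
  · simp only [parseLetter, size_cons, size_nil]
    omega
  · simp only [parseLetter, size_cons, size_nil]
    omega

theorem raw {f : α → List (List (List Bool))} (hf : PolyIn B μ f) :
    PolyIn B μ fun a => rawInstance (f a) :=
  ((hf.headD []).headD []).pair ((hf.headD []).tail.pair (hf.tail.map PolyIn.id.snd.tail))

theorem countEq {l : α → List (List Bool)} {f : α → List Bool} (hl : PolyIn B μ l)
    (hf : PolyIn B μ f) : PolyIn B μ fun a => (l a).countP fun w => decide (w = f a) :=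
  hl.countP (c := fun a w => decide (w = f a)) (PolyIn.id.snd.eqWord hf.lift)

theorem validBlocks {f : α → List (List (List Bool))} (hf : PolyIn B μ f) :
    PolyIn B μ fun a => validBlocks (f a) := by
  have hv := hf.raw.snd.fst
  refine hf.raw.fst.isCanonical.and (hv.isEmpty.not.and ((hv.all ?_).and (hf.tail.all ?_)))
  · exact (hv.lift.countEq PolyIn.id.snd).eqNat (const 1)
  · have hc := (PolyIn.id (B := B) (μ := μ.ctx (List (List Bool)))).snd
    refine ((hc.headD []).eqWord hc.tail.length.encodeNat).and (hc.tail.isEmpty.not.and ?_)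
    exact hc.tail.all (c := fun p v => decide (v ∈ (rawInstance (f p.1)).2.1))
      (PolyIn.id.snd.memWord hv.lift.lift)

theorem listMax {f : α → List ℕ} (hf : PolyIn B μ f) (n : ℕ) :
    PolyIn B μ fun a => (f a).foldl Max.max n :=
  foldl (g := fun _ s x => Max.max s x) (b := fun a => size (f a)) hf (const n)
    (PolyIn.id.snd.fst.max PolyIn.id.snd.snd) hf.polyBd fun a x hx v => by
      have := size_mem hx
      simp only [size_nat] at *
      omega

theorem maxOcc {vars : α → List (List Bool)} {cs : α → List (List (List Bool))}
    (hv : PolyIn B μ vars) (hc : PolyIn B μ cs) : PolyIn B μ fun a => maxOcc (vars a) (cs a) := by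
  refine (hv.map (g := fun a v => ((cs a).map fun c =>
    c.countP fun w => decide (w = v)).foldl Max.max 0) (listMax ?_ 0)).listMax 1
  exact hc.lift.map (g := fun p c => c.countP fun w => decide (w = p.2))
    (PolyIn.id.snd.countEq PolyIn.id.fst.snd)

theorem rawU {f : α → RawInstance} (hf : PolyIn B μ f) :
    PolyIn B μ fun a => RawInstance.u (f a) :=
  hf.snd.snd.length.succ

theorem rawE {f : α → RawInstance} (hf : PolyIn B μ f) :
    PolyIn B μ fun a => RawInstance.e (f a) :=
  hf.snd.fst.maxOcc hf.snd.snd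

end PolyIn

/-- The machine of a function on words. -/
theorem PolyIn.exists_machine {μ : Meas (List Letter)} {f : List Letter → List Bool}
    (hf : PolyIn B μ f) : ∃ (M : TM2ComputableAux Letter Bool) (p : Polynomial ℕ), ∀ x,
      Nonempty (TM2OutputsInTime M.tm (x.map M.inputAlphabet.invFun)
        (some ((f x).map M.outputAlphabet.invFun)) (p.eval (μ.val x + x.length))) := by
  obtain ⟨c, t, ht, ⟨q, hq⟩, hc⟩ := hf.tr
  obtain ⟨p, hp⟩ := ht
  -- The constants 16, 15 and 6 stem from `Runs.full`; one more step halts.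
  refine ⟨c.full.machine, 16 * Polynomial.X + p + 15 * q + 7, fun x => ?_⟩
  have hle : 16 * x.length + t x + 15 * (f x).length + 6 ≤
      (16 * Polynomial.X + p + 15 * q + 6 : Polynomial ℕ).eval (μ.val x + x.length) := by
    have h1 := (hp x).trans (poly_mono p (Nat.le_add_right (μ.val x) x.length))
    have h2 := (hq x).trans (poly_mono q (Nat.le_add_right (μ.val x) x.length))
    have h3 := length_lt_size (f x)
    change size (f x) ≤ _ at h2
    simp only [Polynomial.eval_add, Polynomial.eval_mul, Polynomial.eval_X,
      Polynomial.eval_ofNat]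
    omega
  obtain ⟨h⟩ := ((Runs.full (hc x [])).mono hle).machine
  exact ⟨⟨h.toEvalsTo, h.steps_le_m.trans (by simp)⟩⟩

/-- A machine that halts at once. -/
noncomputable def haltMachine : TM2ComputableAux Letter Bool where
  tm :=
    { K := Bool
      k₀ := true
      k₁ := false
      Γ := fun b => match b with
        | true => Letter
        | false => Bool
      Λ := Unit
      main := ()
      σ := Unit
      initialState := ()
      Γk₀Fin := inferInstanceAs (Fintype Letter)
      m := fun _ => .halt }
  inputAlphabet := Equiv.refl _
  outputAlphabet := Equiv.refl _

theorem polynomial_parameterization {E : Set ℕ} {g : RawInstance → ℕ}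
    (hg : PolyIn haltMachine (.size RawInstance) g) :
    Nonempty (TM2ComputableInPolyTime (id : List Letter → List Letter) encodeNat
      (parameterOnWords fun I : Instance (weightLanguage E) => I.k + g I.raw)) := by
  have hp : PolyIn haltMachine (.size (List Letter))
      fun x => parse x := PolyIn.id.parse
  have h := (hp.validBlocks.cond (hp.raw.fst.incIterate (hg.comp hp.raw))
    (PolyIn.const [true])).congr fun x => encode_parameterOnWords (E := E) g x
  obtain ⟨M, p, hM⟩ := h.exists_machine
  refine ⟨{ M with
    -- The tree of a word `x` has size at most `8 * |x| + 1`.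
    time := p.comp (8 * Polynomial.X + 1 + Polynomial.X)
    outputsFun := fun x => ?_ }⟩
  have h1 := (hM x).some
  refine ⟨h1.toEvalsTo, h1.steps_le_m.trans ?_⟩
  rw [Polynomial.eval_comp]
  refine poly_mono p ?_
  have := size_words x
  simp only [Polynomial.eval_add, Polynomial.eval_mul, Polynomial.eval_X,
    Polynomial.eval_ofNat, Polynomial.eval_one, id]
  change size x + x.length ≤ _
  omega

end

section

/-! ### Dynamic programming over the variables -/

/-- The number of positions of a scope whose variable belongs to `D`. -/
def hits (c D : List (List Bool)) : ℕ := c.countP fun w => decide (w ∈ D)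

/-- The size of `D` and the numbers of hits of `D` in the scopes, truncated at `M`. -/
def signature (M : ℕ) (cs : List (List (List Bool))) (D : List (List Bool)) : List ℕ :=
  min M D.length :: cs.map fun c => min M (hits c D)

/-- Insert an assignment unless there is one of the same signature. -/
def insertSig (M : ℕ) (cs R : List (List (List Bool))) (D : List (List Bool)) :
    List (List (List Bool)) :=
  bif R.any fun D' => decide (signature M cs D' = signature M cs D) then R else D :: R

/-- Extend a list of assignments by the assignments that contain one more variable. -/
def extendBy (M : ℕ) (cs R : List (List (List Bool))) (v : List Bool) :
    List (List (List Bool)) :=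
  R.foldl (fun R' D => insertSig M cs R' (v :: D)) R

/-- Assignments of all signatures. -/
def representatives (M : ℕ) (cs : List (List (List Bool))) (vars : List (List Bool)) :
    List (List (List Bool)) :=
  vars.foldl (extendBy M cs) [[]]

/-- The test of an assignment, where `T` is a table of the allowed numbers of hits. -/
def checkAssignment (T : List Bool) (k : ℕ) (cs : List (List (List Bool)))
    (D : List (List Bool)) : Bool :=
  decide (D.length = k) && cs.all fun c => T.getD (min (T.length - 1) (hits c D)) false

/-- The decision procedure. -/
def solve (T : List Bool) (q : RawInstance) : Bool :=
  (representatives (T.length - 1) q.2.2 q.2.1).any (checkAssignment T (binVal q.1) q.2.2)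

/-! ### Correctness of the dynamic program and the number of representatives -/

section Correctness

variable {M : ℕ} {cs R : List (List (List Bool))} {D D' X : List (List Bool)} {v : List Bool}

theorem hits_cons (c : List (List Bool)) (hv : v ∉ D) :
    hits c (v :: D) = (c.countP fun w => decide (w = v)) + hits c D := by
  induction c with
  | nil => rfl
  | cons w c ih =>
    simp only [hits, List.countP_cons] at ih ⊢
    rw [ih]
    by_cases h : w = v
    · subst h; simp [hv]; omega
    · simp [h]; omega

/-- The exchange property. By `hits_cons` a new variable adds the same amount to both hit numbers,
and `min M (a + h)` depends only on `a` and `min M h`. -/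
theorem signature_cons (h : signature M cs D = signature M cs D') (hv : v ∉ D) (hv' : v ∉ D') :
    signature M cs (v :: D) = signature M cs (v :: D') := by
  simp only [signature, List.cons.injEq, List.map_inj_left, List.length_cons] at h ⊢
  refine ⟨by omega, fun c hc => ?_⟩
  have := h.2 c hc
  rw [hits_cons c hv, hits_cons c hv']
  omega

theorem subset_insertSig : R ⊆ insertSig M cs R D := by
  unfold insertSig
  cases R.any _ <;> simp

theorem mem_insertSig (h : X ∈ insertSig M cs R D) : X ∈ R ∨ X = D := by
  unfold insertSig at h
  cases hc : R.any fun D' => decide (signature M cs D' = signature M cs D) <;> simp [hc] at h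
  · exact h.symm
  · exact .inl h

theorem exists_mem_insertSig : ∃ X ∈ insertSig M cs R D, signature M cs X = signature M cs D := by
  unfold insertSig
  cases hc : R.any fun D' => decide (signature M cs D' = signature M cs D)
  · exact ⟨D, by simp, rfl⟩
  · simpa using hc

theorem nodup_insertSig (h : (R.map (signature M cs)).Nodup) :
    ((insertSig M cs R D).map (signature M cs)).Nodup := by
  unfold insertSig
  cases hc : R.any fun D' => decide (signature M cs D' = signature M cs D)
  · refine List.nodup_cons.2 ⟨fun hm => ?_, h⟩
    obtain ⟨X, hX, e⟩ := List.mem_map.1 hm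
    have : R.any (fun D' => decide (signature M cs D' = signature M cs D)) = true :=
      List.any_eq_true.2 ⟨X, hX, by simpa using e⟩
    simp [this] at hc
  · exact h

/-- The invariants of `extendBy`. There the list run through is the starting list itself; the
induction needs the two to vary separately. -/
theorem foldl_insertSig (L : List (List (List Bool))) (h : (R.map (signature M cs)).Nodup) :
    R ⊆ L.foldl (fun R' D => insertSig M cs R' (v :: D)) R ∧
    (∀ X ∈ L.foldl (fun R' D => insertSig M cs R' (v :: D)) R, X ∈ R ∨ ∃ D ∈ L, X = v :: D) ∧
    (∀ D ∈ L, ∃ X ∈ L.foldl (fun R' D => insertSig M cs R' (v :: D)) R,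
      signature M cs X = signature M cs (v :: D)) ∧
    ((L.foldl (fun R' D => insertSig M cs R' (v :: D)) R).map (signature M cs)).Nodup := by
  induction L generalizing R with
  | nil => simpa using h
  | cons D L ih =>
    obtain ⟨h1, h2, h3, h4⟩ := ih (nodup_insertSig (D := v :: D) h)
    refine ⟨fun X hX => h1 (subset_insertSig hX), fun X hX => ?_, fun D' hD' => ?_, h4⟩
    · rcases h2 X hX with h5 | ⟨D', hD', rfl⟩
      · rcases mem_insertSig h5 with h5 | rfl
        · exact .inl h5
        · exact .inr ⟨D, by simp, rfl⟩
      · exact .inr ⟨D', by simp [hD'], rfl⟩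
    · rcases List.mem_cons.1 hD' with rfl | hD'
      · obtain ⟨X, hX, e⟩ := exists_mem_insertSig (M := M) (cs := cs) (R := R) (D := v :: D')
        exact ⟨X, h1 hX, e⟩
      · exact h3 D' hD'

theorem representatives_append (vars : List (List Bool)) :
    representatives M cs (vars ++ [v]) = extendBy M cs (representatives M cs vars) v := by
  simp [representatives]

/-- Variables are added in front, whence the reversal. Distinct signatures are what keeps the list
short. -/
theorem representatives_spec (vars : List (List Bool)) :
    (∀ X ∈ representatives M cs vars, X.Sublist vars.reverse) ∧
    ((representatives M cs vars).map (signature M cs)).Nodup := by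
  induction vars using List.reverseRecOn with
  | nil => simp [representatives]
  | append_singleton vars v ih =>
    rw [representatives_append, List.reverse_append, List.reverse_singleton]
    obtain ⟨-, h2, -, h4⟩ := foldl_insertSig (v := v) (representatives M cs vars) ih.2
    refine ⟨fun X hX => ?_, h4⟩
    rcases h2 X hX with h | ⟨D, hD, rfl⟩
    · exact (ih.1 X h).cons _
    · exact (ih.1 D hD).cons_cons _

theorem representatives_complete (vars : List (List Bool)) (hv : vars.Nodup)
    (hD : D.Sublist vars.reverse) :
    ∃ X ∈ representatives M cs vars, signature M cs X = signature M cs D := by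
  induction vars using List.reverseRecOn generalizing D with
  | nil => exact ⟨[], by simp [representatives], by rw [List.sublist_nil.1 hD]⟩
  | append_singleton vars v ih =>
    rw [List.nodup_append] at hv
    obtain ⟨hv, -, hd⟩ := hv
    have hmem : ∀ Y : List (List Bool), Y.Sublist vars.reverse → v ∉ Y := fun Y hY hvY =>
      hd v (List.mem_reverse.1 (hY.subset hvY)) v (by simp) rfl
    rw [representatives_append]
    obtain ⟨h1, -, h3, -⟩ := foldl_insertSig (v := v) (representatives M cs vars)
      (representatives_spec (M := M) (cs := cs) vars).2
    rw [List.reverse_append, List.reverse_singleton, List.singleton_append,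
      List.sublist_cons_iff] at hD
    -- If `D` contains the last variable, its rest is exchanged for a representative `X`, and then
    -- `v :: X` for the assignment `Y` kept with that signature.
    rcases hD with hD | ⟨D, rfl, hD⟩
    · obtain ⟨X, hX, e⟩ := ih hv hD
      exact ⟨X, h1 hX, e⟩
    · obtain ⟨X, hX, e⟩ := ih hv hD
      obtain ⟨Y, hY, e'⟩ := h3 X hX
      exact ⟨Y, hY, e'.trans (signature_cons e
        (hmem X ((representatives_spec vars).1 X hX)) (hmem D hD))⟩

/-- Such lists are the value lists of maps `Fin n → Fin (M + 1)`. -/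
theorem length_le_pow {l : List (List ℕ)} (hl : l.Nodup) {n M : ℕ}
    (h : ∀ x ∈ l, x.length = n ∧ ∀ y ∈ x, y ≤ M) : l.length ≤ (M + 1) ^ n := by
  classical
  have h1 : l.toFinset ⊆ Finset.univ.image fun f : Fin n → Fin (M + 1) =>
      List.ofFn fun i => (f i : ℕ) := by
    intro x hx
    obtain ⟨rfl, hx⟩ := h x (List.mem_toFinset.1 hx)
    refine Finset.mem_image.2 ⟨fun i => ⟨x[i], Nat.lt_succ_of_le (hx _ (by simp))⟩,
      Finset.mem_univ _, ?_⟩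
    exact List.ofFn_getElem
  have h2 := (Finset.card_le_card h1).trans Finset.card_image_le
  rw [List.toFinset_card_of_nodup hl] at h2
  simpa using h2

theorem length_representatives (vars : List (List Bool)) :
    (representatives M cs vars).length ≤ (M + 1) ^ (cs.length + 1) := by
  have := length_le_pow (representatives_spec (M := M) (cs := cs) vars).2 (n := cs.length + 1)
    (M := M) fun x hx => by
      obtain ⟨X, -, rfl⟩ := List.mem_map.1 hx
      refine ⟨by simp [signature], fun y hy => ?_⟩
      rcases List.mem_cons.1 hy with rfl | hy
      · exact min_le_left _ _
      · obtain ⟨c, -, rfl⟩ := List.mem_map.1 hy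
        exact min_le_left _ _
  rwa [List.length_map] at this

/-- Here `l₁` is the part of the variables already processed; the bound in terms of the whole list
is the one that the fold needs. -/
theorem size_representatives_le (l₁ l₂ : List (List Bool)) :
    size (representatives M cs l₁) ≤
      (M + 1) ^ (cs.length + 1) * (size (l₁ ++ l₂) + 1) + 1 := by
  refine (size_le_of_forall (n := size (l₁ ++ l₂)) fun X hX => ?_).trans ?_
  · refine (size_sublist ((representatives_spec l₁).1 X hX)).trans ?_
    rw [size_reverse]
    exact size_sublist (List.sublist_append_left l₁ l₂)
  · exact Nat.add_le_add_right (Nat.mul_le_mul_right _ (length_representatives l₁)) _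

/-- The test sees hit numbers only after truncation, and as `k` lies strictly below the bound, the
truncated size decides whether the size is `k`. -/
theorem checkAssignment_congr {T : List Bool} {k : ℕ} (hk : k < T.length - 1)
    (h : signature (T.length - 1) cs D = signature (T.length - 1) cs D') :
    checkAssignment T k cs D = checkAssignment T k cs D' := by
  simp only [signature, List.cons.injEq, List.map_inj_left] at h
  unfold checkAssignment
  congr 1
  · congr 1
    exact propext ⟨fun _ => by omega, fun _ => by omega⟩
  · rw [Bool.eq_iff_iff, List.all_eq_true, List.all_eq_true]
    exact forall₂_congr fun c hc => by rw [h.2 c hc]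

theorem solve_iff {T : List Bool} {q : RawInstance} (hk : binVal q.1 < T.length - 1)
    (hq : q.2.1.Nodup) : solve T q = true ↔
      ∃ D : List (List Bool), D.Sublist q.2.1.reverse ∧
        checkAssignment T (binVal q.1) q.2.2 D = true := by
  rw [solve, List.any_eq_true]
  constructor
  · rintro ⟨D, hD, h⟩
    exact ⟨D, (representatives_spec _).1 D hD, h⟩
  · rintro ⟨D, hD, h⟩
    obtain ⟨X, hX, e⟩ := representatives_complete (M := T.length - 1) (cs := q.2.2) _ hq hD
    exact ⟨X, hX, by rwa [checkAssignment_congr hk e]⟩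

theorem Instance.satisfiable_iff {E : Set ℕ} (I : Instance (weightLanguage E)) :
    I.Satisfiable ↔ ∃ D : List (List Bool), D.Sublist I.vars.reverse ∧ D.length = I.weight ∧
      ∀ c ∈ I.raw.2.2, hits c D ∈ E := by
  have h1 (D : Finset (List Bool)) : (AppliedRelation.mk I.vars.length
      (weightRel {I.weight} I.vars.length) I.vars.get).SatisfiedBy D ↔
      (I.vars.countP fun w => decide (w ∈ D)) = I.weight := by
    have h2 := card_filter_fin I.vars.get (· ∈ D)
    rw [List.ofFn_get] at h2
    rw [← h2]
    exact Iff.rfl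
  have h2 (D : Finset (List Bool)) (c : Constraint (weightLanguage E)) :
      c.toApplied.SatisfiedBy D ↔
      ((List.ofFn c.scope).countP fun w => decide (w ∈ D)) ∈ E := by
    rw [← card_filter_fin c.scope (· ∈ D)]
    exact Iff.rfl
  have hn : I.vars.reverse.Nodup := List.nodup_reverse.2 I.vars_nodup
  simp only [Satisfiable, C, raw, List.mem_cons, List.mem_map, forall_eq_or_imp,
    forall_exists_index, and_imp, forall_apply_eq_imp_iff₂, h1, h2]
  constructor
  · rintro ⟨D, -, hw, hc⟩
    -- The set `D` is listed in the order in which the dynamic program produces assignments.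
    refine ⟨I.vars.reverse.filter fun w => decide (w ∈ D), List.filter_sublist, ?_, fun c hcI => ?_⟩
    · rw [← List.countP_eq_length_filter, ← hw]
      exact (List.reverse_perm I.vars).countP_eq _
    · convert hc c hcI using 1
      refine List.countP_congr fun w hwc => ?_
      obtain ⟨j, rfl⟩ := (List.mem_ofFn' _ _).1 hwc
      simp [I.scope_mem c hcI j]
  · rintro ⟨D, hD, hw, hc⟩
    refine ⟨D.toFinset, fun v hv => ?_, ?_, fun c hcI => ?_⟩
    · simpa [V] using hD.subset (List.mem_toFinset.1 hv)
    · rw [← hw, List.countP_eq_length_filter]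
      refine List.Perm.length_eq ((List.perm_ext_iff_of_nodup (I.vars_nodup.filter _)
        (hn.sublist hD)).2 fun v => ?_)
      have : v ∈ D → v ∈ I.vars.reverse := fun h => hD.subset h
      simp at this ⊢
      tauto
    · convert hc c hcI using 1
      simp [hits]

open scoped Classical in
/-- The table of membership in `E` of the numbers up to `M`. -/
noncomputable def memTable (E : Set ℕ) (M : ℕ) : List Bool :=
  (List.range (M + 1)).map fun j => decide (j ∈ E)

theorem solve_memTable {E : Set ℕ} (I : Instance (weightLanguage E)) {M : ℕ} (hM : I.weight < M)
    (h : ∀ D : List (List Bool), D.Sublist I.vars.reverse → D.length = I.weight →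
      ∀ c ∈ I.raw.2.2, (min M (hits c D) ∈ E ↔ hits c D ∈ E)) :
    solve (memTable E M) I.raw = true ↔ I.Satisfiable := by
  have hl : (memTable E M).length - 1 = M := by simp [memTable]
  have hb : binVal I.raw.1 = I.weight := binVal_encodeNat _
  rw [solve_iff (by rw [hl, hb]; exact hM) I.vars_nodup, I.satisfiable_iff]
  refine exists_congr fun D => and_congr_right fun hD => ?_
  rw [checkAssignment, hl, hb, Bool.and_eq_true, decide_eq_true_eq, List.all_eq_true]
  refine and_congr_right fun hw => forall₂_congr fun c hc => ?_
  rw [← h D hD hw c hc]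
  have hlt : min M (hits c D) < M + 1 := by omega
  simp [memTable, hlt]

theorem countP_le_maxOcc {vars : List (List Bool)} {c : List (List Bool)} (hv : v ∈ vars)
    (hc : c ∈ cs) : (c.countP fun w => decide (w = v)) ≤ maxOcc vars cs := by
  have h1 := ((foldl_max_le_iff _ 0 _).1 le_rfl).2 _
    (List.mem_map.2 ⟨c, hc, rfl⟩ : (c.countP fun w => decide (w = v)) ∈
      cs.map fun c => c.countP fun w => decide (w = v))
  exact h1.trans (((foldl_max_le_iff _ 1 _).1 le_rfl).2 _ (List.mem_map.2 ⟨v, hv, rfl⟩))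

/-- Each variable of `D` accounts for at most `maxOcc vars cs` positions. This is the only place
where the parameter `e` bounds anything in the correctness argument. -/
theorem hits_le {vars : List (List Bool)} {c : List (List Bool)} (hD : D ⊆ vars)
    (hn : D.Nodup) (hc : c ∈ cs) : hits c D ≤ D.length * maxOcc vars cs := by
  induction D with
  | nil => simp [hits]
  | cons v D ih =>
    obtain ⟨h1, h2⟩ := List.nodup_cons.1 hn
    rw [hits_cons c h1, List.length_cons, Nat.add_mul, one_mul, add_comm]
    exact add_le_add (ih (fun x hx => hD (List.mem_cons_of_mem _ hx)) h2)
      (countP_le_maxOcc (hD List.mem_cons_self) hc)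

end Correctness

/-! ### The time of the decision procedure -/

section Time

variable {B : TM2ComputableAux Letter Bool} {α : Type} [TreeRep α] {μ : Meas α}

namespace PolyIn

theorem hits {c D : α → List (List Bool)} (hc : PolyIn B μ c) (hD : PolyIn B μ D) :
    PolyIn B μ fun a => hits (c a) (D a) :=
  hc.countP (c := fun a w => decide (w ∈ D a)) (PolyIn.id.snd.memWord hD.lift)

theorem signature {M : α → ℕ} {cs : α → List (List (List Bool))} {D : α → List (List Bool)}
    (hM : PolyIn B μ M) (hc : PolyIn B μ cs) (hD : PolyIn B μ D) :
    PolyIn B μ fun a => signature (M a) (cs a) (D a) :=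
  (hM.min hD.length).cons (hc.map (g := fun a c => Min.min (M a) (ParamCSP.hits c (D a)))
    (hM.lift.min (PolyIn.id.snd.hits hD.lift)))

theorem insertSig {M : α → ℕ} {cs R : α → List (List (List Bool))} {D : α → List (List Bool)}
    (hM : PolyIn B μ M) (hc : PolyIn B μ cs) (hR : PolyIn B μ R) (hD : PolyIn B μ D) :
    PolyIn B μ fun a => insertSig (M a) (cs a) (R a) (D a) :=
  (hR.any (c := fun a D' => decide (ParamCSP.signature (M a) (cs a) D' =
    ParamCSP.signature (M a) (cs a) (D a))) ((hM.lift.signature hc.lift PolyIn.id.snd).eqNats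
      (hM.lift.signature hc.lift hD.lift))).cond hR (hD.cons hR)

theorem extendBy {M : α → ℕ} {cs R : α → List (List (List Bool))} {v : α → List Bool}
    (hM : PolyIn B μ M) (hc : PolyIn B μ cs) (hR : PolyIn B μ R) (hv : PolyIn B μ v) :
    PolyIn B μ fun a => extendBy (M a) (cs a) (R a) (v a) := by
  refine foldl (g := fun a R' D => ParamCSP.insertSig (M a) (cs a) R' (v a :: D))
    (b := fun a => size (v a) + size (R a) + 2) hR hR ?_
    ((hv.polyBd.add hR.polyBd).add (PolyBd.const 2)) fun a D hD R' => ?_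
  · exact hM.lift.insertSig hc.lift PolyIn.id.snd.fst (hv.lift.cons PolyIn.id.snd.snd)
  · have := size_mem hD
    unfold ParamCSP.insertSig
    cases R'.any _ <;> simp only [cond_true, cond_false, size_cons] <;> omega

/-- The number of signatures is the only exponential quantity in this recursion; `hb` requires the
measure to pay for it. -/
theorem representatives {M : α → ℕ} {cs : α → List (List (List Bool))}
    {vars : α → List (List Bool)} (hM : PolyIn B μ M) (hc : PolyIn B μ cs)
    (hv : PolyIn B μ vars) (hb : PolyBd μ.val fun a => (M a + 1) ^ ((cs a).length + 1)) :
    PolyIn B μ fun a => representatives (M a) (cs a) (vars a) := by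
  refine foldl_of_le (g := fun a => ParamCSP.extendBy (M a) (cs a))
    (b := fun a => (M a + 1) ^ ((cs a).length + 1) * (size (vars a) + 1) + 1) hv (const [[]])
    (hM.lift.extendBy hc.lift PolyIn.id.snd.fst PolyIn.id.snd.snd)
    ((hb.mul (hv.polyBd.add (PolyBd.const 1))).add (PolyBd.const 1)) fun a l₁ l₂ e => ?_
  rw [e]
  exact size_representatives_le l₁ l₂

theorem solve {T : α → List Bool} {q : α → RawInstance} (hT : PolyIn B μ T) (hq : PolyIn B μ q)
    (hk : PolyBd μ.val fun a => ParamCSP.binVal (q a).1)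
    (hb : PolyBd μ.val fun a => ((T a).length - 1 + 1) ^ ((q a).2.2.length + 1)) :
    PolyIn B μ fun a => solve (T a) (q a) := by
  have hk' := hq.fst.binVal hk
  refine (representatives hT.length.pred hq.snd.snd hq.snd.fst hb).any
    (c := fun a D => checkAssignment (T a) (ParamCSP.binVal (q a).1) (q a).2.2 D) ?_
  refine (PolyIn.id.snd.length.eqNat hk'.lift).and (hq.lift.snd.snd.all
    (c := fun p c => (T p.1).getD (Min.min ((T p.1).length - 1) (ParamCSP.hits c p.2)) false) ?_)
  exact getD hT.lift.lift (hT.lift.lift.length.pred.min (PolyIn.id.snd.hits PolyIn.id.fst.snd)) false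

end PolyIn

end Time

end

section

/-! ### Computable bounds -/

/-- Natural coefficients satisfy `c ≤ c * c`, and each term is at most the whole sum. The inequality
splits a time bound into a factor for the parameter and one for the length. -/
theorem poly_mul_le (p : Polynomial ℕ) (m n : ℕ) : p.eval (m * n) ≤ p.eval m * p.eval n := by
  simp only [Polynomial.eval_eq_sum_range]
  rw [Finset.sum_mul]
  refine Finset.sum_le_sum fun i hi => ?_
  calc p.coeff i * (m * n) ^ i ≤ (p.coeff i * p.coeff i) * (m * n) ^ i :=
        Nat.mul_le_mul_right _ (Nat.le_mul_self _)
    _ = p.coeff i * m ^ i * (p.coeff i * n ^ i) := by rw [mul_pow]; ring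
    _ ≤ _ := Nat.mul_le_mul_left _ (Finset.single_le_sum
        (f := fun i => p.coeff i * n ^ i) (fun _ _ => Nat.zero_le _) hi)

theorem primrec_pow : Primrec₂ ((· ^ ·) : ℕ → ℕ → ℕ) := Primrec₂.unpaired'.1 Nat.Primrec.pow

theorem primrec_poly (p : Polynomial ℕ) : Primrec fun n => p.eval n := by
  induction p using Polynomial.induction_on' with
  | add p q hp hq => exact (Primrec.nat_add.comp hp hq).of_eq fun n => by simp
  | monomial k c =>
    exact (Primrec.nat_mul.comp (Primrec.const c) (primrec_pow.comp Primrec.id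
      (Primrec.const k))).of_eq fun n => by simp

theorem computable_sum {F : ℕ → ℕ} (hF : Computable F) :
    Computable fun n => ∑ j ∈ Finset.range n, F j := by
  refine (Computable.nat_rec Computable.id (Computable.const 0)
    (h := fun _ p => p.2 + F p.1) (Primrec.nat_add.to_comp.comp (Computable.snd.comp Computable.snd)
      (hF.comp (Computable.fst.comp Computable.snd)))).of_eq fun n => ?_
  change Nat.rec (motive := fun _ => ℕ) 0 (fun y IH => IH + F y) n = _
  induction n with
  | zero => rfl
  | succ n ih => rw [Finset.sum_range_succ, ← ih]

/-! ### Fixed-parameter tractability from the decision procedure -/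

/-- The size plus another function as a measure. -/
def Meas.sizeAdd {α : Type} [TreeRep α] (S : α → ℕ) : Meas α :=
  ⟨fun a => ParamCSP.size a + S a, fun _ => Nat.le_add_right _ _⟩

theorem Meas.polyBd_sizeAdd {α : Type} [TreeRep α] (S : α → ℕ) :
    PolyBd (Meas.sizeAdd S).val S :=
  PolyBd.self.mono fun _ => Nat.le_add_left _ _

/-- The data of the instance with the word `x`, or the data of an unsatisfiable instance. -/
def normalize (x : List Letter) : RawInstance :=
  bif validBlocks (parse x) then rawInstance (parse x) else ([true], [], [])

theorem normalize_encode {E : Set ℕ} (I : Instance (weightLanguage E)) :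
    normalize I.encode = I.raw := by
  rw [normalize, I.parse_encode, I.validBlocks_blocks, I.rawInstance_blocks, cond_true]

theorem normalize_of_not {E : Set ℕ} {x : List Letter}
    (h : ¬ ∃ I : Instance (weightLanguage E), I.encode = x) :
    normalize x = ([true], [], []) := by
  rw [← validBlocks_iff, Bool.not_eq_true] at h
  rw [normalize, h, cond_false]

theorem mem_weightedCSP_encode {E : Set ℕ} (I : Instance (weightLanguage E)) :
    I.encode ∈ weightedCSP (weightLanguage E) ↔ I.Satisfiable :=
  ⟨fun ⟨_, h, hJ⟩ => Instance.encode_injective _ h ▸ hJ, fun h => ⟨I, rfl, h⟩⟩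

/-! ### From polynomial time in size plus `S` to fixed-parameter time -/

section Decide

variable {E : Set ℕ} {B : TM2ComputableAux Letter Bool} {g M S : RawInstance → ℕ} {G : ℕ → ℕ}

theorem solve_normalize
    (h : ∀ I : Instance (weightLanguage E),
      solve (memTable E (M I.raw)) I.raw = true ↔ I.Satisfiable) (x : List Letter) :
    solve (memTable E (M (normalize x))) (normalize x) = true ↔
      x ∈ weightedCSP (weightLanguage E) := by
  by_cases hx : ∃ I : Instance (weightLanguage E), I.encode = x
  · obtain ⟨I, rfl⟩ := hx
    rw [normalize_encode, h, mem_weightedCSP_encode]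
  · rw [normalize_of_not hx]
    refine iff_of_false ?_ fun ⟨I, hI, _⟩ => hx ⟨I, hI⟩
    -- The substitute has weight 1 and no variables, so only the empty assignment is tested, and it
    -- fails.
    simp [solve, representatives, checkAssignment, binVal]

theorem fixedParameterTractable_of_solve (hg : PolyIn haltMachine (.size RawInstance) g)
    (hT : PolyIn B (.sizeAdd S) fun q => memTable E (M q))
    (hk : PolyBd (Meas.sizeAdd S).val fun q => binVal q.1)
    (hM : PolyBd (Meas.sizeAdd S).val fun q => (M q + 1) ^ (q.2.2.length + 1))
    (h : ∀ I : Instance (weightLanguage E),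
      solve (memTable E (M I.raw)) I.raw = true ↔ I.Satisfiable)
    (hS : ∀ I : Instance (weightLanguage E), S I.raw ≤ G (I.k + g I.raw)) (hG : Computable G) :
    FixedParameterTractable (weightedCSP (weightLanguage E))
      (parameterOnWords fun I : Instance (weightLanguage E) => I.k + g I.raw) := by
  refine ⟨polynomial_parameterization hg, ?_⟩
  set κ := parameterOnWords fun I : Instance (weightLanguage E) => I.k + g I.raw
  have hsolve : PolyIn B (.sizeAdd S) fun q => solve (memTable E (M q)) q :=
    hT.solve PolyIn.id hk (hM.mono fun q => by simp [memTable])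
  have hp : PolyIn B (.sizeAdd fun x => S (normalize x)) fun x : List Letter => parse x :=
    PolyIn.id.parse
  have hn : PolyIn B (.sizeAdd fun x => S (normalize x)) normalize :=
    hp.validBlocks.cond hp.raw (PolyIn.const _)
  have hf := (hsolve.comp' hn (hn.polyBd.add (Meas.polyBd_sizeAdd _))).cons (PolyIn.const [])
  obtain ⟨N, p, hN⟩ := hf.exists_machine
  -- The cost of the substitute instance, for words that are not instances.
  set s := S ([true], [], [])
  -- The measure plus the length is at most `G (κ x) + s + (9 * |x| + 1)`, hence at most the product
  -- `(G (κ x) + s + 1) * (9 * |x| + 2)`, to which `poly_mul_le` applies.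
  refine ⟨N, fun n => p.eval (G n + s + 1), p.comp (9 * Polynomial.X + 2), ?_, fun x => ?_⟩
  · exact (primrec_poly p).to_comp.comp (Primrec.succ.to_comp.comp
      (Primrec.nat_add.to_comp.comp hG (Computable.const s)))
  refine ⟨_, solve_normalize h x, ⟨(hN x).some.toEvalsTo, (hN x).some.steps_le_m.trans ?_⟩⟩
  rw [Polynomial.eval_comp]
  refine (poly_mono p ?_).trans (poly_mul_le _ _ _)
  have hx : S (normalize x) ≤ G (κ x) + s := by
    by_cases hx : ∃ I : Instance (weightLanguage E), I.encode = x
    · obtain ⟨I, rfl⟩ := hx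
      rw [normalize_encode, show κ I.encode = _ from parameterOnWords_encode _ I]
      exact (hS I).trans (Nat.le_add_right _ _)
    · rw [normalize_of_not hx]
      exact Nat.le_add_left _ _
  have := size_words x
  simp only [Polynomial.eval_add, Polynomial.eval_mul, Polynomial.eval_X, Polynomial.eval_ofNat]
  change size x + S (normalize x) + x.length ≤ _
  nlinarith

theorem fixedParameterTractable_congr {param param' : Instance (weightLanguage E) → ℕ}
    (h : FixedParameterTractable (weightedCSP (weightLanguage E)) (parameterOnWords param'))
    (e : ∀ I, param I = param' I) :
    FixedParameterTractable (weightedCSP (weightLanguage E)) (parameterOnWords param) := by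
  rwa [show param = param' from funext e]

end Decide

theorem pow_length_le {a b n : ℕ} {l : List (List (List Bool))} (h : a ≤ b) (hb : 0 < b)
    (hl : l.length + 1 ≤ n) : a ^ (l.length + 1) ≤ b ^ n :=
  (Nat.pow_le_pow_left h _).trans (Nat.pow_le_pow_right hb hl)

/-! ### Fpt membership checkable languages -/

section Oracle

variable {E : Set ℕ} {B : TM2ComputableAux Letter Bool} {f : ℕ → ℕ} {c : ℕ}

/-- The question whether `j` belongs to `E`, as a word. -/
def membershipQuery (j : ℕ) : List Letter :=
  encodeBlock (max j 1) ((List.range j).map fun t => encodeNat (t + 1))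

open scoped Classical in
-- A set of `j` positions belongs to the relation exactly if `j ∈ E`, so one set per `j` is enough:
-- all positions of the relation with index `j`.
theorem membershipQuery_outputs
    (h : ∀ (i : ℕ+) (T : Finset (Fin ((weightLanguage E).arity i))),
      AnswersWithin B (encodeBlock i (T.sort.map fun j => encodeNat (j.val + 1)))
        (T ∈ (weightLanguage E).rel i) (f T.card * (i : ℕ).size ^ c)) (j : ℕ) :
    Nonempty (TM2OutputsInTime B.tm ((membershipQuery j).map B.inputAlphabet.invFun)
      (some ((encodeBool (decide (j ∈ E))).map B.outputAlphabet.invFun)) (f j * (j + 1) ^ c)) := by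
  have h' : ∀ (n : ℕ), 0 < n → ∀ T : Finset (Fin n),
      AnswersWithin B (encodeBlock n (T.sort.map fun j => encodeNat (j.val + 1)))
        (T.card ∈ E) (f T.card * n.size ^ c) := fun n hn T => h ⟨n, hn⟩ T
  have key : AnswersWithin B (membershipQuery j) (j ∈ E) (f j * (max j 1).size ^ c) := by
    rcases j with _ | n
    -- Indices start at 1, so the number 0 is tested by the empty set in the relation of arity 1.
    · simpa only [Finset.sort_empty] using! h' 1 one_pos ∅
    · have h1 := h' (n + 1) n.succ_pos Finset.univ
      have h2 : ((Finset.univ : Finset (Fin (n + 1))).sort.map fun j => encodeNat (j.val + 1)) =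
          (List.range (n + 1)).map fun t => encodeNat (t + 1) := by
        rw [Fin.sort_univ, ← List.map_coe_finRange_eq_range, List.map_map]
        rfl
      rw [h2, Finset.card_fin] at h1
      rwa [membershipQuery, max_eq_left (Nat.le_add_left 1 n)]
  obtain ⟨b, hb, ⟨h1⟩⟩ := key
  have e : b = decide (j ∈ E) := by rw [Bool.eq_iff_iff, hb, decide_eq_true_eq]
  rw [← e]
  refine ⟨⟨h1.toEvalsTo, h1.steps_le_m.trans (Nat.mul_le_mul_left _ (Nat.pow_le_pow_left ?_ _))⟩⟩
  -- The index is at most `j + 1`, which is less than `2 ^ (j + 1)`.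
  refine Nat.size_le.2 (lt_of_le_of_lt ?_ (Nat.lt_two_pow_self (n := j + 1)))
  omega

namespace PolyIn

variable {α β γ : Type} [TreeRep α] [TreeRep β] [TreeRep γ] {μ : Meas α}

theorem flatMap {l : α → List β} {g : α → β → List γ} (hl : PolyIn B μ l)
    (hg : PolyIn B (μ.ctx β) fun p => g p.1 p.2) : PolyIn B μ fun a => (l a).flatMap (g a) := by
  obtain ⟨b, hb, hgb⟩ := bd_of_mem hl hg
  refine (foldl (g := fun a s x => s ++ g a x) hl (const []) (PolyIn.id.snd.fst.append hg.step) hb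
    fun a x hx s => ?_).congr fun a => List.flatMap_eq_foldl
  have h1 := hgb a x hx
  have h2 := size_append s (g a x)
  omega

theorem mapBit {f : α → List Bool} (hf : PolyIn B μ f) :
    PolyIn B μ fun a => (f a).map Letter.bit :=
  hf.of_rep fun _ => rep_map_bit _

theorem encodeBlock {n : α → ℕ} {ws : α → List (List Bool)} (hn : PolyIn B μ n)
    (hw : PolyIn B μ ws) : PolyIn B μ fun a => encodeBlock (n a) (ws a) :=
  hn.encodeNat.mapBit.append (hw.flatMap (g := fun _ w => Letter.comma :: w.map Letter.bit)
    ((const Letter.comma).cons PolyIn.id.snd.mapBit))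

theorem membershipQuery {f : α → ℕ} (hf : PolyIn B μ f) :
    PolyIn B μ fun a => membershipQuery (f a) :=
  (hf.max (const 1)).encodeBlock
    (hf.range.map (g := fun _ t => Computability.encodeNat (t + 1)) PolyIn.id.snd.succ.encodeNat)

open scoped Classical in
-- No monotonicity of `F` is available, so the sum over all queries serves as bound for each of
-- them.
theorem memTable_of_queries {F : ℕ → ℕ}
    (h : ∀ j, Nonempty (TM2OutputsInTime B.tm
      ((ParamCSP.membershipQuery j).map B.inputAlphabet.invFun)
      (some ((encodeBool (decide (j ∈ E))).map B.outputAlphabet.invFun)) (F j)))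
    {M : α → ℕ} (hM : PolyIn B μ M)
    (hF : PolyBd μ.val fun a => ∑ j ∈ Finset.range (M a + 1), F j) :
    PolyIn B μ fun a => memTable E (M a) := by
  refine map' (ν := .sizeAdd fun p => F p.2) (g := fun _ j => decide (j ∈ E))
    (b := fun a => (size a + size (M a) + 1) + ∑ j ∈ Finset.range (M a + 1), F j) hM.succ.range
    (ask PolyIn.id.snd.membershipQuery (Meas.polyBd_sizeAdd _) fun p => h p.2)
    (((μ.polyBd_size.add hM.polyBd).add (PolyBd.const 1)).add hF) fun a j hj => ?_
  have h1 := List.mem_range.1 hj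
  have h2 : F j ≤ ∑ j ∈ Finset.range (M a + 1), F j :=
    Finset.single_le_sum (fun _ _ => Nat.zero_le _) (Finset.mem_range.2 h1)
  change size (a, j) + F j ≤ _
  rw [size_pair, size_nat, size_nat]
  omega

end PolyIn

theorem fixedParameterTractable_of_queries (hf : Computable f)
    (h : ∀ (i : ℕ+) (T : Finset (Fin ((weightLanguage E).arity i))),
      AnswersWithin B (encodeBlock i (T.sort.map fun j => encodeNat (j.val + 1)))
        (T ∈ (weightLanguage E).rel i) (f T.card * (i : ℕ).size ^ c)) :
    FixedParameterTractable (weightedCSP (weightLanguage E))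
      (parameterOnWords fun I : Instance (weightLanguage E) => I.k + I.u + I.e) := by
  let F : ℕ → ℕ := fun j => f j * (j + 1) ^ c
  -- The summand `k * e` keeps all hit numbers untruncated, and `k + 1` ensures `k < M`.
  let M : RawInstance → ℕ := fun q => binVal q.1 * RawInstance.e q + binVal q.1 + 1
  let S : RawInstance → ℕ := fun q => binVal q.1 + (M q + 1) ^ (q.2.2.length + 1) +
    ∑ j ∈ Finset.range (M q + 1), F j
  -- For `n = k + u + e` one has `M + 1 ≤ n * n + n + 2`, and the exponent in `S` is `u ≤ n`.
  let G : ℕ → ℕ := fun n => n + (n * n + n + 2) ^ n + ∑ j ∈ Finset.range (n * n + n + 2), F j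
  have hS := Meas.polyBd_sizeAdd S
  have hk : PolyBd (Meas.sizeAdd S).val fun q => binVal q.1 := hS.mono fun q => by
    simp only [S]; omega
  have hb : PolyIn B (.sizeAdd S) fun q => binVal q.1 := PolyIn.id.fst.binVal hk
  refine fixedParameterTractable_congr (fixedParameterTractable_of_solve (M := M) (S := S) (G := G)
    (PolyIn.id.rawU.add PolyIn.id.rawE) (PolyIn.memTable_of_queries (F := F)
      (membershipQuery_outputs h) ((hb.mul PolyIn.id.rawE).add hb).succ (hS.mono fun q => ?_)) hk
    (hS.mono fun q => ?_) (fun I => solve_memTable I ?_ fun D hD hw s hs => ?_) (fun I => ?_) ?_)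
    fun I => ?_
  · simp only [S]; omega
  · simp only [S]; omega
  · have : binVal I.raw.1 = I.weight := binVal_encodeNat _
    simp only [M, this]
    omega
  · have h1 := hits_le (fun v hv => List.mem_reverse.1 (hD.subset hv))
      ((List.nodup_reverse.2 I.vars_nodup).sublist hD) hs
    have h2 : binVal I.raw.1 = I.weight := binVal_encodeNat _
    have h3 : hits s D ≤ M I.raw := by
      rw [hw] at h1
      simp only [M, h2]
      change hits s D ≤ I.weight * RawInstance.e I.raw at h1
      omega
    rw [min_eq_right h3]
  · have h2 : binVal I.raw.1 = I.k := binVal_encodeNat _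
    have h3 : I.raw.2.2.length + 1 = RawInstance.u I.raw := rfl
    set n := I.k + (RawInstance.u I.raw + RawInstance.e I.raw)
    have h4 : M I.raw + 1 ≤ n * n + n + 2 := by
      have : I.k * RawInstance.e I.raw ≤ n * n := Nat.mul_le_mul (by omega) (by omega)
      simp only [M, h2]
      omega
    refine Nat.add_le_add (Nat.add_le_add (by omega) (pow_length_le h4 (by omega) (by omega))) ?_
    exact Finset.sum_le_sum_of_subset (Finset.range_mono h4)
  · have hq : Primrec fun n : ℕ => n * n + n + 2 := Primrec.nat_add.comp (Primrec.nat_add.comp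
      (Primrec.nat_mul.comp Primrec.id Primrec.id) Primrec.id) (Primrec.const 2)
    have hF : Computable F := Primrec.nat_mul.to_comp.comp hf
      (primrec_pow.comp Primrec.succ (Primrec.const c)).to_comp
    exact Primrec.nat_add.to_comp.comp
      (Primrec.nat_add.comp Primrec.id (primrec_pow.comp hq Primrec.id)).to_comp
      ((computable_sum hF).comp hq.to_comp)
  · rw [I.raw_u, I.raw_e, add_assoc]

end Oracle

/-! ### Finite and cofinite sets -/

section Finite

variable {E : Set ℕ}

/-- A finite or cofinite set is constant from some number on. -/
theorem exists_mem_iff_of_finite (h : E.Finite ∨ Eᶜ.Finite) :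
    ∃ b, ∀ n, b ≤ n → (n ∈ E ↔ b ∈ E) := by
  rcases h with h | h
  · obtain ⟨b, hb⟩ := h.bddAbove
    have key : ∀ n, b + 1 ≤ n → n ∉ E := fun n hn hE => absurd (hb hE) (by omega)
    exact ⟨b + 1, fun n hn => iff_of_false (key n hn) (key _ le_rfl)⟩
  · obtain ⟨b, hb⟩ := h.bddAbove
    have key : ∀ n, b + 1 ≤ n → n ∈ E := fun n hn => by
      by_contra hE
      exact absurd (hb hE) (by omega)
    exact ⟨b + 1, fun n hn => iff_of_true (key n hn) (key _ le_rfl)⟩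

open scoped Classical in
-- The values below `b` are a constant built into the program, and the default of `getD` is the
-- common value from `b` on; no subroutine is needed.
theorem PolyIn.memTable_of_iff {B : TM2ComputableAux Letter Bool} {α : Type} [TreeRep α]
    {μ : Meas α} {b : ℕ} (h : ∀ n, b ≤ n → (n ∈ E ↔ b ∈ E)) {M : α → ℕ} (hM : PolyIn B μ M) :
    PolyIn B μ fun a => memTable E (M a) := by
  refine hM.succ.range.map (g := fun _ j => decide (j ∈ E))
    ((getD (const ((List.range b).map fun j => decide (j ∈ E))) PolyIn.id.snd
      (decide (b ∈ E))).congr fun p => ?_)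
  rcases lt_or_ge p.2 b with hp | hp
  · simp [hp]
  · simp [hp, h p.2 hp]

theorem fixedParameterTractable_of_finite (h : E.Finite ∨ Eᶜ.Finite) :
    FixedParameterTractable (weightedCSP (weightLanguage E))
      (parameterOnWords fun I : Instance (weightLanguage E) => I.k + I.u) := by
  obtain ⟨b, hE⟩ := exists_mem_iff_of_finite h
  -- Both `k < M` and `b ≤ M` are needed: a truncated hit number and its truncation `M` lie in the
  -- range where membership is constant.
  let M : RawInstance → ℕ := fun q => binVal q.1 + b + 1
  let S : RawInstance → ℕ := fun q => binVal q.1 + (M q + 1) ^ (q.2.2.length + 1)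
  let G : ℕ → ℕ := fun n => n + (n + b + 2) ^ n
  have hS := Meas.polyBd_sizeAdd S
  have hk : PolyBd (Meas.sizeAdd S).val fun q => binVal q.1 := hS.mono fun q => by
    simp only [S]; omega
  have hb : PolyIn haltMachine (.sizeAdd S) fun q => binVal q.1 := PolyIn.id.fst.binVal hk
  refine fixedParameterTractable_congr (fixedParameterTractable_of_solve (M := M) (S := S) (G := G)
    PolyIn.id.rawU (PolyIn.memTable_of_iff hE (hb.add (PolyIn.const b)).succ) hk
    (hS.mono fun q => ?_) (fun I => solve_memTable I ?_ fun D hD hw s hs => ?_) (fun I => ?_) ?_)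
    fun I => ?_
  · simp only [S]; omega
  · have : binVal I.raw.1 = I.weight := binVal_encodeNat _
    simp only [M, this]
    omega
  · have h1 : b ≤ M I.raw := by simp only [M]; omega
    rcases le_total (M I.raw) (hits s D) with h2 | h2
    · rw [min_eq_left h2, hE _ h1, hE _ (h1.trans h2)]
    · rw [min_eq_right h2]
  · have h2 : binVal I.raw.1 = I.k := binVal_encodeNat _
    have h3 : I.raw.2.2.length + 1 = RawInstance.u I.raw := rfl
    have h4 : M I.raw + 1 ≤ I.k + RawInstance.u I.raw + b + 2 := by
      simp only [M, h2]
      omega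
    exact Nat.add_le_add (by omega) (pow_length_le h4 (by omega) (by omega))
  · have hq : Primrec fun n : ℕ => n + b + 2 := Primrec.nat_add.comp (Primrec.nat_add.comp
      Primrec.id (Primrec.const b)) (Primrec.const 2)
    exact (Primrec.nat_add.comp Primrec.id (primrec_pow.comp hq Primrec.id)).to_comp
  · rw [I.raw_u]

end Finite

end

end ParamCSP

theorem mainTheorem4 (E : Set ℕ) :
    (ParamCSP.FptMembershipCheckable (ParamCSP.weightLanguage E) →
      ParamCSP.FixedParameterTractable
        (ParamCSP.weightedCSP (ParamCSP.weightLanguage E))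
        (ParamCSP.parameterOnWords
          fun I : ParamCSP.Instance (ParamCSP.weightLanguage E) => I.k + I.u + I.e)) ∧
    (E.Finite ∨ Eᶜ.Finite →
      ParamCSP.FixedParameterTractable
        (ParamCSP.weightedCSP (ParamCSP.weightLanguage E))
        (ParamCSP.parameterOnWords
          fun I : ParamCSP.Instance (ParamCSP.weightLanguage E) => I.k + I.u)) := by
  refine ⟨?_, ParamCSP.fixedParameterTractable_of_finite⟩
  rintro ⟨B, f, c, hf, h⟩
  exact ParamCSP.fixedParameterTractable_of_queries hf h
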